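/- Let $n\ge 1$ and $k\ge 2$ be integers, and put $$\rho(2)=\frac18,\qquad \rho(k)=\frac{\lceil k/2\rceil-1}{2k\lceil k/2\rceil+2}\quad (k\ge 3).$$ For a prime $p$ and a primitive root $\vartheta$ of $\mathbb F_{p^n}$ (a generator of $\mathbb F_{p^n}^*$), let $\mathbf a_m=(a_{0,m},\dots,a_{n-1,m})\in\mathbb F_p^n$ be the coordinate vector of $\vartheta^m$ given by $$\vartheta^m=\sum_{j=0}^{n-1}a_{j,m}\vartheta^{j},$$ and, representing $\mathbb F_p$ by $\{0,1,\dots,p-1\}$, regard $\frac1p\mathbf a_m$ as a point of $[0,1]^n$. For $\Omega\subseteq[0,1]^n$ let $N_{\vartheta,k}(\Omega)$ be the number of integers $m\in\{1,\dots,p^n-1\}$ with $\frac1p\mathbf a_{m^k}\in\Omega$. We say that $\Omega$ has piecewise smooth boundary if its boundary is contained in a finite union of images of $[0,1]^{n-1}$ under $C^1$ maps $[0,1]^{n-1}\to\mathbb R^n$ (in particular, every set whose boundary is a finite union of compact $C^1$ pieces of hypersurfaces, possibly with edges and corners, is of this kind). Then there is a function $\delta$, depending only on $n$ and $k$, with $\delta(p)\to0$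 as $p\to\infty$, such that for every $\Omega\subseteq[0,1]^n$ with piecewise smooth boundary there is a constant $C$, depending only on $n$, $k$ and $\Omega$, such that for every prime $p$ and every primitive root $\vartheta$ of $\mathbb F_{p^n}$ $$\bigl|N_{\vartheta,k}(\Omega)-p^n\,\mathrm{vol}\,\Omega\bigr|\le C\,p^{\,n-\rho(k)+\delta(p)}.$$ That is, $N_{\vartheta,k}(\Omega)=p^n\,\mathrm{vol}\,\Omega+O\bigl(p^{n-\rho(k)+o(1)}\bigr)$. -/

import Mathlib

/-- The exponent `ρ(k)`; only its values for `k ≥ 2` are used. -/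
noncomputable def rho (k : ℕ) : ℝ :=
  if k = 2 then 1 / 8
  else ((⌈(k : ℝ) / 2⌉ : ℝ) - 1) / (2 * (k : ℝ) * (⌈(k : ℝ) / 2⌉ : ℝ) + 2)

/-- A field with `p^n` elements has degree `n` over `𝔽_p`. -/
theorem finrank_eq_of_card {p n : ℕ} [Fact p.Prime] {F : Type*} [Field F] [Algebra (ZMod p) F]
    (hF : Nat.card F = p ^ n) : Module.finrank (ZMod p) F = n := by
  have hp : p.Prime := Fact.out
  have : Finite F := Nat.finite_of_card_ne_zero (by rw [hF]; exact pow_ne_zero _ hp.ne_zero)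
  have h := FiniteField.pow_finrank_eq_natCard p F
  exact Nat.pow_right_injective hp.two_le (h.trans hF)

/-- A primitive root of `𝔽_{p^n}` (an element of multiplicative order `p^n - 1`) generates
`𝔽_{p^n}` as an algebra over `𝔽_p`. -/
theorem adjoin_primitiveRoot_eq_top {p n : ℕ} [Fact p.Prime] {F : Type*} [Field F]
    [Algebra (ZMod p) F] (hF : Nat.card F = p ^ n) {θ : F}
    (hθ : IsPrimitiveRoot θ (p ^ n - 1)) : Algebra.adjoin (ZMod p) {θ} = ⊤ := by
  have hp : p.Prime := Fact.out
  have : Finite F := Nat.finite_of_card_ne_zero (by rw [hF]; exact pow_ne_zero _ hp.ne_zero)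
  have : Fintype F := Fintype.ofFinite F
  have hpos : 1 < p ^ n := hF ▸ Finite.one_lt_card
  have : NeZero (p ^ n - 1) := ⟨by omega⟩
  rw [eq_top_iff]
  intro x _
  by_cases hx : x = 0
  · rw [hx]
    exact Subalgebra.zero_mem _
  · have hx1 : x ^ (p ^ n - 1) = 1 := by
      have h := FiniteField.pow_card_sub_one_eq_one x hx
      rwa [← Nat.card_eq_fintype_card, hF] at h
    obtain ⟨i, _, rfl⟩ := hθ.eq_pow_of_pow_eq_one hx1
    exact pow_mem (Algebra.self_mem_adjoin_singleton (ZMod p) θ) i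

/-- The basis `1, θ, …, θ^(n-1)` of `𝔽_{p^n}` over `𝔽_p` given by a primitive root `θ`. -/
noncomputable def primitiveRootBasis {p n : ℕ} [Fact p.Prime] {F : Type*} [Field F]
    [Algebra (ZMod p) F] (hF : Nat.card F = p ^ n) {θ : F}
    (hθ : IsPrimitiveRoot θ (p ^ n - 1)) : Module.Basis (Fin n) (ZMod p) F :=
  have : Finite F := Nat.finite_of_card_ne_zero
    (by rw [hF]; exact pow_ne_zero _ (Fact.out : p.Prime).ne_zero)
  let B := PowerBasis.ofAdjoinEqTop (Algebra.IsIntegral.isIntegral θ)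
    (adjoin_primitiveRoot_eq_top hF hθ)
  B.basis.reindex (finCongr (B.finrank.symm.trans (finrank_eq_of_card hF)))

theorem primitiveRootBasis_apply {p n : ℕ} [Fact p.Prime] {F : Type*} [Field F]
    [Algebra (ZMod p) F] (hF : Nat.card F = p ^ n) {θ : F}
    (hθ : IsPrimitiveRoot θ (p ^ n - 1)) (j : Fin n) :
    primitiveRootBasis hF hθ j = θ ^ (j : ℕ) := by
  unfold primitiveRootBasis
  rw [Module.Basis.reindex_apply, PowerBasis.basis_eq_pow, PowerBasis.ofAdjoinEqTop_gen]
  rfl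

/-- The coordinates `a_m ∈ 𝔽_p^n` of `θ^m`, so that `θ^m = ∑ j, a_{j,m} θ^j`. -/
noncomputable def coordVec {p n : ℕ} [Fact p.Prime] {F : Type*} [Field F]
    [Algebra (ZMod p) F] (hF : Nat.card F = p ^ n) {θ : F}
    (hθ : IsPrimitiveRoot θ (p ^ n - 1)) (m : ℕ) : Fin n → ZMod p :=
  fun j => (primitiveRootBasis hF hθ).repr (θ ^ m) j

theorem sum_coordVec {p n : ℕ} [Fact p.Prime] {F : Type*} [Field F]
    [Algebra (ZMod p) F] (hF : Nat.card F = p ^ n) {θ : F}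
    (hθ : IsPrimitiveRoot θ (p ^ n - 1)) (m : ℕ) :
    ∑ j : Fin n, coordVec hF hθ m j • θ ^ (j : ℕ) = θ ^ m := by
  have h := (primitiveRootBasis hF hθ).sum_repr (θ ^ m)
  simp only [primitiveRootBasis_apply] at h
  exact h

/-- The point `(1/p) a_m` of the unit cube, with `𝔽_p` represented by `0, 1, …, p - 1`. -/
noncomputable def orbitPoint {p n : ℕ} [Fact p.Prime] {F : Type*} [Field F]
    [Algebra (ZMod p) F] (hF : Nat.card F = p ^ n) {θ : F}
    (hθ : IsPrimitiveRoot θ (p ^ n - 1)) (m : ℕ) : Fin n → ℝ :=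
  fun j => ((coordVec hF hθ m j).val : ℝ) / (p : ℝ)

/-- The number of `m = 1, …, p^n - 1` for which the point `(1/p) a_{m^k}` lies in `Ω`
(the points are counted with multiplicity). -/
noncomputable def orbitCount {p n : ℕ} [Fact p.Prime] {F : Type*} [Field F]
    [Algebra (ZMod p) F] (hF : Nat.card F = p ^ n) {θ : F}
    (hθ : IsPrimitiveRoot θ (p ^ n - 1)) (k : ℕ) (Ω : Set (Fin n → ℝ)) : ℕ :=
  Set.ncard {m : ℕ | m ∈ Set.Icc 1 (p ^ n - 1) ∧ orbitPoint hF hθ (m ^ k) ∈ Ω}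

/-- The boundary of `Ω ⊆ ℝ^n` is covered by finitely many `C^1` patches, each parametrized by
the closed unit cube of dimension `n - 1` (a single point if `n = 1`). Every set whose boundary is
a finite union of compact `C^1` (in particular `C^∞`) pieces of hypersurfaces, possibly with
edges and corners, has this property. No regularity of the parametrizations and no
condition on how the patches meet is imposed. -/
def HasPiecewiseSmoothBoundary {n : ℕ} (Ω : Set (Fin n → ℝ)) : Prop :=
  ∃ (r : ℕ) (φ : Fin r → (Fin (n - 1) → ℝ) → (Fin n → ℝ)),
    (∀ i, ContDiffOn ℝ 1 (φ i) (Set.Icc 0 1)) ∧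
      frontier Ω ⊆ ⋃ i, φ i '' Set.Icc 0 1

/-! Put q = p^n. The points equidistribute because every nontrivial additive character ψ of 𝔽_q
satisfies Σ_m ψ(θ^(m^k)) = O(q^(1-σ+ε)) with σ = 1/(2k+4) (`exists_norm_sum_pow_pow_le`), and ρ(k) ≤
σ (`rho_le`).

The exponential sum. Write m = dj with d = gcd(m, q-1) and T = (q-1)/d. If d ≥ q^σ the trivial bound
T is enough. Otherwise j runs over the units modulo T. Consider the primes y ≤ q^(2σ) not dividing
(q-1)p. The k-th powers have index q^(o(1)) in the units, so many of these y share a coset; within a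
coset a substitution in j multiplies j^k by y/y₀ and leaves the sum unchanged. Averaging over y,
applying Cauchy–Schwarz and completing to all residues modulo T (`card_mul_norm_sum_units_sq_le`)
leaves correlations which are, up to the factor 1/d, sums of ψ(x^a - x^b) with a, b ≤ d^k q^(2σ).
Weil's bound controls these.

Weil's bound (`norm_sum_addChar_eval_le`) comes from Stepanov's method. On y^p - y = f(x) the pole
order at infinity gives a monomial basis with distinct weights, and counting dimensions bounds the
number of points from above over fields with s² elements (`card_algHom_le`). The values of Tr f(x)
fall into p classes of known total size, so the upper bound alone gives square-root cancellation,
with a poor constant. The L-function is a polynomial of degree less than deg f, so the sums over all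
extensions are, up to sign, power sums of deg f - 1 numbers. Their growth along extensions of even
degree forces each to have modulus at most √q, and the poor constant disappears.

From sums to counts. Cut the cube into H^n cells with H about p^ρ; only O(H^(n-1)) of them meet the
boundary. Summation by parts along columns joins the cells inside Ω, or those meeting Ω, into
O(H^(n-1)) boxes, each with discrepancy O(q^(1-σ+ε) (log p)^n) by Fourier inversion. The total error
q^(1-σ) H^(n-1) + p^n/H is O(p^(n-ρ)) up to p^ε because ρ ≤ σ. For each ε the constant involves Ω
only through a factor counting boundary cells, so a single δ can be chosen for all Ω. -/

/-! ### Stepanov's method in a ring with a degree function -/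

/-- The largest weight of a basis vector occurring in `a`. -/
noncomputable def weightDegree {E A ι : Type*} [Field E] [CommRing A] [Algebra E A]
    (b : Module.Basis ι E A) (w : ι → ℕ) (a : A) : ℕ := (b.repr a).support.sup w

/-- A basis with injective weights for which the weight degree is multiplicative, and for which
all but at most `g` natural numbers are weights. -/
structure IsDegreeBasis {E A ι : Type*} [Field E] [CommRing A] [Algebra E A]
    (b : Module.Basis ι E A) (w : ι → ℕ) (g : ℕ) : Prop where
  inj : Function.Injective w
  mul : ∀ x y : A, x ≠ 0 → y ≠ 0 → weightDegree b w (x * y) = weightDegree b w x + weightDegree b w y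
  low : ∀ m : ℕ, m + 1 ≤ Nat.card {i // w i ≤ m} + g

section DegreeBasis

variable {E A ι : Type*} [Field E] [CommRing A] [Algebra E A]
  {b : Module.Basis ι E A} {w : ι → ℕ}

theorem weightDegree_le_iff {a : A} {m : ℕ} :
    weightDegree b w a ≤ m ↔ ∀ i, b.repr a i ≠ 0 → w i ≤ m := by
  simp [weightDegree, Finset.sup_le_iff]

theorem repr_eq_zero_of_weightDegree_lt {a : A} {i : ι} (h : weightDegree b w a < w i) :
    b.repr a i = 0 := by
  by_contra h'
  exact absurd (weightDegree_le_iff.1 (le_refl (weightDegree b w a)) i h') (by omega)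

theorem exists_weight_eq_weightDegree {a : A} (ha : a ≠ 0) :
    ∃ i, b.repr a i ≠ 0 ∧ w i = weightDegree b w a := by
  have hne : (b.repr a).support.Nonempty := by
    rw [Finsupp.support_nonempty_iff]
    simpa using ha
  obtain ⟨i, hi, h⟩ := Finset.exists_mem_eq_sup _ hne w
  exact ⟨i, by simpa using hi, h.symm⟩

theorem weightDegree_basis (i : ι) : weightDegree b w (b i) = w i := by
  simp [weightDegree]

variable (b w) in
/-- The elements of weight degree at most `m`. -/
noncomputable def degreeLESpace (m : ℕ) : Submodule E A :=
  (Finsupp.supported E E {i | w i ≤ m}).comap (b.repr : A →ₗ[E] ι →₀ E)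

theorem mem_degreeLESpace {a : A} {m : ℕ} : a ∈ degreeLESpace b w m ↔ weightDegree b w a ≤ m := by
  rw [weightDegree_le_iff]
  simp [degreeLESpace, Finsupp.mem_supported, Set.subset_def]

theorem finite_weight_le (hw : Function.Injective w) (m : ℕ) : Finite {i // w i ≤ m} :=
  Finite.of_injective (fun i => (⟨w i, Nat.lt_succ_of_le i.2⟩ : Fin (m + 1)))
    (fun i j h => Subtype.ext (hw (by simpa using h)))

theorem card_weight_le (hw : Function.Injective w) (m : ℕ) : Nat.card {i // w i ≤ m} ≤ m + 1 := by
  have := Nat.card_le_card_of_injective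
    (fun i : {i // w i ≤ m} => (⟨w i, Nat.lt_succ_of_le i.2⟩ : Fin (m + 1)))
    (fun i j h => Subtype.ext (hw (by simpa using h)))
  simpa using this

/-- Over a finite field dimensions are compared through cardinalities, so a pigeonhole between
finite sets replaces rank computations. With `low` and `card_weight_le` the dimension lies between m
+ 1 - g and m + 1, which is all that is needed of Riemann–Roch. -/
theorem card_degreeLESpace (hw : Function.Injective w) (m : ℕ) :
    Nat.card (degreeLESpace b w m) = Nat.card E ^ Nat.card {i // w i ≤ m} := by
  have := finite_weight_le hw m
  have e1 : degreeLESpace b w m ≃ Finsupp.supported E E {i | w i ≤ m} :=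
    (b.repr.toEquiv.subtypeEquiv (fun a => by rfl))
  have e2 := (Finsupp.supportedEquivFinsupp (R := E) (M := E) {i | w i ≤ m}).toEquiv
  have e3 : ({i | w i ≤ m} →₀ E) ≃ ({i // w i ≤ m} → E) := by
    haveI : Finite ↥{i | w i ≤ m} := this
    exact Finsupp.equivFunOnFinite
  rw [Nat.card_congr (e1.trans (e2.trans e3)), Nat.card_fun]

theorem finite_degreeLESpace [Finite E] (hw : Function.Injective w) (m : ℕ) :
    Finite (degreeLESpace b w m) := by
  refine Nat.finite_of_card_ne_zero ?_
  rw [card_degreeLESpace hw]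
  exact pow_ne_zero _ Nat.card_pos.ne'

/-- Finitely many distinct points admit separating functions. -/
theorem exists_separating (P : Finset (A →ₐ[E] E)) (φ : A →ₐ[E] E) :
    ∃ a : A, φ a ≠ 0 ∧ ∀ ψ ∈ P, ψ ≠ φ → ψ a = 0 := by
  classical
  induction P using Finset.induction_on with
  | empty => exact ⟨1, by simp, by simp⟩
  | insert ψ P _ ih =>
    obtain ⟨a, ha, hP⟩ := ih
    by_cases h : ψ = φ
    · refine ⟨a, ha, fun χ hχ hne => ?_⟩
      rcases Finset.mem_insert.1 hχ with rfl | h'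
      · exact absurd h hne
      · exact hP χ h' hne
    · obtain ⟨t, ht⟩ : ∃ t, ψ t ≠ φ t := by
        by_contra hcon
        push Not at hcon
        exact h (AlgHom.ext hcon)
      refine ⟨a * (t - algebraMap E A (ψ t)), ?_, fun χ hχ hne => ?_⟩
      · simp only [map_mul, map_sub, AlgHom.commutes, Algebra.algebraMap_self_apply]
        exact mul_ne_zero ha (sub_ne_zero.2 (Ne.symm ht))
      · rcases Finset.mem_insert.1 hχ with rfl | h'
        · simp
        · simp [hP χ h' hne]

/-- A function of degree `D` vanishes at no more than `D + g` points. -/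
theorem card_le_of_forall_eval_eq_zero [Finite E] [IsDomain A] {g : ℕ} (hb : IsDegreeBasis b w g)
    (P : Finset (A →ₐ[E] E)) {G : A} (hG : G ≠ 0) (hP : ∀ φ ∈ P, φ G = 0) :
    P.card ≤ weightDegree b w G + g := by
  classical
  choose s hs hs' using exists_separating P
  set δ := weightDegree b w G
  set M := P.sup (fun φ => weightDegree b w (s φ))
  -- The map (a, c) ↦ G a + Σ c_φ s_φ is injective: evaluation at the points of P kills G a and
  -- recovers c, and G can then be cancelled. Comparing dimensions, (M + 1 - g) + |P| ≤ M + δ + 1.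
  have hmem : ∀ (a : degreeLESpace b w M) (c : P → E),
      G * a + ∑ φ : P, c φ • s φ ∈ degreeLESpace b w (M + δ) := by
    intro a c
    refine add_mem ?_ (Submodule.sum_mem _ fun φ _ => Submodule.smul_mem _ _ ?_)
    · by_cases ha : (a : A) = 0
      · simp [ha]
      · rw [mem_degreeLESpace, hb.mul _ _ hG ha]
        have := mem_degreeLESpace.1 a.2
        omega
    · rw [mem_degreeLESpace]
      have : weightDegree b w (s φ) ≤ M :=
        Finset.le_sup (f := fun φ => weightDegree b w (s φ)) φ.2
      omega
  let F : degreeLESpace b w M × (P → E) → degreeLESpace b w (M + δ) :=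
    fun x => ⟨_, hmem x.1 x.2⟩
  have hF : Function.Injective F := by
    rintro ⟨a, c⟩ ⟨a', c'⟩ h
    have h : G * (a : A) + ∑ φ : P, c φ • s φ = G * (a' : A) + ∑ φ : P, c' φ • s φ :=
      congrArg Subtype.val h
    have hev : ∀ (ψ : P) (a : A) (c : P → E),
        (ψ : A →ₐ[E] E) (G * a + ∑ φ : P, c φ • s φ) = c ψ * (ψ : A →ₐ[E] E) (s ψ) := by
      intro ψ a c
      rw [map_add, map_mul, hP ψ ψ.2, zero_mul, zero_add, map_sum,
        Finset.sum_eq_single ψ]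
      · simp
      · intro φ _ hne
        rw [map_smul, hs' φ ψ ψ.2 (fun h => hne (Subtype.ext h.symm)), smul_zero]
      · simp
    have hc : c = c' := by
      funext ψ
      have := congrArg (ψ : A →ₐ[E] E) h
      rw [hev, hev] at this
      exact mul_right_cancel₀ (hs ψ) this
    subst hc
    have h2 := mul_left_cancel₀ hG (add_right_cancel h)
    exact Prod.ext (Subtype.ext h2) rfl
  have := finite_degreeLESpace (E := E) (b := b) hb.inj (M + δ)
  have hcard := Nat.card_le_card_of_injective F hF
  rw [Nat.card_prod, card_degreeLESpace hb.inj, card_degreeLESpace hb.inj, Nat.card_fun,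
    ← pow_add, Nat.pow_le_pow_iff_right Finite.one_lt_card] at hcard
  have h1 := hb.low M
  have h2 := card_weight_le hb.inj (M + δ)
  have h3 : Nat.card P = P.card := by simp
  omega

/-- A sum of elements of distinct degrees is nonzero as soon as one of them is. -/
theorem sum_ne_zero_of_weightDegree_injOn {κ : Type*} (t : Finset κ) (y : κ → A)
    (hinj : ∀ i ∈ t, ∀ j ∈ t, y i ≠ 0 → y j ≠ 0 →
      weightDegree b w (y i) = weightDegree b w (y j) → i = j)
    (hne : ∃ i ∈ t, y i ≠ 0) : ∑ i ∈ t, y i ≠ 0 := by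
  classical
  have hne' : (t.filter (fun i => y i ≠ 0)).Nonempty := by
    obtain ⟨i, hi, h⟩ := hne
    exact ⟨i, Finset.mem_filter.2 ⟨hi, h⟩⟩
  obtain ⟨i, hi, hmax⟩ := Finset.exists_max_image _ (fun i => weightDegree b w (y i)) hne'
  obtain ⟨hit, hi0⟩ := Finset.mem_filter.1 hi
  obtain ⟨k, hk, hwk⟩ := exists_weight_eq_weightDegree (b := b) (w := w) hi0
  intro h
  have h1 := congrArg (fun a => b.repr a k) h
  simp only [map_sum, Finsupp.coe_finsetSum, Finset.sum_apply, map_zero, Finsupp.coe_zero,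
    Pi.zero_apply] at h1
  rw [Finset.sum_eq_single i] at h1
  · exact hk h1
  · intro j hj hji
    by_cases hj0 : y j = 0
    · simp [hj0]
    · refine repr_eq_zero_of_weightDegree_lt (w := w) ?_
      rw [hwk]
      refine lt_of_le_of_ne (hmax j (Finset.mem_filter.2 ⟨hj, hj0⟩)) fun he => hji ?_
      exact hinj j hj i hit hj0 hi0 he
  · exact fun h' => absurd hit h'

theorem IsDegreeBasis.pow [IsDomain A] {g : ℕ} (hb : IsDegreeBasis b w g) {x : A} (hx : x ≠ 0)
    (k : ℕ) : weightDegree b w (x ^ k) = k * weightDegree b w x := by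
  induction k with
  | zero =>
    have h := hb.mul 1 1 one_ne_zero one_ne_zero
    rw [mul_one] at h
    rw [pow_zero, zero_mul]
    omega
  | succ k ih =>
    rw [pow_succ, hb.mul _ _ (pow_ne_zero _ hx) hx, ih]
    ring

/-- **Bombieri's form of Stepanov's bound**: the number of rational points over a field with
`s²` elements is at most `s² + (2g+1)s + g`. -/
theorem card_algHom_le [Finite E] [IsDomain A] {g p μ s : ℕ} [Fact p.Prime] [CharP A p]
    (hb : IsDegreeBasis b w g) (hs : s = p ^ μ) (hE : Nat.card E = s ^ 2)
    (hsg : g ^ 2 + 3 * g + 1 < s) (P : Finset (A →ₐ[E] E)) :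
    P.card ≤ s ^ 2 + (2 * g + 1) * s + g := by
  classical
  have hfin := finite_weight_le (w := w) hb.inj (s + 2 * g)
  have hfin1 := finite_degreeLESpace (E := E) (b := b) hb.inj (s - 1)
  have hfin2 := finite_degreeLESpace (E := E) (b := b) hb.inj ((s - 1) * s + (s + 2 * g))
  have := Fintype.ofFinite {i // w i ≤ s + 2 * g}
  have hpow : ∀ x y : A, (x - y) ^ s = x ^ s - y ^ s := by
    intro x y
    rw [hs]
    exact sub_pow_char_pow x y μ
  have hsum : ∀ y : {i // w i ≤ s + 2 * g} → A, (∑ i, y i) ^ s = ∑ i, y i ^ s := by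
    intro y
    have h := sum_pow_char_pow p μ Finset.univ y
    rwa [← hs] at h
  -- The candidate functions are Σ ν_i^s b_i with ν_i of degree below s. Being additive in ν, they
  -- give a nontrivial relation as soon as two choices of ν collide.
  have hmem : ∀ ν : {i // w i ≤ s + 2 * g} → degreeLESpace b w (s - 1),
      ∑ i, (ν i : A) ^ s * b i ∈ degreeLESpace b w ((s - 1) * s + (s + 2 * g)) := by
    intro ν
    refine Submodule.sum_mem _ fun i _ => ?_
    by_cases h0 : (ν i : A) = 0
    · rw [h0, zero_pow (by omega), zero_mul]
      exact Submodule.zero_mem _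
    · rw [mem_degreeLESpace, hb.mul _ _ (pow_ne_zero _ h0) (b.ne_zero _), hb.pow h0,
        weightDegree_basis]
      have h1 := mem_degreeLESpace.1 (ν i).2
      have h2 := i.2
      have h3 := Nat.mul_le_mul_left s h1
      rw [mul_comm (s - 1)]
      omega
  let Ψ : ({i // w i ≤ s + 2 * g} → degreeLESpace b w (s - 1)) →
      degreeLESpace b w ((s - 1) * s + (s + 2 * g)) := fun ν => ⟨_, hmem ν⟩
  -- The source has dimension at least (s - g)(s + g + 1) = s² + s - g² - g and the target at most
  -- s² + 2g + 1. The hypothesis `hsg` says exactly that the first exceeds the second.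
  have hnot : ¬ Function.Injective Ψ := by
    intro hinj
    have hcard := Nat.card_le_card_of_injective Ψ hinj
    rw [Nat.card_fun, card_degreeLESpace hb.inj, card_degreeLESpace hb.inj, ← pow_mul,
      Nat.pow_le_pow_iff_right Finite.one_lt_card] at hcard
    have h1 := hb.low (s - 1)
    have h2 := hb.low (s + 2 * g)
    have h3 := card_weight_le hb.inj ((s - 1) * s + (s + 2 * g))
    obtain ⟨e, he⟩ : ∃ e, s = g + e := Nat.exists_eq_add_of_le (by nlinarith)
    have h4 : e * (s + g + 1) ≤
        Nat.card {i // w i ≤ s - 1} * Nat.card {i // w i ≤ s + 2 * g} :=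
      Nat.mul_le_mul (by omega) (by omega)
    have h5 : (s - 1) * s + s = s * s := by
      obtain ⟨r, rfl⟩ : ∃ r, s = r + 1 := ⟨s - 1, by omega⟩
      simp; ring
    nlinarith
  rw [Function.Injective] at hnot
  push Not at hnot
  obtain ⟨ν₁, ν₂, hΨ, hne⟩ := hnot
  have hΨ : ∑ i, (ν₁ i : A) ^ s * b i = ∑ i, (ν₂ i : A) ^ s * b i := congrArg Subtype.val hΨ
  set ν : {i // w i ≤ s + 2 * g} → A := fun i => (ν₁ i : A) - ν₂ i with hν
  have hν0 : ∑ i, ν i ^ s * b i = 0 := by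
    simp only [hν, hpow, sub_mul, Finset.sum_sub_distrib, hΨ, sub_self]
  have hνdeg : ∀ i, weightDegree b w (ν i) ≤ s - 1 := fun i =>
    mem_degreeLESpace.1 (sub_mem (ν₁ i).2 (ν₂ i).2)
  obtain ⟨i₀, hi₀⟩ : ∃ i, ν i ≠ 0 := by
    by_contra hcon
    push Not at hcon
    exact hne (funext fun i => Subtype.ext (sub_eq_zero.1 (hcon i)))
  have hterm : ∀ i, ν i ≠ 0 → weightDegree b w (ν i * b i ^ s) =
      weightDegree b w (ν i) + s * w i := by
    intro i hi
    rw [hb.mul _ _ hi (pow_ne_zero _ (b.ne_zero _)), hb.pow (b.ne_zero _), weightDegree_basis]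
  -- G moves the s-th power from ν_i to b_i. Its terms have degrees deg ν_i + s w_i with deg ν_i <
  -- s, which are distinct by division by s; hence G ≠ 0.
  set G : A := ∑ i, ν i * b i ^ s with hGdef
  have hG : G ≠ 0 := by
    refine sum_ne_zero_of_weightDegree_injOn (b := b) (w := w) _ _ ?_
      ⟨i₀, Finset.mem_univ _, mul_ne_zero hi₀ (pow_ne_zero _ (b.ne_zero _))⟩
    intro i _ j _ hi hj h
    have hi' := left_ne_zero_of_mul hi
    have hj' := left_ne_zero_of_mul hj
    rw [hterm i hi', hterm j hj'] at h
    have h1 := hνdeg i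
    have h2 := hνdeg j
    have h3 : (weightDegree b w (ν i) + s * w i) / s = (weightDegree b w (ν j) + s * w j) / s := by
      rw [h]
    rw [Nat.add_mul_div_left _ _ (by omega), Nat.add_mul_div_left _ _ (by omega),
      Nat.div_eq_of_lt (by omega), Nat.div_eq_of_lt (by omega)] at h3
    exact Subtype.ext (hb.inj (by omega))
  have hGdeg : weightDegree b w G ≤ (s - 1) + s * (s + 2 * g) := by
    rw [← mem_degreeLESpace]
    refine Submodule.sum_mem _ fun i _ => ?_
    by_cases h0 : ν i = 0
    · simp [h0]
    · rw [mem_degreeLESpace, hterm i h0]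
      exact Nat.add_le_add (hνdeg i) (Nat.mul_le_mul_left _ i.2)
  -- At a rational point b_i^(s²) and b_i take the same value, so G^s takes the value of Σ ν_i^s
  -- b_i, which is 0.
  have hPG : ∀ φ ∈ P, φ G = 0 := by
    intro φ _
    have hfrob : ∀ c : E, c ^ (s ^ 2) = c := fun c => by
      have := Fintype.ofFinite E
      rw [← hE, Nat.card_eq_fintype_card]
      exact FiniteField.pow_card c
    have h1 : φ (G ^ s) = φ (∑ i, ν i ^ s * b i) := by
      rw [hGdef, hsum, map_sum, map_sum]
      refine Finset.sum_congr rfl fun i _ => ?_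
      simp only [mul_pow, map_mul, map_pow]
      rw [← pow_mul, ← sq, hfrob]
    rw [hν0, map_zero, map_pow] at h1
    exact pow_eq_zero_iff (by omega) |>.1 h1
  have hfinal := card_le_of_forall_eval_eq_zero hb P hG hPG
  have : (s - 1) + s * (s + 2 * g) + g ≤ s ^ 2 + (2 * g + 1) * s + g := by
    have : (s-1) ≤ s := by omega
    nlinarith
  omega

end DegreeBasis

/-! ### Artin–Schreier curves: the degree function from a place at infinity -/

section

open Polynomial

/-- A valuation compatible with the weights makes a basis a degree basis. -/
theorem isDegreeBasis_of_valuation {E A ι L Γ : Type*} [Field E] [CommRing A] [Algebra E A]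
    {b : Module.Basis ι E A} {w : ι → ℕ} {g : ℕ} (hinj : Function.Injective w)
    (hlow : ∀ m : ℕ, m + 1 ≤ Nat.card {i // w i ≤ m} + g) [Field L]
    [LinearOrderedCommGroupWithZero Γ] (v : Valuation L Γ) (φ : A →+* L) {γ : Γ} (hγ : 1 < γ)
    {p : ℕ} (hp : p ≠ 0) (hE : ∀ c : E, c ≠ 0 → v (φ (algebraMap E A c)) = 1)
    (hbw : ∀ i, v (φ (b i)) ^ p = γ ^ w i) : IsDomain A ∧ IsDegreeBasis b w g := by
  classical
  have hterm : ∀ (c : E) (i : ι), c ≠ 0 → v (φ (c • b i)) ^ p = γ ^ w i := by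
    intro c i hc
    rw [Algebra.smul_def, map_mul, map_mul, hE c hc, one_mul, hbw]
  have hmono : ∀ m n : ℕ, γ ^ m < γ ^ n ↔ m < n := fun m n => pow_lt_pow_iff_right₀ hγ
  -- The terms of a have distinct values because the weights are injective, so the ultrametric
  -- inequality is an equality with the largest term. Working with p-th powers of values avoids
  -- roots in the value group.
  have key : ∀ a : A, a ≠ 0 → v (φ a) ^ p = γ ^ weightDegree b w a := by
    intro a ha
    obtain ⟨i, hi, hwi⟩ := exists_weight_eq_weightDegree (b := b) (w := w) ha
    have hsum : a = ∑ j ∈ (b.repr a).support, b.repr a j • b j := (b.linearCombination_repr a).symm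
    have hv : v (φ a) = v (φ (b.repr a i • b i)) := by
      conv_lhs => rw [hsum, map_sum]
      refine v.map_sum_eq_of_lt (by simpa using hi) fun j hj => ?_
      obtain ⟨hj1, hj2⟩ := Finset.mem_sdiff.1 hj
      have hj1' : b.repr a j ≠ 0 := by simpa using hj1
      refine lt_of_pow_lt_pow_left₀ p zero_le ?_
      rw [hterm _ _ hj1', hterm _ _ hi, hmono, hwi]
      refine lt_of_le_of_ne (weightDegree_le_iff.1 le_rfl j hj1') fun h => hj2 ?_
      exact Finset.mem_singleton.2 (hinj (h.trans hwi.symm))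
    rw [hv, hterm _ _ hi, hwi]
  have hγ0 : γ ≠ 0 := (zero_lt_one.trans hγ).ne'
  have hφ : Function.Injective φ := by
    rw [injective_iff_map_eq_zero]
    intro a ha
    by_contra h
    have := key a h
    rw [ha, map_zero, zero_pow hp] at this
    exact pow_ne_zero _ hγ0 this.symm
  have hdom : IsDomain A := hφ.isDomain φ
  refine ⟨hdom, hinj, fun x y hx hy => ?_, hlow⟩
  have h1 := key (x * y) (mul_ne_zero hx hy)
  rw [map_mul, map_mul, mul_pow, key x hx, key y hy, ← pow_add] at h1
  exact ((pow_right_injective₀ (zero_lt_one.trans hγ) hγ.ne') h1).symm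

/-- There is a place of the algebraic closure of `E(X)` at which `X` has a pole. -/
theorem exists_valuationSubring_one_lt_X (E : Type*) [Field E] :
    ∃ B : ValuationSubring (AlgebraicClosure (RatFunc E)),
      1 < B.valuation (algebraMap (RatFunc E) _ RatFunc.X) := by
  set L := AlgebraicClosure (RatFunc E)
  set x : L := algebraMap (RatFunc E) L RatFunc.X with hx
  have hx0 : x ≠ 0 := by
    rw [hx, _root_.map_ne_zero]
    exact RatFunc.X_ne_zero
  have htr : Transcendental E x := by
    rw [hx, transcendental_algebraMap_iff (algebraMap (RatFunc E) L).injective]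
    exact RatFunc.transcendental_X
  have htr' : Transcendental E x⁻¹ := fun h => htr (inv_inv x ▸ h.inv)
  have hinj : Function.Injective (aeval (R := E) x⁻¹ : E[X] →ₐ[E] L).toRingHom :=
    transcendental_iff_injective.1 htr'
  set ψ := (aeval (R := E) x⁻¹ : E[X] →ₐ[E] L).toRingHom
  let e : E[X] ≃+* ψ.range := RingEquiv.ofBijective ψ.rangeRestrict
    ⟨fun a b h => hinj (congrArg Subtype.val h), ψ.rangeRestrict_surjective⟩
  -- X⁻¹ generates a proper ideal of the polynomial ring E[X⁻¹]; a valuation ring in which this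
  -- ideal consists of nonunits gives X a pole.
  have hI : (Ideal.span {(X : E[X])}).comap (e.symm : ψ.range →+* E[X]) ≠ ⊤ := by
    rw [Ne, Ideal.comap_eq_top_iff, Ideal.span_singleton_eq_top]
    exact Polynomial.not_isUnit_X
  obtain ⟨B, -, hB⟩ := Ideal.image_subset_nonunits_valuationSubring _ hI
  refine ⟨B, ?_⟩
  have hmem : x⁻¹ ∈ B.nonunits := by
    refine hB ⟨e X, ?_, ?_⟩
    · simp
    · change ψ X = x⁻¹
      simp [ψ]
  rw [ValuationSubring.mem_nonunits_iff, map_inv₀] at hmem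
  exact (inv_lt_one₀ (by rw [zero_lt_iff, Valuation.ne_zero_iff]; exact hx0)).1 hmem

/-- Nonzero elements of a finite field are roots of unity, and an ordered value group has no
torsion. -/
theorem valuation_eq_one_of_finite {E L Γ : Type*} [Field E] [Finite E] [Field L]
    [LinearOrderedCommGroupWithZero Γ] (v : Valuation L Γ) (φ : E →+* L) {c : E} (hc : c ≠ 0) :
    v (φ c) = 1 := by
  have := Fintype.ofFinite E
  have h := FiniteField.pow_card_sub_one_eq_one c hc
  have h1 : v (φ c) ^ (Fintype.card E - 1) = 1 := by rw [← map_pow, ← map_pow, h, map_one, map_one]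
  have h2 := Fintype.one_lt_card (α := E)
  exact (pow_eq_one_iff_of_nonneg zero_le (by omega)).1 h1

/-- When X has a pole, the leading term strictly dominates all others, since constants have value 1.
-/
theorem valuation_polynomial {E L Γ : Type*} [Field E] [Finite E] [Field L]
    [LinearOrderedCommGroupWithZero Γ] (v : Valuation L Γ) (φ : E[X] →+* L)
    (hx : 1 < v (φ X)) {f : E[X]} (hf : f ≠ 0) : v (φ f) = v (φ X) ^ f.natDegree := by
  classical
  have hterm : ∀ i, f.coeff i ≠ 0 → v (φ (monomial i (f.coeff i))) = v (φ X) ^ i := by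
    intro i hi
    rw [← C_mul_X_pow_eq_monomial, map_mul, map_mul, map_pow, map_pow,
      show φ (C (f.coeff i)) = (φ.comp C) (f.coeff i) from rfl,
      valuation_eq_one_of_finite v _ hi, one_mul]
  have hlc : f.coeff f.natDegree ≠ 0 := by simpa using hf
  conv_lhs => rw [f.as_sum_support, map_sum]
  rw [v.map_sum_eq_of_lt (j := f.natDegree), hterm _ hlc]
  · simpa using hf
  · intro i hi
    obtain ⟨h1, h2⟩ := Finset.mem_sdiff.1 hi
    rw [hterm _ hlc, hterm _ (by simpa using h1)]
    refine (pow_lt_pow_iff_right₀ hx).2 (lt_of_le_of_ne (le_natDegree_of_mem_supp _ h1) ?_)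
    simpa using h2

/-- If y were integral, so would be y^p - y = z. Hence y has a pole, and then y^p dominates y. -/
theorem valuation_artinSchreier {L Γ : Type*} [Field L] [LinearOrderedCommGroupWithZero Γ]
    (v : Valuation L Γ) {p : ℕ} (hp : 2 ≤ p) {y z : L} (h : y ^ p - y = z) (hz : 1 < v z) :
    v y ^ p = v z := by
  have hy : 1 < v y := by
    by_contra hcon
    push Not at hcon
    have : v (y ^ p - y) ≤ 1 :=
      v.map_sub_le (by rw [map_pow]; exact pow_le_one₀ zero_le hcon) hcon
    rw [h] at this
    exact absurd hz (not_lt.2 this)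
  rw [← h, ← map_pow]
  refine (v.map_sub_eq_of_lt_left ?_).symm
  rw [map_pow]
  calc v y = v y ^ 1 := (pow_one _).symm
    _ < v y ^ p := (pow_lt_pow_iff_right₀ hy).2 (by omega)

/-- As d is invertible modulo p, the weight determines j modulo p, hence j < p itself, and then i.
-/
theorem weight_injective {p d : ℕ} (hp : p.Prime) (hd : ¬ p ∣ d) :
    Function.Injective (fun x : ℕ × Fin p => p * x.1 + d * x.2) := by
  rintro ⟨i, j⟩ ⟨i', j'⟩ h
  have h : p * i + d * j = p * i' + d * j' := h
  have hcop : Nat.Coprime p d := (hp.coprime_iff_not_dvd).2 hd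
  have h1 : d * (j : ℕ) ≡ d * j' [MOD p] := by
    have : (p * i + d * j) % p = (p * i' + d * j') % p := by rw [h]
    simpa [Nat.ModEq, Nat.mul_add_mod] using this
  have h2 : (j : ℕ) ≡ j' [MOD p] := Nat.ModEq.cancel_left_of_coprime hcop h1
  have h3 : j = j' := Fin.ext (Nat.ModEq.eq_of_lt_of_lt h2 j.2 j'.2)
  subst h3
  have h4 : i = i' := Nat.eq_of_mul_eq_mul_left hp.pos (by omega)
  rw [h4]

/-- Every N ≥ dp is a weight: take j ≡ N/d modulo p, so that dj ≤ N. The crude count dp of possible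
gaps stands in for the genus. -/
theorem weight_card {p d : ℕ} (hp : p.Prime) (hd : ¬ p ∣ d) (m : ℕ) :
    m + 1 ≤ Nat.card {x : ℕ × Fin p // p * x.1 + d * x.2 ≤ m} + d * p := by
  have := finite_weight_le (weight_injective hp hd) m
  have hsurj : ∀ N : Finset.Icc (d * p) m,
      ∃ x : {x : ℕ × Fin p // p * x.1 + d * x.2 ≤ m}, p * x.1.1 + d * x.1.2 = N := by
    rintro ⟨N, hN⟩
    obtain ⟨hN1, hN2⟩ := Finset.mem_Icc.1 hN
    have : Fact p.Prime := ⟨hp⟩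
    have hd0 : (d : ZMod p) ≠ 0 := by rwa [Ne, ZMod.natCast_eq_zero_iff]
    set j := ((N : ZMod p) * (d : ZMod p)⁻¹).val
    have hj : j < p := ZMod.val_lt _
    have hle : d * j ≤ N := (Nat.mul_le_mul_left d hj.le).trans hN1
    have hmod : (p : ℕ) ∣ N - d * j := by
      rw [← Nat.modEq_iff_dvd' hle, ← ZMod.natCast_eq_natCast_iff]
      push_cast
      rw [ZMod.natCast_zmod_val]
      field_simp
    obtain ⟨i, hi⟩ := hmod
    exact ⟨⟨(i, ⟨j, hj⟩), by simp only; omega⟩, by simp only; omega⟩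
  choose F hF using hsurj
  have hFinj : Function.Injective F := fun a b h => Subtype.ext (by rw [← hF a, ← hF b, h])
  have := Nat.card_le_card_of_injective F hFinj
  rw [Nat.card_eq_fintype_card, Fintype.card_coe, Nat.card_Icc] at this
  omega

/-- The polynomial `Y^p - Y - f` over `E[X]`. -/
noncomputable def artinSchreierPoly {E : Type*} [Field E] (p : ℕ) (f : E[X]) : E[X][X] :=
  X ^ p - (X + C f)

theorem artinSchreierPoly_degree_aux {E : Type*} [Field E] {p : ℕ} (hp : 2 ≤ p) (f : E[X]) :
    (X + C f : E[X][X]).degree < (p : WithBot ℕ) := by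
  rw [degree_X_add_C]
  exact_mod_cast (by omega : 1 < p)

theorem artinSchreierPoly_monic {E : Type*} [Field E] {p : ℕ} (hp : 2 ≤ p) (f : E[X]) :
    (artinSchreierPoly p f).Monic :=
  monic_X_pow_sub (artinSchreierPoly_degree_aux hp f)

theorem artinSchreierPoly_natDegree {E : Type*} [Field E] {p : ℕ} (hp : 2 ≤ p) (f : E[X]) :
    (artinSchreierPoly p f).natDegree = p := by
  refine natDegree_eq_of_degree_eq_some ?_
  rw [artinSchreierPoly, degree_sub_eq_left_of_degree_lt, degree_X_pow]
  rw [degree_X_pow]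
  exact artinSchreierPoly_degree_aux hp f

/-- The monomial basis `X^i y^j`, `j < p`, of the coordinate ring of `y^p - y = f(X)`. -/
noncomputable def artinSchreierBasis {E : Type*} [Field E] {p : ℕ} (hp : 2 ≤ p) (f : E[X]) :
    Module.Basis (ℕ × Fin p) E (AdjoinRoot (artinSchreierPoly p f)) :=
  (Polynomial.basisMonomials E).smulTower
    ((AdjoinRoot.powerBasis' (artinSchreierPoly_monic hp f)).basis.reindex
      (finCongr ((AdjoinRoot.powerBasis'_dim _).trans (artinSchreierPoly_natDegree hp f))))

theorem artinSchreierBasis_apply {E : Type*} [Field E] {p : ℕ} (hp : 2 ≤ p) (f : E[X])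
    (i : ℕ × Fin p) : artinSchreierBasis hp f i =
      AdjoinRoot.of _ (X ^ i.1) * AdjoinRoot.root _ ^ (i.2 : ℕ) := by
  rw [artinSchreierBasis, Module.Basis.smulTower_apply, coe_basisMonomials,
    Module.Basis.reindex_apply, PowerBasis.basis_eq_pow, AdjoinRoot.powerBasis'_gen,
    Algebra.smul_def, ← monomial_one_right_eq_X_pow, AdjoinRoot.algebraMap_eq]
  congr 1

/-- A root η of Y^p - Y - f in the algebraic closure of E(X) satisfies v(η)^p = v(X)^d, so X^i η^j
has value v(X)^(pi+dj) after raising to the power p. The coordinate ring embeds in a field because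
distinct weights exclude cancellation, so irreducibility needs no separate proof. -/
theorem artinSchreier_isDegreeBasis {E : Type*} [Field E] [Finite E] {p : ℕ} (hp : p.Prime)
    {f : E[X]} (hd : ¬ p ∣ f.natDegree) :
    IsDomain (AdjoinRoot (artinSchreierPoly p f)) ∧
      IsDegreeBasis (artinSchreierBasis hp.two_le f)
        (fun x : ℕ × Fin p => p * x.1 + f.natDegree * x.2) (f.natDegree * p) := by
  obtain ⟨B, hB⟩ := exists_valuationSubring_one_lt_X E
  set L := AlgebraicClosure (RatFunc E)
  set ψ : E[X] →+* L := (algebraMap (RatFunc E) L).comp (algebraMap E[X] (RatFunc E)) with hψ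
  have hX : 1 < B.valuation (ψ X) := by
    simpa [hψ] using hB
  have hd0 : f.natDegree ≠ 0 := fun h => hd (h ▸ dvd_zero p)
  have hf : f ≠ 0 := fun h => hd0 (by rw [h, natDegree_zero])
  obtain ⟨η, hη⟩ := IsAlgClosed.exists_root ((artinSchreierPoly p f).map ψ) (by
    rw [(artinSchreierPoly_monic hp.two_le f).degree_map, degree_eq_natDegree
      (artinSchreierPoly_monic hp.two_le f).ne_zero, artinSchreierPoly_natDegree hp.two_le]
    exact_mod_cast hp.ne_zero)
  have hη' : eval₂ ψ η (artinSchreierPoly p f) = 0 := by rwa [IsRoot, eval_map] at hη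
  have hη2 : η ^ p - η = ψ f := by
    have := hη'
    simp only [artinSchreierPoly, eval₂_sub, eval₂_pow, eval₂_X, eval₂_add, eval₂_C] at this
    linear_combination this
  have hvη : B.valuation η ^ p = B.valuation (ψ X) ^ f.natDegree := by
    rw [← valuation_polynomial B.valuation ψ hX hf]
    refine valuation_artinSchreier _ hp.two_le hη2 ?_
    rw [valuation_polynomial B.valuation ψ hX hf]
    exact one_lt_pow₀ hX hd0
  refine isDegreeBasis_of_valuation (weight_injective hp hd) (weight_card hp hd) B.valuation
    (AdjoinRoot.lift ψ η hη') hX hp.ne_zero ?_ ?_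
  · intro c hc
    exact valuation_eq_one_of_finite B.valuation
      ((AdjoinRoot.lift ψ η hη').comp (algebraMap E _)) hc
  · intro i
    rw [artinSchreierBasis_apply, map_mul, map_pow (AdjoinRoot.lift ψ η hη'), AdjoinRoot.lift_of,
      AdjoinRoot.lift_root, map_pow, map_mul, map_pow, map_pow, mul_pow, pow_add, ← pow_mul, mul_comm _ p, ← pow_mul,
      mul_comm _ p, pow_mul (B.valuation η), hvη, ← pow_mul]

/-- The number of affine points on `y^p - y = f(x)` over a field with `s²` elements. -/
theorem artinSchreier_card_le {E : Type*} [Field E] [Fintype E] {p μ s : ℕ} [hp : Fact p.Prime]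
    [CharP E p] (hs : s = p ^ μ) (hE : Nat.card E = s ^ 2) {f : E[X]} (hd : ¬ p ∣ f.natDegree)
    (hsg : (f.natDegree * p) ^ 2 + 3 * (f.natDegree * p) + 1 < s) :
    Nat.card {z : E × E // z.2 ^ p - z.2 = f.eval z.1} ≤
      s ^ 2 + (2 * (f.natDegree * p) + 1) * s + f.natDegree * p := by
  classical
  obtain ⟨hdom, hb⟩ := artinSchreier_isDegreeBasis hp.out hd
  have hroot : ∀ z : {z : E × E // z.2 ^ p - z.2 = f.eval z.1},
      eval₂ ((aeval z.1.1 : E[X] →ₐ[E] E) : E[X] →+* E) z.1.2 (artinSchreierPoly p f) = 0 := by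
    rintro ⟨⟨x, y⟩, h⟩
    have h : y ^ p - y = f.eval x := h
    simp only [artinSchreierPoly, eval₂_sub, eval₂_pow, eval₂_X, eval₂_add, eval₂_C]
    simp only [RingHom.coe_coe, coe_aeval_eq_eval]
    linear_combination h
  let F : {z : E × E // z.2 ^ p - z.2 = f.eval z.1} →
      (AdjoinRoot (artinSchreierPoly p f) →ₐ[E] E) :=
    fun z => AdjoinRoot.liftAlgHom _ (aeval z.1.1) z.1.2 (hroot z)
  have hF : Function.Injective F := by
    intro z z' h
    have h1 := congrArg (fun φ => φ (AdjoinRoot.of _ X)) h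
    have h2 := congrArg (fun φ => φ (AdjoinRoot.root _)) h
    simp only [F, AdjoinRoot.liftAlgHom_of, AdjoinRoot.liftAlgHom_root, aeval_X] at h1 h2
    exact Subtype.ext (Prod.ext h1 h2)
  have : CharP (AdjoinRoot (artinSchreierPoly p f)) p :=
    charP_of_injective_algebraMap (algebraMap E _).injective p
  have := card_algHom_le hb hs hE hsg (Finset.univ.image F)
  rw [Finset.card_image_of_injective _ hF, Finset.card_univ] at this
  rwa [Nat.card_eq_fintype_card]

end

/-! ### Traces, and square-root cancellation over fields of square order -/

section

open Polynomial

/-- Additive Hilbert 90 over the prime field. -/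
theorem exists_pow_sub_self_of_trace_eq_zero {E : Type*} [Field E] [Finite E] {p : ℕ}
    [hp : Fact p.Prime] [Algebra (ZMod p) E] {z : E} (hz : Algebra.trace (ZMod p) E z = 0) :
    ∃ y : E, y ^ p - y = z := by
  have : CharP E p := charP_of_injective_algebraMap (algebraMap (ZMod p) E).injective p
  let P : E →ₗ[ZMod p] E :=
    { toFun := fun y => y ^ p - y
      map_add' := fun a b => by rw [add_pow_char]; ring
      map_smul' := fun c a => by
        rw [RingHom.id_apply, Algebra.smul_def, Algebra.smul_def, mul_pow, ← map_pow, ZMod.pow_card]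
        ring }
  have hP : ∀ y, P y = y ^ p - y := fun y => rfl
  have hTr : ∀ y : E, Algebra.trace (ZMod p) E (y ^ p) = Algebra.trace (ZMod p) E y := by
    intro y
    have h := Algebra.trace_eq_of_algEquiv (FiniteField.frobeniusAlgEquivOfAlgebraic (ZMod p) E) y
    rw [← h]
    simp [ZMod.card]
  have hle : LinearMap.range P ≤ LinearMap.ker (Algebra.trace (ZMod p) E) := by
    rintro _ ⟨y, rfl⟩
    rw [LinearMap.mem_ker, hP, map_sub, hTr, sub_self]
  have hker : Module.finrank (ZMod p) (LinearMap.ker P) ≤ 1 := by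
    have hle' : LinearMap.ker P ≤ (ZMod p) ∙ (1 : E) := by
      intro y hy
      rw [LinearMap.mem_ker, hP, sub_eq_zero] at hy
      have h1 : y ∈ (⊥ : Subfield E) := (Subfield.mem_bot_iff_pow_eq_self E p).2 hy
      obtain ⟨n, rfl⟩ := (_root_.mem_bot_iff_intCast p E).1 h1
      exact Submodule.mem_span_singleton.2 ⟨(n : ZMod p), by simp [Algebra.smul_def]⟩
    exact (Submodule.finrank_mono hle').trans ((finrank_span_le_card _).trans (by simp))
  have h1 := LinearMap.finrank_range_add_finrank_ker P
  have h2 := LinearMap.finrank_range_add_finrank_ker (Algebra.trace (ZMod p) E)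
  rw [LinearMap.range_eq_top.2 (Algebra.trace_surjective (ZMod p) E), finrank_top,
    Module.finrank_self] at h2
  -- The kernel of y ↦ y^p - y has dimension at most 1, so its image has codimension at most 1; it
  -- is contained in the kernel of the trace, whose codimension is exactly 1.
  have heq := Submodule.eq_of_le_of_finrank_le hle (by omega)
  have hz' : z ∈ LinearMap.range P := heq ▸ hz
  exact hz'

/-- Every additive character of a finite field has the form `z ↦ ζ(Tr(β z))`. -/
theorem exists_eq_stdAddChar_trace {E : Type*} [Field E] [Fintype E] {p : ℕ} [hp : Fact p.Prime]
    [Algebra (ZMod p) E] {χ : AddChar E ℂ} (hχ : χ ≠ 1) :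
    ∃ β : E, β ≠ 0 ∧ ∀ z, χ z = ZMod.stdAddChar (Algebra.trace (ZMod p) E (β * z)) := by
  let ψ : AddChar E ℂ :=
    (ZMod.stdAddChar (N := p)).compAddMonoidHom (Algebra.trace (ZMod p) E).toAddMonoidHom
  have hψ1 : ψ ≠ 1 := by
    intro h
    obtain ⟨z, hz⟩ := Algebra.trace_surjective (ZMod p) E 1
    have h1 : ψ z = 1 := by rw [h]; rfl
    have h2 : ψ z = ZMod.stdAddChar (Algebra.trace (ZMod p) E z) := rfl
    rw [h2, hz, ← AddChar.map_zero_eq_one (ZMod.stdAddChar (N := p))] at h1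
    exact one_ne_zero (ZMod.injective_stdAddChar h1)
  have hprim : ψ.IsPrimitive := AddChar.IsPrimitive.of_ne_one hψ1
  have hinj := AddChar.to_mulShift_inj_of_isPrimitive hprim
  have hbij : Function.Bijective (AddChar.mulShift ψ) := by
    classical
    refine (Fintype.bijective_iff_injective_and_card _).2 ⟨hinj, ?_⟩
    exact (AddChar.card_eq (α := E)).symm
  obtain ⟨β, rfl⟩ := hbij.2 χ
  refine ⟨β, fun h => hχ ?_, fun z => rfl⟩
  rw [h, AddChar.mulShift_zero]

/-- The number of `x` for which `Tr(f(x))` takes a given value. -/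
theorem mul_card_trace_eq_le {E : Type*} [Field E] [Fintype E] {p μ s : ℕ} [hp : Fact p.Prime]
    [Algebra (ZMod p) E] (hs : s = p ^ μ) (hE : Nat.card E = s ^ 2) {f : E[X]}
    (hd : ¬ p ∣ f.natDegree)
    (hsg : (f.natDegree * p) ^ 2 + 3 * (f.natDegree * p) + 1 < s) (c : ZMod p) :
    p * Nat.card {x : E // Algebra.trace (ZMod p) E (f.eval x) = c} ≤
      s ^ 2 + (2 * (f.natDegree * p) + 1) * s + f.natDegree * p := by
  have : CharP E p := charP_of_injective_algebraMap (algebraMap (ZMod p) E).injective p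
  obtain ⟨γ, hγ⟩ := Algebra.trace_surjective (ZMod p) E c
  have hdeg : (f - C γ).natDegree = f.natDegree := natDegree_sub_C
  have hmain := artinSchreier_card_le (f := f - C γ) hs hE (by rwa [hdeg]) (by rwa [hdeg])
  rw [hdeg] at hmain
  refine le_trans ?_ hmain
  have hex : ∀ x : {x : E // Algebra.trace (ZMod p) E (f.eval x) = c},
      ∃ y : E, y ^ p - y = (f - C γ).eval x.1 := fun x =>
    exists_pow_sub_self_of_trace_eq_zero (by rw [eval_sub, eval_C, map_sub, x.2, hγ, sub_self])
  choose y hy using hex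
  -- Each such x carries p points of the curve, namely (x, y + i) with i in the prime field.
  let F : ZMod p × {x : E // Algebra.trace (ZMod p) E (f.eval x) = c} →
      {z : E × E // z.2 ^ p - z.2 = (f - C γ).eval z.1} := fun a =>
    ⟨(a.2.1, y a.2 + algebraMap (ZMod p) E a.1), by
      simp only
      rw [add_pow_char, ← map_pow, ZMod.pow_card, ← hy]
      ring⟩
  have hF : Function.Injective F := by
    rintro ⟨i, x⟩ ⟨i', x'⟩ h
    have h := congrArg Subtype.val h
    simp only [F, Prod.mk.injEq] at h
    obtain rfl : x = x' := Subtype.ext h.1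
    have h2 := (algebraMap (ZMod p) E).injective (add_left_cancel h.2)
    rw [h2]
  have := Nat.card_le_card_of_injective F hF
  rwa [Nat.card_prod, Nat.card_zmod] at this

/-- Square-root cancellation over fields of square order, with an unspecified constant. -/
theorem exists_norm_charSum_le {p d : ℕ} [hp : Fact p.Prime] (hd : ¬ p ∣ d) :
    ∃ C : ℝ, ∀ (E : Type*) [Field E] [Fintype E] [Algebra (ZMod p) E] (μ : ℕ)
      (_ : Nat.card E = (p ^ μ) ^ 2) (χ : AddChar E ℂ) (_ : χ ≠ 1) (f : E[X])
      (_ : f.natDegree = d), ‖∑ x, χ (f.eval x)‖ ≤ C * (p : ℝ) ^ μ := by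
  set g := d * p
  refine ⟨3 * g + 1 + (g ^ 2 + 3 * g + 1), ?_⟩
  intro E _ _ _ μ hE χ hχ f hf
  have hs1 : (1 : ℝ) ≤ (p : ℝ) ^ μ := one_le_pow₀ (by exact_mod_cast hp.out.one_le)
  have hcardE : (Fintype.card E : ℝ) = ((p : ℝ) ^ μ) ^ 2 := by
    rw [← Nat.card_eq_fintype_card, hE]
    push_cast
    rfl
  -- In fields too small for Stepanov's method the trivial bound is absorbed by the constant, which
  -- may depend on p and d.
  rcases le_or_gt (p ^ μ) (g ^ 2 + 3 * g + 1) with hsmall | hbig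
  · have h1 : ‖∑ x, χ (f.eval x)‖ ≤ ((p : ℝ) ^ μ) ^ 2 := by
      refine (norm_sum_le _ _).trans ?_
      simp [AddChar.norm_apply, hcardE]
    refine h1.trans ?_
    have h2 : (p : ℝ) ^ μ ≤ g ^ 2 + 3 * g + 1 := by exact_mod_cast hsmall
    rw [sq]
    refine mul_le_mul_of_nonneg_right (h2.trans ?_) (by positivity)
    have : (0 : ℝ) ≤ 3 * g + 1 := by positivity
    linarith
  · obtain ⟨β, hβ, hχβ⟩ := exists_eq_stdAddChar_trace (p := p) hχ
    set h := C β * f with hh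
    have hdeg : h.natDegree = d := by rw [hh, natDegree_C_mul hβ, hf]
    set N : ZMod p → ℕ := fun c => Nat.card {x : E // Algebra.trace (ZMod p) E (h.eval x) = c}
      with hN
    have hNle : ∀ c, p * N c ≤ (p ^ μ) ^ 2 + (2 * g + 1) * p ^ μ + g := by
      intro c
      have := mul_card_trace_eq_le (f := h) (s := p ^ μ) rfl hE (by rwa [hdeg])
        (by rw [hdeg]; exact hbig) c
      rwa [hdeg] at this
    have hsumfib : ∀ G : ZMod p → ℂ, ∑ x, G (Algebra.trace (ZMod p) E (h.eval x)) =
        ∑ c, (N c : ℂ) * G c := by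
      classical
      intro G
      rw [← Finset.sum_fiberwise (s := Finset.univ)
        (g := fun x => Algebra.trace (ZMod p) E (h.eval x))]
      refine Finset.sum_congr rfl fun c _ => ?_
      rw [Finset.sum_congr rfl (g := fun _ => G c) (fun x hx => by
        rw [(Finset.mem_filter.1 hx).2]), Finset.sum_const, nsmul_eq_mul]
      congr 2
      simp only [hN]
      rw [Nat.card_eq_fintype_card, Fintype.card_subtype]
    have hNsum : ∑ c, (N c : ℝ) = ((p : ℝ) ^ μ) ^ 2 := by
      have := hsumfib (fun _ => 1)
      simp only [Finset.sum_const, nsmul_eq_mul, mul_one, Finset.card_univ] at this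
      rw [← hcardE]
      exact_mod_cast this.symm
    -- M bounds every N c from above and Σ N c is known exactly, so Σ (M - N c) is small without any
    -- lower bound on the N c. Subtracting M is free since the character sums to zero.
    set M : ℝ := (((p : ℝ) ^ μ) ^ 2 + (2 * g + 1) * (p : ℝ) ^ μ + g) / p
    have hp0 : (0 : ℝ) < p := by exact_mod_cast hp.out.pos
    have hNM : ∀ c, (N c : ℝ) ≤ M := by
      intro c
      rw [le_div_iff₀ hp0, mul_comm]
      exact_mod_cast hNle c
    have hχsum : ∑ x, χ (f.eval x) = ∑ c, ((N c : ℂ) - M) * ZMod.stdAddChar c := by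
      have h1 : ∑ x, χ (f.eval x) = ∑ c, (N c : ℂ) * ZMod.stdAddChar c := by
        rw [← hsumfib]
        refine Finset.sum_congr rfl fun x _ => ?_
        rw [hχβ, hh, eval_mul, eval_C]
      have h2 : ∑ c : ZMod p, ZMod.stdAddChar c = (0 : ℂ) := by
        refine AddChar.sum_eq_zero_of_ne_one ?_
        intro h1
        have h3 : ZMod.stdAddChar (1 : ZMod p) = ZMod.stdAddChar (0 : ZMod p) := by
          rw [h1]; rfl
        exact one_ne_zero (ZMod.injective_stdAddChar h3)
      simp only [sub_mul, Finset.sum_sub_distrib, ← Finset.mul_sum, h2, mul_zero, sub_zero, h1]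
    rw [hχsum]
    calc ‖∑ c : ZMod p, ((N c : ℂ) - M) * ZMod.stdAddChar c‖
        ≤ ∑ c : ZMod p, (M - N c) := by
          refine norm_sum_le_of_le _ fun c _ => ?_
          rw [norm_mul, AddChar.norm_apply, mul_one, ← Complex.ofReal_natCast,
            ← Complex.ofReal_sub, Complex.norm_real, Real.norm_eq_abs, abs_sub_comm,
            abs_of_nonneg (sub_nonneg.2 (hNM c))]
      _ = (2 * g + 1) * (p : ℝ) ^ μ + g := by
          rw [Finset.sum_sub_distrib, hNsum, Finset.sum_const, Finset.card_univ, ZMod.card,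
            nsmul_eq_mul, mul_div_cancel₀ _ hp0.ne']
          ring
      _ ≤ _ := by
          have hg0 : (0 : ℝ) ≤ g := by positivity
          nlinarith [mul_nonneg hg0 (sub_nonneg.2 hs1), mul_nonneg (sq_nonneg (g : ℝ)) (zero_le_one.trans hs1)]

end

/-! ### Newton's identities and Frobenius orbits of roots -/

section

open Polynomial

/-- **Newton's identities** for the power sums of a multiset. -/
theorem sum_pow_eq_mul_esymm_sub_sum {R : Type*} [CommRing R] (s : Multiset R) {k : ℕ}
    (hk : 0 < k) : (s.map (· ^ k)).sum = (-1) ^ (k + 1) * k * s.esymm k -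
      ∑ a ∈ Finset.HasAntidiagonal.antidiagonal k with a.1 ∈ Set.Ioo 0 k,
        (-1) ^ a.1 * s.esymm a.1 * (s.map (· ^ a.2)).sum := by
  classical
  have h := congrArg (MvPolynomial.aeval (fun x : s => (x.1 : R)))
    (MvPolynomial.psum_eq_mul_esymm_sub_sum s R k hk)
  have hp : ∀ j, MvPolynomial.aeval (fun x : s => (x.1 : R)) (MvPolynomial.psum s R j) =
      (s.map (· ^ j)).sum := by
    intro j
    simp only [MvPolynomial.psum, map_sum, map_pow, MvPolynomial.aeval_X]
    conv_rhs => rw [← Multiset.map_univ_coe s, Multiset.map_map]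
    rfl
  have he : ∀ j, MvPolynomial.aeval (fun x : s => (x.1 : R)) (MvPolynomial.esymm s R j) =
      s.esymm j := by
    intro j
    rw [MvPolynomial.aeval_esymm_eq_multiset_esymm, Multiset.map_univ_coe]
  simpa only [map_sub, map_mul, map_sum, map_pow, map_neg, map_one, map_natCast, hp, he] using h

/-- Two multisets with equal elementary symmetric functions below `d` have equal power sums below
`d`, and their `d`-th power sums differ by `± d` times the difference of the `d`-th elementary
symmetric functions. -/
theorem sum_pow_eq_of_esymm_eq {R : Type*} [CommRing R] {s t : Multiset R} {d : ℕ}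
    (h : ∀ i < d, s.esymm i = t.esymm i) {k : ℕ} (hk0 : 0 < k) (hk : k < d) :
    (s.map (· ^ k)).sum = (t.map (· ^ k)).sum := by
  induction k using Nat.strong_induction_on with
  | _ k ih =>
    rw [sum_pow_eq_mul_esymm_sub_sum s hk0, sum_pow_eq_mul_esymm_sub_sum t hk0, h k hk]
    congr 1
    refine Finset.sum_congr rfl fun a ha => ?_
    obtain ⟨h1, h2, h3⟩ := Finset.mem_filter.1 ha
    have h4 := Finset.HasAntidiagonal.mem_antidiagonal.1 h1
    rw [h a.1 (by omega), ih a.2 (by omega) (by omega) (by omega)]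

/-- In Newton's identity of index d the correction terms involve only indices strictly between 0 and
d, where both multisets agree. -/
theorem sum_pow_sub_sum_pow_of_esymm_eq {R : Type*} [CommRing R] {s t : Multiset R} {d : ℕ}
    (hd : 0 < d) (h : ∀ i < d, s.esymm i = t.esymm i) :
    (s.map (· ^ d)).sum - (t.map (· ^ d)).sum = (-1) ^ (d + 1) * d * (s.esymm d - t.esymm d) := by
  have hsum : ∑ a ∈ Finset.HasAntidiagonal.antidiagonal d with a.1 ∈ Set.Ioo 0 d,
        (-1) ^ a.1 * s.esymm a.1 * (s.map (· ^ a.2)).sum =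
      ∑ a ∈ Finset.HasAntidiagonal.antidiagonal d with a.1 ∈ Set.Ioo 0 d,
        (-1) ^ a.1 * t.esymm a.1 * (t.map (· ^ a.2)).sum := by
    refine Finset.sum_congr rfl fun a ha => ?_
    obtain ⟨h1, h2, h3⟩ := Finset.mem_filter.1 ha
    have h4 := Finset.HasAntidiagonal.mem_antidiagonal.1 h1
    rw [h a.1 h3, sum_pow_eq_of_esymm_eq h (by omega) (by omega)]
  rw [sum_pow_eq_mul_esymm_sub_sum s hd, sum_pow_eq_mul_esymm_sub_sum t hd, hsum]
  ring

section Orbits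

variable {K L : Type*} [Field K] [Fintype K] [Field L] [Algebra K L]

/-- X^q - X is the product of X - a over a in K, so it has no further roots in L. -/
theorem mem_range_algebraMap_of_pow_card_eq {x : L} (hx : x ^ Fintype.card K = x) :
    x ∈ (algebraMap K L).range := by
  have h1 : (X ^ Fintype.card K - X : K[X]) = ∏ a : K, (X - C a) := by
    have hne := FiniteField.X_pow_card_sub_X_ne_zero K (Fintype.one_lt_card (α := K))
    have hdeg := FiniteField.X_pow_card_sub_X_natDegree_eq K (Fintype.one_lt_card (α := K))
    have hroots := FiniteField.roots_X_pow_card_sub_X K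
    have hmon : (X ^ Fintype.card K - X : K[X]).Monic :=
      monic_X_pow_sub (by rw [degree_X]; exact_mod_cast Fintype.one_lt_card (α := K))
    have := prod_multiset_X_sub_C_of_monic_of_roots_card_eq hmon (by
      rw [hroots, hdeg]; rfl)
    rw [hroots] at this
    exact this.symm
  have h2 := congrArg (aeval x) h1
  rw [map_sub, map_pow, aeval_X, hx, sub_self, map_prod] at h2
  obtain ⟨a, -, ha⟩ := Finset.prod_eq_zero_iff.1 h2.symm
  rw [map_sub, aeval_X, aeval_C, sub_eq_zero] at ha
  exact ⟨a, ha.symm⟩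

variable (K) in
/-- The `q`-power Frobenius map. -/
noncomputable def frob (x : L) : L := FiniteField.frobeniusAlgHom K L x

theorem frob_eq (x : L) : frob K x = x ^ Fintype.card K := rfl

theorem frob_iterate (r : ℕ) (x : L) : (frob K)^[r] x = x ^ Fintype.card K ^ r := by
  induction r with
  | zero => simp
  | succ r ih => rw [Function.iterate_succ_apply', ih, frob_eq, ← pow_mul, pow_succ]

theorem frob_injective : Function.Injective (frob K : L → L) :=
  (FiniteField.frobeniusAlgHom K L).toRingHom.injective

theorem roots_map_frob [IsAlgClosed L] (g : K[X]) :
    (g.map (algebraMap K L)).roots.map (frob K) = (g.map (algebraMap K L)).roots := by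
  have h := Splits.roots_map (IsAlgClosed.splits (g.map (algebraMap K L)))
    (FiniteField.frobeniusAlgHom K L : L →+* L)
  rw [Polynomial.map_map, AlgHom.comp_algebraMap] at h
  exact h.symm

theorem count_roots_frob_iterate [IsAlgClosed L] [DecidableEq L] (g : K[X]) (r : ℕ) (x : L) :
    (g.map (algebraMap K L)).roots.count ((frob K)^[r] x) =
      (g.map (algebraMap K L)).roots.count x := by
  induction r with
  | zero => rfl
  | succ r ih =>
    rw [Function.iterate_succ_apply']
    conv_lhs => rw [← roots_map_frob g]
    rw [Multiset.count_map_eq_count' _ _ frob_injective, ih]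

variable (K) in
/-- The first `r` Frobenius conjugates of `x`. -/
noncomputable def frobOrbit (r : ℕ) (x : L) : Multiset L :=
  (Multiset.range r).map fun i => (frob K)^[i] x

theorem frobOrbit_card (r : ℕ) (x : L) : (frobOrbit K r x).card = r := by simp [frobOrbit]

/-- Frobenius preserves the finite set of roots and is injective; a non-periodic root would produce
infinitely many. -/
theorem mem_periodicPts_of_mem_roots [IsAlgClosed L] {g : K[X]} {x : L}
    (hx : x ∈ (g.map (algebraMap K L)).roots) : x ∈ Function.periodicPts (frob K) := by
  classical
  by_contra h
  have hinj : Function.Injective fun i : ℕ => (frob K)^[i] x := by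
    intro i j hij
    rcases lt_trichotomy i j with hlt | heq | hlt
    · exact absurd ((Function.mk_mem_periodicPts (n := j - i) (by omega)
        (Function.iterate_cancel frob_injective hij.symm))) h
    · exact heq
    · exact absurd ((Function.mk_mem_periodicPts (n := i - j) (by omega)
        (Function.iterate_cancel frob_injective hij))) h
  refine Set.infinite_of_injective_forall_mem hinj (s := ((g.map (algebraMap K L)).roots.toFinset :
    Set L)) (fun i => ?_) (Finset.finite_toSet _)
  rw [Finset.mem_coe, Multiset.mem_toFinset, ← Multiset.count_pos, count_roots_frob_iterate,
    Multiset.count_pos]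
  exact hx

theorem frobOrbit_mul [DecidableEq L] {x : L} {e : ℕ} (he : (frob K)^[e] x = x) (j : ℕ) :
    frobOrbit K (e * j) x = j • frobOrbit K e x := by
  induction j with
  | zero => simp [frobOrbit]
  | succ j ih =>
    have h1 : frobOrbit K (e * (j + 1)) x = frobOrbit K (e * j) x + frobOrbit K e x := by
      rw [frobOrbit, Nat.mul_succ, Multiset.range_add, Multiset.map_add, Multiset.map_map]
      congr 1
      refine Multiset.map_congr rfl fun i _ => ?_
      have h2 : (frob K)^[e * j] x = x := Function.IsPeriodicPt.mul_const (m := e) he j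
      rw [Function.comp_apply, add_comm, Function.iterate_add_apply, h2]
    rw [h1, ih, succ_nsmul]

/-- The number of `r ≥ 1` for which `x ∈ 𝔽_{q^r}` and the characteristic polynomial of `x`
over `𝔽_q` divides `g` is the multiplicity of `x` as a root of `g`. -/
theorem card_frobOrbit_le_roots [IsAlgClosed L] [DecidableEq L] {g : K[X]} (hg : g.Monic) {x : L}
    (hx : x ∈ (g.map (algebraMap K L)).roots) :
    ((Finset.Icc 1 g.natDegree).filter fun r => (frob K)^[r] x = x ∧
      frobOrbit K r x ≤ (g.map (algebraMap K L)).roots).card =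
      (g.map (algebraMap K L)).roots.count x := by
  set R := (g.map (algebraMap K L)).roots with hR
  set e := Function.minimalPeriod (frob K) x with he_def
  have he0 : 0 < e := Function.minimalPeriod_pos_of_mem_periodicPts (mem_periodicPts_of_mem_roots hx)
  have he : (frob K)^[e] x = x := Function.isPeriodicPt_minimalPeriod _ _
  have hnodup : (frobOrbit K e x).Nodup := by
    refine (Multiset.nodup_map_iff_inj_on (Multiset.nodup_range e)).2 fun i hi j hj h => ?_
    exact (Function.iterate_injOn_Iio_minimalPeriod (f := frob K) (x := x))
      (by simpa using hi) (by simpa using hj) h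
  have hxmem : x ∈ frobOrbit K e x :=
    Multiset.mem_map.2 ⟨0, by simpa using he0, rfl⟩
  have hcard : Multiset.card R = g.natDegree := by
    rw [hR, splits_iff_card_roots.1 (IsAlgClosed.splits _), hg.natDegree_map]
  -- With e the exact period, the orbit of length ej is j copies of e distinct conjugates, each of
  -- the same multiplicity in R as x.
  have hle : ∀ j, frobOrbit K (e * j) x ≤ R ↔ j ≤ R.count x := by
    intro j
    rw [frobOrbit_mul he, Multiset.le_iff_count]
    constructor
    · intro h
      have h1 := h x
      rwa [Multiset.count_nsmul, Multiset.count_eq_one_of_mem hnodup hxmem, mul_one] at h1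
    · intro h a
      rw [Multiset.count_nsmul]
      by_cases ha : a ∈ frobOrbit K e x
      · obtain ⟨i, -, rfl⟩ := Multiset.mem_map.1 ha
        rw [Multiset.count_eq_one_of_mem hnodup ha, mul_one, hR, count_roots_frob_iterate]
        exact h
      · rw [Multiset.count_eq_zero_of_notMem ha, mul_zero]
        exact Nat.zero_le _
  have himage : (Finset.Icc 1 g.natDegree).filter (fun r => (frob K)^[r] x = x ∧
      frobOrbit K r x ≤ R) = (Finset.Icc 1 (R.count x)).image (e * ·) := by
    ext r
    simp only [Finset.mem_filter, Finset.mem_Icc, Finset.mem_image]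
    constructor
    · rintro ⟨⟨h1, h2⟩, h3, h4⟩
      obtain ⟨j, rfl⟩ := Function.isPeriodicPt_iff_minimalPeriod_dvd.1 h3
      refine ⟨j, ⟨?_, (hle j).1 h4⟩, rfl⟩
      exact Nat.pos_of_ne_zero fun h => by simp [h] at h1
    · rintro ⟨j, ⟨h1, h2⟩, rfl⟩
      have h3 := (hle j).2 h2
      refine ⟨⟨Nat.mul_pos he0 h1, ?_⟩, Function.IsPeriodicPt.mul_const (m := e) he j, h3⟩
      rw [← hcard, ← frobOrbit_card (K := K) (e * j) x]
      exact Multiset.card_le_card h3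
  rw [himage, Finset.card_image_of_injective _ (mul_right_injective₀ he0.ne')]
  simp

/-- The characteristic polynomial over `𝔽_q` of an element of `𝔽_{q^r}`. -/
theorem exists_monic_roots_eq_frobOrbit {r : ℕ} {x : L} (hx : (frob K)^[r] x = x) :
    ∃ P : K[X], P.Monic ∧ P.natDegree = r ∧
      (P.map (algebraMap K L)).roots = frobOrbit K r x := by
  set Q : L[X] := ((frobOrbit K r x).map fun a => X - C a).prod with hQ
  have hmonic : Q.Monic := monic_multiset_prod_of_monic _ _ fun a _ => monic_X_sub_C a
  have hroots : Q.roots = frobOrbit K r x := roots_multiset_prod_X_sub_C _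
  -- Frobenius shifts the list of conjugates by one place and the last returns to x. Hence the
  -- coefficients of Q are fixed by Frobenius and lie in K.
  have hmap : (frobOrbit K r x).map (frob K) = frobOrbit K r x := by
    cases r with
    | zero => simp [frobOrbit]
    | succ r =>
      have h1 : (frobOrbit K (r + 1) x).map (frob K) =
          (Multiset.range (r + 1)).map fun i => (frob K)^[i + 1] x := by
        rw [frobOrbit, Multiset.map_map]
        refine Multiset.map_congr rfl fun i _ => ?_
        rw [Function.comp_apply, Function.iterate_succ_apply']
      have h2 : frobOrbit K (r + 1) x =
          x ::ₘ (Multiset.range r).map fun i => (frob K)^[i + 1] x := by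
        rw [frobOrbit, add_comm r 1, Multiset.range_add, Multiset.map_add, Multiset.map_map]
        simp [add_comm]
        rfl
      rw [h1, h2, Multiset.range_succ, Multiset.map_cons, hx]
  have hQmap : Q.map (FiniteField.frobeniusAlgHom K L : L →+* L) = Q := by
    rw [hQ, Polynomial.map_multiset_prod, Multiset.map_map]
    conv_rhs => rw [← hmap, Multiset.map_map]
    refine congrArg Multiset.prod (Multiset.map_congr rfl fun a _ => ?_)
    simp only [Function.comp_apply, Polynomial.map_sub, Polynomial.map_X, Polynomial.map_C]
    rfl
  have hlift : Q ∈ lifts (algebraMap K L) := by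
    rw [lifts_iff_coeff_lifts]
    intro n
    refine mem_range_algebraMap_of_pow_card_eq ?_
    conv_rhs => rw [← hQmap, coeff_map]
    rfl
  obtain ⟨P, hP1, hP2, hP3⟩ := lifts_and_natDegree_eq_and_monic hlift hmonic
  refine ⟨P, hP3, ?_, by rw [hP1, hroots]⟩
  rw [hP2, hQ, natDegree_multiset_prod_X_sub_C_eq_card, frobOrbit_card]

end Orbits

end

/-! ### The L-function of an additive character sum -/

section

open Polynomial

/-- Monic polynomials of degree `m`. -/
abbrev MonicOfDegree (K : Type*) [Field K] (m : ℕ) := {g : K[X] // g.Monic ∧ g.natDegree = m}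

instance {K : Type*} [Field K] [Finite K] (m : ℕ) : Finite (MonicOfDegree K m) := by
  refine Finite.of_injective (β := Fin m → K) (fun g i => g.1.coeff i) fun g h hgh => ?_
  refine Subtype.ext (Polynomial.ext fun n => ?_)
  rcases lt_trichotomy n m with hn | hn | hn
  · exact congrFun hgh ⟨n, hn⟩
  · have h1 := g.2.1.coeff_natDegree
    have h2 := h.2.1.coeff_natDegree
    rw [g.2.2] at h1
    rw [h.2.2] at h2
    rw [hn, h1, h2]
  · rw [coeff_eq_zero_of_natDegree_lt (by rw [g.2.2]; exact hn),
      coeff_eq_zero_of_natDegree_lt (by rw [h.2.2]; exact hn)]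

noncomputable instance {K : Type*} [Field K] [Finite K] (m : ℕ) : Fintype (MonicOfDegree K m) :=
  Fintype.ofFinite _

section LFunction

variable {K L : Type*} [Field K] [Field L] [Algebra K L]

/-- The sum of the values of `f` over a multiset. -/
noncomputable def rootSum (f : K[X]) (s : Multiset L) : L := (s.map fun x => aeval x f).sum

theorem rootSum_add (f : K[X]) (s t : Multiset L) :
    rootSum f (s + t) = rootSum f s + rootSum f t := by
  simp [rootSum]

theorem rootSum_eq_sum (f : K[X]) (s : Multiset L) : rootSum f s =
    ∑ i ∈ Finset.range (f.natDegree + 1), algebraMap K L (f.coeff i) * (s.map (· ^ i)).sum := by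
  induction s using Multiset.induction_on with
  | empty => simp [rootSum]
  | cons a s ih =>
    rw [← Multiset.singleton_add, rootSum_add, ih]
    simp only [Multiset.map_add, Multiset.sum_add, mul_add, Finset.sum_add_distrib]
    congr 1
    simp [rootSum, aeval_eq_sum_range, Algebra.smul_def]

/-- Power sums of exponent below deg f agree by Newton's identities, so only the leading term of f
sees the difference. -/
theorem rootSum_sub_rootSum {f : K[X]} (hd : 0 < f.natDegree) {s t : Multiset L}
    (hcard : Multiset.card s = Multiset.card t) (h : ∀ i < f.natDegree, s.esymm i = t.esymm i) :
    rootSum f s - rootSum f t = algebraMap K L f.leadingCoeff *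
      ((-1) ^ (f.natDegree + 1) * f.natDegree * (s.esymm f.natDegree - t.esymm f.natDegree)) := by
  rw [rootSum_eq_sum, rootSum_eq_sum, Finset.sum_range_succ, Finset.sum_range_succ,
    ← sum_pow_sub_sum_pow_of_esymm_eq hd h]
  have : ∑ i ∈ Finset.range f.natDegree, algebraMap K L (f.coeff i) * (s.map (· ^ i)).sum =
      ∑ i ∈ Finset.range f.natDegree, algebraMap K L (f.coeff i) * (t.map (· ^ i)).sum := by
    refine Finset.sum_congr rfl fun i hi => ?_
    rcases Nat.eq_zero_or_pos i with rfl | hi0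
    · simp [hcard]
    · rw [sum_pow_eq_of_esymm_eq h hi0 (Finset.mem_range.1 hi)]
  rw [this, leadingCoeff]
  ring

theorem card_roots_map [IsAlgClosed L] {g : K[X]} (hg : g.Monic) :
    Multiset.card (g.map (algebraMap K L)).roots = g.natDegree := by
  rw [splits_iff_card_roots.1 (IsAlgClosed.splits _), hg.natDegree_map]

theorem esymm_roots_map [IsAlgClosed L] {g : K[X]} (hg : g.Monic) {i : ℕ} (hi : i ≤ g.natDegree) :
    (g.map (algebraMap K L)).roots.esymm i =
      (-1) ^ i * algebraMap K L (g.coeff (g.natDegree - i)) := by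
  have h := coeff_eq_esymm_roots_of_splits (IsAlgClosed.splits (g.map (algebraMap K L)))
    (k := g.natDegree - i) (by rw [hg.natDegree_map]; omega)
  rw [coeff_map, (hg.map _).leadingCoeff, hg.natDegree_map, one_mul,
    show g.natDegree - (g.natDegree - i) = i by omega] at h
  rw [h, ← mul_assoc, ← pow_add, Even.neg_one_pow ⟨i, rfl⟩, one_mul]

variable [Fintype K]

/-- The coefficients of the L-function of the exponential sum attached to `f`. -/
noncomputable def lCoeff (Ψ : AddChar L ℂ) (f : K[X]) (m : ℕ) : ℂ :=
  ∑ g : MonicOfDegree K m, Ψ (rootSum f (g.1.map (algebraMap K L)).roots)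

variable (K L) in
/-- The elements of `𝔽_{q^r}`. -/
noncomputable def fixedPts (r : ℕ) : Finset L :=
  letI := Classical.decEq L
  (X ^ (Fintype.card K ^ r) - X : L[X]).roots.toFinset

theorem mem_fixedPts {r : ℕ} (hr : r ≠ 0) {x : L} : x ∈ fixedPts K L r ↔ (frob K)^[r] x = x := by
  classical
  have hne := FiniteField.X_pow_card_pow_sub_X_ne_zero L hr (Fintype.one_lt_card (α := K))
  rw [fixedPts, Multiset.mem_toFinset, mem_roots hne, IsRoot, eval_sub, eval_pow, eval_X,
    sub_eq_zero, frob_iterate]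

/-- The exponential sum over `𝔽_{q^r}`. -/
noncomputable def extSum (Ψ : AddChar L ℂ) (f : K[X]) (r : ℕ) : ℂ :=
  ∑ x ∈ fixedPts K L r, Ψ (rootSum f (frobOrbit K r x))

theorem lCoeff_zero (Ψ : AddChar L ℂ) (f : K[X]) : lCoeff Ψ f 0 = 1 := by
  have h : ∀ g : MonicOfDegree K 0, g = ⟨1, monic_one, natDegree_one⟩ := fun g =>
    Subtype.ext (eq_one_of_monic_natDegree_zero g.2.1 g.2.2)
  rw [lCoeff, Fintype.sum_eq_single _ fun g hg => absurd (h g) hg]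
  simp [rootSum]

variable [IsAlgClosed L]

/-- Each root x accounts for as many r as its multiplicity, and the multiplicities add up to the
degree. This is deg g = Σ deg P over all prime powers P^j dividing g, in terms of points instead of
primes. -/
theorem sum_card_frobOrbit_le [DecidableEq L] {g : K[X]} (hg : g.Monic) :
    ∑ r ∈ Finset.Icc 1 g.natDegree, ∑ x ∈ fixedPts K L r,
      (if frobOrbit K r x ≤ (g.map (algebraMap K L)).roots then 1 else 0) = g.natDegree := by
  set R := (g.map (algebraMap K L)).roots with hR
  have h1 : ∑ x ∈ R.toFinset, R.count x = g.natDegree := by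
    rw [Multiset.toFinset_sum_count_eq, card_roots_map hg]
  have h2 : ∑ x ∈ R.toFinset, R.count x = ∑ x ∈ R.toFinset, ∑ r ∈ Finset.Icc 1 g.natDegree,
      (if (frob K)^[r] x = x ∧ frobOrbit K r x ≤ R then 1 else 0) := by
    refine Finset.sum_congr rfl fun x hx => ?_
    rw [← card_frobOrbit_le_roots hg (Multiset.mem_toFinset.1 hx), Finset.card_filter]
  rw [h2, Finset.sum_comm] at h1
  refine Eq.trans ?_ h1
  refine Finset.sum_congr rfl fun r hr => ?_
  have hr1 : 1 ≤ r := (Finset.mem_Icc.1 hr).1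
  rw [← Finset.card_filter, ← Finset.card_filter]
  congr 1
  ext x
  simp only [Finset.mem_filter, Multiset.mem_toFinset, mem_fixedPts (K := K) (by omega : r ≠ 0)]
  constructor
  · rintro ⟨h2, h3⟩
    refine ⟨Multiset.mem_of_le h3 ?_, h2, h3⟩
    exact Multiset.mem_map.2 ⟨0, Multiset.mem_range.2 hr1, rfl⟩
  · rintro ⟨-, h2, h3⟩
    exact ⟨h2, h3⟩

/-- The g in question are exactly the multiples P h of the characteristic polynomial P of x, and g ↦
Ψ(rootSum f (roots of g)) is multiplicative. -/
theorem sum_of_frobOrbit_le [DecidableEq L] (Ψ : AddChar L ℂ) (f : K[X]) {m r : ℕ} (hrm : r ≤ m)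
    {x : L} (hx : (frob K)^[r] x = x) :
    ∑ g : MonicOfDegree K m, (if frobOrbit K r x ≤ (g.1.map (algebraMap K L)).roots then
      Ψ (rootSum f (g.1.map (algebraMap K L)).roots) else 0) =
      Ψ (rootSum f (frobOrbit K r x)) * lCoeff Ψ f (m - r) := by
  obtain ⟨P, hP1, hP2, hP3⟩ := exists_monic_roots_eq_frobOrbit hx
  rw [lCoeff, Finset.mul_sum, ← Finset.sum_filter]
  symm
  have hroots : ∀ h : K[X], h.Monic → ((P * h).map (algebraMap K L)).roots =
      frobOrbit K r x + (h.map (algebraMap K L)).roots := by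
    intro h hh
    rw [Polynomial.map_mul, roots_mul (mul_ne_zero (hP1.map _).ne_zero (hh.map _).ne_zero), hP3]
  refine Finset.sum_bij (fun h _ => (⟨P * h.1, hP1.mul h.2.1, by
      rw [hP1.natDegree_mul h.2.1, hP2, h.2.2]; omega⟩ : MonicOfDegree K m)) ?_ ?_ ?_ ?_
  · intro h _
    rw [Finset.mem_filter]
    refine ⟨Finset.mem_univ _, ?_⟩
    rw [hroots _ h.2.1]
    exact Multiset.le_add_right _ _
  · intro h _ h' _ heq
    exact Subtype.ext (mul_left_cancel₀ hP1.ne_zero (congrArg Subtype.val heq))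
  · intro g hg
    have hle := (Finset.mem_filter.1 hg).2
    have hdvd : P.map (algebraMap K L) ∣ g.1.map (algebraMap K L) := by
      rw [← prod_multiset_X_sub_C_of_monic_of_roots_card_eq (hP1.map (algebraMap K L))
        (splits_iff_card_roots.1 (IsAlgClosed.splits _)), hP3]
      exact (Multiset.prod_X_sub_C_dvd_iff_le_roots (g.2.1.map _).ne_zero _).2 hle
    obtain ⟨h, hh⟩ := (Polynomial.map_dvd_map' (algebraMap K L)).1 hdvd
    have hmon : h.Monic := hP1.of_mul_monic_left (hh ▸ g.2.1)
    refine ⟨⟨h, hmon, ?_⟩, Finset.mem_univ _, Subtype.ext hh.symm⟩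
    have h3 := g.2.2
    rw [hh, hP1.natDegree_mul hmon, hP2] at h3
    omega
  · intro h _
    rw [hroots _ h.2.1, rootSum_add, AddChar.map_add_eq_mul]

/-- The logarithmic derivative of the Euler product. -/
theorem mul_lCoeff_eq_sum (Ψ : AddChar L ℂ) (f : K[X]) (m : ℕ) :
    (m : ℂ) * lCoeff Ψ f m = ∑ r ∈ Finset.Icc 1 m, extSum Ψ f r * lCoeff Ψ f (m - r) := by
  classical
  have h1 : ∀ g : MonicOfDegree K m, (m : ℂ) * Ψ (rootSum f (g.1.map (algebraMap K L)).roots) =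
      ∑ r ∈ Finset.Icc 1 m, ∑ x ∈ fixedPts K L r,
        (if frobOrbit K r x ≤ (g.1.map (algebraMap K L)).roots then
          Ψ (rootSum f (g.1.map (algebraMap K L)).roots) else 0) := by
    intro g
    have h2 := sum_card_frobOrbit_le (L := L) g.2.1
    rw [g.2.2] at h2
    have h3 := congrArg (Nat.cast : ℕ → ℂ) h2
    push_cast at h3
    conv_lhs => rw [← h3]
    simp only [Finset.sum_mul, ite_mul, one_mul, zero_mul]
  rw [lCoeff, Finset.mul_sum, Finset.sum_congr rfl fun g _ => h1 g, Finset.sum_comm]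
  refine Finset.sum_congr rfl fun r hr => ?_
  obtain ⟨hr1, hr2⟩ := Finset.mem_Icc.1 hr
  rw [Finset.sum_comm, extSum, Finset.sum_mul]
  exact Finset.sum_congr rfl fun x hx =>
    sum_of_frobOrbit_le Ψ f hr2 ((mem_fixedPts (by omega)).1 hx)

/-- The L-function is a polynomial of degree less than `deg f`. -/
theorem lCoeff_eq_zero {Ψ : AddChar L ℂ} (hΨ : ∃ c : K, Ψ (algebraMap K L c) ≠ 1) {f : K[X]}
    (hd : (f.natDegree : K) ≠ 0) {m : ℕ} (hm : f.natDegree ≤ m) : lCoeff Ψ f m = 0 := by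
  set d := f.natDegree with hd_def
  have hd0 : 0 < d := Nat.pos_of_ne_zero fun h => hd (by rw [h]; simp)
  have hf : f ≠ 0 := fun h => by simp [hd_def, h] at hd0
  have hdeg : ∀ c : K, (C c * X ^ (m - d)).degree < (m : WithBot ℕ) := fun c =>
    (degree_C_mul_X_pow_le _ _).trans_lt (by exact_mod_cast (by omega : m - d < m))
  have hT : ∀ (c : K) (g : MonicOfDegree K m),
      (g.1 + C c * X ^ (m - d)).Monic ∧ (g.1 + C c * X ^ (m - d)).natDegree = m := by
    intro c g
    have hgdeg : g.1.degree = m := by rw [degree_eq_natDegree g.2.1.ne_zero, g.2.2]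
    refine ⟨g.2.1.add_of_left (by rw [hgdeg]; exact hdeg c), ?_⟩
    refine natDegree_eq_of_degree_eq_some ?_
    rw [degree_add_eq_left_of_degree_lt (by rw [hgdeg]; exact hdeg c), hgdeg]
  -- Adding c X^(m-d) to g changes no elementary symmetric function of the roots except the d-th, so
  -- it multiplies every term of `lCoeff` by one common constant.
  let T : K → MonicOfDegree K m ≃ MonicOfDegree K m := fun c =>
    { toFun := fun g => ⟨_, hT c g⟩
      invFun := fun g => ⟨_, hT (-c) g⟩
      left_inv := fun g => Subtype.ext (by simp)
      right_inv := fun g => Subtype.ext (by simp) }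
  obtain ⟨c₀, hc₀⟩ := hΨ
  have hlc : f.leadingCoeff ≠ 0 := leadingCoeff_ne_zero.2 hf
  -- Since d and the leading coefficient are invertible in K, c can be chosen so that this constant
  -- is Ψ(c₀) ≠ 1; the sum must then vanish.
  obtain ⟨c, hc⟩ : ∃ c : K, f.leadingCoeff * (-(d * c)) = c₀ :=
    ⟨-(c₀ / (f.leadingCoeff * d)), by field_simp⟩
  have hesymm : ∀ (g : MonicOfDegree K m) (i : ℕ), i ≤ m →
      ((T c g).1.map (algebraMap K L)).roots.esymm i = (g.1.map (algebraMap K L)).roots.esymm i +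
        (-1) ^ i * algebraMap K L (if i = d then c else 0) := by
    intro g i hi
    rw [esymm_roots_map (T c g).2.1 (by rw [(T c g).2.2]; exact hi),
      esymm_roots_map g.2.1 (by rw [g.2.2]; exact hi), (T c g).2.2, g.2.2, ← mul_add, ← map_add]
    congr 2
    change (g.1 + C c * X ^ (m - d)).coeff (m - i) = _
    rw [coeff_add, coeff_C_mul, coeff_X_pow]
    congr 1
    by_cases h : i = d
    · simp [h]
    · rw [if_neg h, if_neg (by omega), mul_zero]
  have hshift : ∀ g : MonicOfDegree K m,
      Ψ (rootSum f ((T c g).1.map (algebraMap K L)).roots) =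
        Ψ (algebraMap K L c₀) * Ψ (rootSum f (g.1.map (algebraMap K L)).roots) := by
    intro g
    have h := rootSum_sub_rootSum (f := f) hd0
      (s := ((T c g).1.map (algebraMap K L)).roots) (t := (g.1.map (algebraMap K L)).roots)
      (by rw [card_roots_map (T c g).2.1, card_roots_map g.2.1, (T c g).2.2, g.2.2])
      (fun i hi => by rw [hesymm g i (by omega), if_neg hi.ne, map_zero, mul_zero, add_zero])
    rw [← hd_def, hesymm g d hm, if_pos rfl, add_sub_cancel_left] at h
    rw [← AddChar.map_add_eq_mul]
    congr 1
    rw [← sub_eq_iff_eq_add, h, ← map_natCast (algebraMap K L) d]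
    have hsign : (-1 : L) ^ (d + 1) * (-1) ^ d = -1 := by
      rw [pow_succ, mul_right_comm, ← pow_add, Even.neg_one_pow ⟨d, rfl⟩, one_mul]
    rw [← hc, map_mul, map_neg, map_mul]
    linear_combination (algebraMap K L f.leadingCoeff * algebraMap K L d * algebraMap K L c) * hsign
  have hsum : lCoeff Ψ f m = Ψ (algebraMap K L c₀) * lCoeff Ψ f m := by
    conv_lhs => rw [lCoeff, ← Equiv.sum_comp (T c)]
    rw [Finset.sum_congr rfl fun g _ => hshift g, ← Finset.mul_sum, lCoeff]
  have h1 : (Ψ (algebraMap K L c₀) - 1) * lCoeff Ψ f m = 0 := by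
    linear_combination -hsum
  exact (mul_eq_zero.1 h1).resolve_left (sub_ne_zero.2 hc₀)

/-- The exponential sums over all extensions are power sums of at most `deg f - 1` numbers. -/
theorem exists_extSum_eq_neg_sum_pow {Ψ : AddChar L ℂ} (hΨ : ∃ c : K, Ψ (algebraMap K L c) ≠ 1)
    {f : K[X]} (hd : (f.natDegree : K) ≠ 0) : ∃ ω : Multiset ℂ,
      Multiset.card ω = f.natDegree - 1 ∧ ∀ r, 0 < r → extSum Ψ f r = -(ω.map (· ^ r)).sum := by
  set D := f.natDegree - 1 with hD
  have hd0 : 0 < f.natDegree := Nat.pos_of_ne_zero fun h => hd (by rw [h]; simp)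
  -- P is the L-function with its coefficients reversed. It is monic because the L-function has
  -- constant term 1, and its roots are the required numbers, with 0 occurring if the degree of the
  -- L-function drops.
  set P : ℂ[X] := ∑ i ∈ Finset.range (D + 1), C (lCoeff Ψ f (D - i)) * X ^ i with hP
  have hcoeff : ∀ i ≤ D, P.coeff i = lCoeff Ψ f (D - i) := by
    intro i hi
    rw [hP, finsetSum_coeff, Finset.sum_eq_single i]
    · simp
    · intro j _ hj
      rw [coeff_C_mul, coeff_X_pow, if_neg (Ne.symm hj), mul_zero]
    · intro h
      exact absurd (Finset.mem_range.2 (by omega)) h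
  have hle : P.natDegree ≤ D := by
    refine natDegree_sum_le_of_forall_le _ _ fun i hi => ?_
    exact (natDegree_C_mul_X_pow_le _ _).trans (by have := Finset.mem_range.1 hi; omega)
  have hPD : P.coeff D = 1 := by rw [hcoeff D le_rfl, Nat.sub_self, lCoeff_zero]
  have hmonic : P.Monic := monic_of_natDegree_le_of_coeff_eq_one D hle hPD
  have hdeg : P.natDegree = D := natDegree_eq_of_le_of_coeff_ne_zero hle (by rw [hPD]; exact one_ne_zero)
  have hsplit := IsAlgClosed.splits P
  have hcard : Multiset.card P.roots = D := by rw [splits_iff_card_roots.1 hsplit, hdeg]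
  have hesymm : ∀ i, P.roots.esymm i = (-1) ^ i * lCoeff Ψ f i := by
    intro i
    rcases le_or_gt i D with hi | hi
    · have h := coeff_eq_esymm_roots_of_splits hsplit (k := D - i) (by omega)
      rw [hmonic.leadingCoeff, hdeg, hcoeff _ (by omega), one_mul,
        show D - (D - i) = i by omega] at h
      rw [h, ← mul_assoc, ← pow_add, Even.neg_one_pow ⟨i, rfl⟩, one_mul]
    · rw [lCoeff_eq_zero hΨ hd (by omega), mul_zero, Multiset.esymm,
        Multiset.powersetCard_eq_empty _ (by omega)]
      simp
  refine ⟨P.roots, hcard, fun r hr => ?_⟩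
  -- Newton's identities for the roots and `mul_lCoeff_eq_sum` are the same recursion up to sign.
  induction r using Nat.strong_induction_on with
  | _ r ih =>
    rw [sum_pow_eq_mul_esymm_sub_sum _ hr, hesymm]
    have hN := mul_lCoeff_eq_sum Ψ f r
    have hr' : Finset.Icc 1 r = insert r (Finset.Ico 1 r) := by
      ext i; simp only [Finset.mem_Icc, Finset.mem_insert, Finset.mem_Ico]; omega
    rw [hr', Finset.sum_insert (by simp), Nat.sub_self, lCoeff_zero, mul_one] at hN
    have hsum : ∑ a ∈ Finset.HasAntidiagonal.antidiagonal r with a.1 ∈ Set.Ioo 0 r,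
        (-1) ^ a.1 * P.roots.esymm a.1 * (P.roots.map (· ^ a.2)).sum =
        -∑ i ∈ Finset.Ico 1 r, extSum Ψ f i * lCoeff Ψ f (r - i) := by
      rw [← Finset.sum_neg_distrib]
      refine Finset.sum_bij (fun a _ => a.2) ?_ ?_ ?_ ?_
      · intro a ha
        obtain ⟨h1, h2, h3⟩ := Finset.mem_filter.1 ha
        have h4 := Finset.HasAntidiagonal.mem_antidiagonal.1 h1
        exact Finset.mem_Ico.2 (by omega)
      · intro a ha b hb hab
        have h1 := Finset.HasAntidiagonal.mem_antidiagonal.1 (Finset.mem_filter.1 ha).1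
        have h2 := Finset.HasAntidiagonal.mem_antidiagonal.1 (Finset.mem_filter.1 hb).1
        exact Prod.ext (by omega) hab
      · intro i hi
        obtain ⟨h1, h2⟩ := Finset.mem_Ico.1 hi
        refine ⟨(r - i, i), Finset.mem_filter.2
          ⟨Finset.HasAntidiagonal.mem_antidiagonal.2 (by simp only; omega), ?_⟩, rfl⟩
        exact ⟨by simp only; omega, by simp only; omega⟩
      · intro a ha
        obtain ⟨h1, h2, h3⟩ := Finset.mem_filter.1 ha
        have h4 := Finset.HasAntidiagonal.mem_antidiagonal.1 h1
        rw [ih a.2 (by omega) (by omega), hesymm, ← mul_assoc, ← pow_add,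
          Even.neg_one_pow ⟨a.1, rfl⟩, show r - a.2 = a.1 by omega]
        ring
    rw [hsum]
    have hsign : (-1 : ℂ) ^ (r + 1) * (-1) ^ r = -1 := by
      rw [pow_succ, mul_right_comm, ← pow_add, Even.neg_one_pow ⟨r, rfl⟩, one_mul]
    linear_combination -hN + (r : ℂ) * lCoeff Ψ f r * hsign

end LFunction

end

/-! ### Weil's bound from growth along extensions -/

section

open Polynomial

/-- If all power sums of a multiset are `O(B^j)`, then so are its elements. -/
theorem norm_le_of_norm_sum_pow_le {s : Multiset ℂ} {B C : ℝ} (hB : 0 < B)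
    (h : ∀ j : ℕ, 0 < j → ‖(s.map (· ^ j)).sum‖ ≤ C * B ^ j) {z : ℂ} (hz : z ∈ s) : ‖z‖ ≤ B := by
  classical
  by_contra hcon
  push Not at hcon
  -- Q isolates z: the sum of y^j Q(y) over s is the multiplicity of z times z^j, and it is also a
  -- fixed combination of the power sums of exponents j, j + 1, …, hence O(B^j).
  set Q : ℂ[X] := Lagrange.basis s.toFinset id z with hQ
  have hzs : z ∈ s.toFinset := Multiset.mem_toFinset.2 hz
  have hQ1 : Q.eval z = 1 := Lagrange.eval_basis_self (Set.injOn_id _) hzs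
  have hQ0 : ∀ y ∈ s, y ≠ z → Q.eval y = 0 := fun y hy hyz =>
    Lagrange.eval_basis_of_ne (v := id) (Ne.symm hyz) (Multiset.mem_toFinset.2 hy)
  have hkey : ∀ j : ℕ, (s.count z : ℂ) * z ^ j =
      ∑ i ∈ Finset.range (Q.natDegree + 1), Q.coeff i * (s.map (· ^ (j + i))).sum := by
    intro j
    have h1 : (s.map fun y => y ^ j * Q.eval y).sum = (s.count z : ℂ) * z ^ j := by
      rw [Finset.sum_multiset_map_count, Finset.sum_eq_single z]
      · rw [hQ1, mul_one, nsmul_eq_mul]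
      · intro y hy hyz
        rw [hQ0 y (Multiset.mem_toFinset.1 hy) hyz, mul_zero, smul_zero]
      · exact fun h => absurd hzs h
    rw [← h1]
    clear h1 hQ0 hzs hQ1 hQ hz h
    clear_value Q
    induction s using Multiset.induction_on with
    | empty => simp
    | cons a s ih =>
      simp only [Multiset.map_cons, Multiset.sum_cons, mul_add, Finset.sum_add_distrib]
      rw [ih, eval_eq_sum_range, Finset.mul_sum]
      congr 1
      exact Finset.sum_congr rfl fun i _ => by ring
  set M : ℝ := ∑ i ∈ Finset.range (Q.natDegree + 1), ‖Q.coeff i‖ * (C * B ^ i)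
  have hbound : ∀ j : ℕ, 0 < j → ‖z‖ ^ j ≤ M * B ^ j := by
    intro j hj
    have h1 : ‖z‖ ^ j ≤ ‖(s.count z : ℂ) * z ^ j‖ := by
      rw [norm_mul, norm_pow, Complex.norm_natCast]
      have : (1 : ℝ) ≤ s.count z := by exact_mod_cast Multiset.count_pos.2 hz
      exact le_mul_of_one_le_left (by positivity) this
    refine h1.trans ?_
    rw [hkey, Finset.sum_mul]
    refine norm_sum_le_of_le _ fun i _ => ?_
    rw [norm_mul, mul_assoc]
    refine mul_le_mul_of_nonneg_left ((h (j + i) (by omega)).trans_eq ?_) (norm_nonneg _)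
    ring
  obtain ⟨j, hj⟩ := pow_unbounded_of_one_lt M ((one_lt_div hB).2 hcon)
  have h1 := hbound (j + 1) (by omega)
  have h2 : M < (‖z‖ / B) ^ (j + 1) :=
    hj.trans_le (pow_le_pow_right₀ ((one_lt_div hB).2 hcon).le (by omega))
  rw [div_pow, lt_div_iff₀ (by positivity)] at h2
  exact absurd h1 (not_le.2 h2)

/-- Embedding E in L identifies it with the fixed points of the r-th Frobenius power, and the sum of
f over the conjugates of x is the trace of f(x). -/
theorem extSum_eq_sum_trace {K L E : Type*} [Field K] [Fintype K] [Field L] [Algebra K L]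
    [IsAlgClosed L] [Field E] [Fintype E] [Algebra K E] {Ψ : AddChar L ℂ} {ψ : AddChar K ℂ}
    (hΨ : ∀ c, Ψ (algebraMap K L c) = ψ c) (f : K[X]) :
    extSum Ψ f (Module.finrank K E) = ∑ x : E, ψ (Algebra.trace K E (aeval x f)) := by
  classical
  set r := Module.finrank K E with hr
  have hr0 : r ≠ 0 := Module.finrank_pos.ne'
  let ι : E →ₐ[K] L := IsAlgClosed.lift
  have hι : Function.Injective ι := ι.toRingHom.injective
  have hcardE : Fintype.card E = Fintype.card K ^ r := Module.card_eq_pow_finrank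
  have hfix : fixedPts K L r = Finset.univ.image ι := by
    symm
    refine Finset.eq_of_subset_of_card_le ?_ ?_
    · intro y hy
      obtain ⟨x, -, rfl⟩ := Finset.mem_image.1 hy
      rw [mem_fixedPts hr0, frob_iterate, ← map_pow, ← hcardE, FiniteField.pow_card]
    · rw [Finset.card_image_of_injective _ hι, Finset.card_univ, hcardE, fixedPts]
      refine (Multiset.toFinset_card_le _).trans ((card_roots' _).trans ?_)
      rw [FiniteField.X_pow_card_pow_sub_X_natDegree_eq L hr0 Fintype.one_lt_card]
  rw [extSum, hfix, Finset.sum_image fun x _ y _ h => hι h]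
  refine Finset.sum_congr rfl fun x _ => ?_
  rw [← hΨ]
  congr 1
  rw [← ι.commutes, FiniteField.algebraMap_trace_eq_sum_pow, ← hr, map_sum, rootSum, frobOrbit,
    Multiset.map_map]
  change ∑ i ∈ Finset.range r, _ = _
  refine Finset.sum_congr rfl fun i _ => ?_
  have hfr : ∀ (y : L), (frob K)^[i] (aeval y f) = aeval ((frob K)^[i] y) f := by
    intro y
    clear * -
    induction i with
    | zero => rfl
    | succ i ih =>
      rw [Function.iterate_succ_apply', Function.iterate_succ_apply', ih]
      exact (aeval_algHom_apply (FiniteField.frobeniusAlgHom K L) _ f).symm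
  rw [Function.comp_apply, ← hfr, aeval_algHom_apply, frob_iterate, map_pow,
    Nat.card_eq_fintype_card]

/-- Compose ψ with a K-linear retraction of L onto K. With a character on all of L, sums over
conjugates need not first be shown to lie in K. -/
theorem exists_addChar_extension {K : Type*} (L : Type*) [Field K] [Field L] [Algebra K L]
    (ψ : AddChar K ℂ) : ∃ Ψ : AddChar L ℂ, ∀ c, Ψ (algebraMap K L c) = ψ c := by
  obtain ⟨π, hπ⟩ := (Algebra.linearMap K L).exists_leftInverse_of_injective
    (LinearMap.ker_eq_bot.2 (algebraMap K L).injective)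
  refine ⟨ψ.compAddMonoidHom π.toAddMonoidHom, fun c => ?_⟩
  have := LinearMap.congr_fun hπ c
  simp only [LinearMap.comp_apply, Algebra.linearMap_apply, LinearMap.id_apply] at this
  simp [this]

/-- **Weil's bound** for additive character sums with polynomial argument. -/
theorem norm_sum_addChar_eval_le {K : Type*} [Field K] [Fintype K] {ψ : AddChar K ℂ} (hψ : ψ ≠ 1)
    {f : K[X]} (hd : (f.natDegree : K) ≠ 0) :
    ‖∑ x, ψ (f.eval x)‖ ≤ (f.natDegree - 1 : ℕ) * √(Fintype.card K) := by
  obtain ⟨p, hchar, n, hp, hcard⟩ := FiniteField.card' K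
  have : Fact p.Prime := ⟨hp⟩
  let _ : Algebra (ZMod p) K := ZMod.algebra K p
  set q := Fintype.card K with hq
  have hpd : ¬ p ∣ f.natDegree := by rwa [← CharP.cast_eq_zero_iff K p]
  obtain ⟨Ψ, hΨ⟩ := exists_addChar_extension (AlgebraicClosure K) ψ
  have hne : ∃ c : K, Ψ (algebraMap K (AlgebraicClosure K) c) ≠ 1 := by
    by_contra hcon
    push Not at hcon
    exact hψ (DFunLike.ext _ _ fun c => by rw [← hΨ, hcon]; rfl)
  obtain ⟨ω, hω1, hω2⟩ := exists_extSum_eq_neg_sum_pow hne hd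
  obtain ⟨C, hC⟩ := exists_norm_charSum_le hpd
  -- The crude bound applies only to fields of square order, so it is used for extensions of even
  -- degree 2j and bounds the power sums of the squares ω². Its constant does not depend on j.
  have hsq : ∀ j : ℕ, 0 < j → ‖((ω.map (· ^ 2)).map (· ^ j)).sum‖ ≤ C * (q : ℝ) ^ j := by
    intro j hj
    have : NeZero (2 * j) := ⟨by omega⟩
    let _ := Fintype.ofFinite (FiniteField.Extension K p (2 * j))
    have h1 := extSum_eq_sum_trace (E := FiniteField.Extension K p (2 * j)) hΨ f
    rw [FiniteField.finrank_extension, hω2 _ (by omega)] at h1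
    rw [Multiset.map_map]
    simp only [Function.comp_def, ← pow_mul]
    rw [← norm_neg, h1]
    let χ : AddChar (FiniteField.Extension K p (2 * j)) ℂ := ψ.compAddMonoidHom
      (Algebra.trace K (FiniteField.Extension K p (2 * j))).toAddMonoidHom
    have hχ : χ ≠ 1 := by
      intro hχ1
      refine hψ (DFunLike.ext _ _ fun c => ?_)
      obtain ⟨z, rfl⟩ := Algebra.trace_surjective K (FiniteField.Extension K p (2 * j)) c
      exact DFunLike.congr_fun hχ1 z
    have hcardE : Nat.card (FiniteField.Extension K p (2 * j)) = (p ^ (n * j : ℕ)) ^ 2 := by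
      rw [FiniteField.natCard_extension, Nat.card_eq_fintype_card, ← hq, hcard]
      ring
    have := hC (FiniteField.Extension K p (2 * j)) (n * j) hcardE χ hχ
      (f.map (algebraMap K _)) (natDegree_map _)
    rw [hcard]
    push_cast
    rw [← pow_mul]
    refine Eq.trans_le (congrArg _ (Finset.sum_congr rfl fun x _ => ?_)) this
    rw [eval_map_algebraMap]
    rfl
  have hq0 : (0 : ℝ) < q := by exact_mod_cast Fintype.card_pos
  have hnorm : ∀ z ∈ ω, ‖z‖ ≤ √q := by
    intro z hz
    refine Real.le_sqrt_of_sq_le ?_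
    rw [← norm_pow]
    exact norm_le_of_norm_sum_pow_le hq0 hsq (Multiset.mem_map_of_mem _ hz)
  have h1 := extSum_eq_sum_trace (E := K) hΨ f
  rw [Module.finrank_self, hω2 1 one_pos] at h1
  have h2 : ∑ x, ψ (f.eval x) = -ω.sum := by
    simp only [pow_one, Multiset.map_id'] at h1
    rw [h1]
    refine Finset.sum_congr rfl fun x _ => ?_
    rw [Algebra.trace_self_apply, coe_aeval_eq_eval]
  rw [h2, norm_neg, ← hω1]
  clear h1 h2 hω1 hω2 hsq
  induction ω using Multiset.induction_on with
  | empty => simp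
  | cons a s ih =>
    rw [Multiset.sum_cons, Multiset.card_cons]
    push_cast
    refine (norm_add_le _ _).trans ?_
    have h3 := ih fun z hz => hnorm z (Multiset.mem_cons_of_mem hz)
    have h4 := hnorm a (Multiset.mem_cons_self _ _)
    linarith

end

/-! ### Divisors, roots of unity modulo N, and primes not dividing N -/

/-- Bounding a multiplicative function by a small power of its argument. -/
theorem prod_factorization_le_rpow {ε M : ℝ} (hM : 1 ≤ M) {P : ℕ} {g : ℕ → ℕ → ℝ}
    (h0 : ∀ p a, 0 ≤ g p a) (h1 : ∀ p a : ℕ, p.Prime → 0 < a → g p a ≤ M * ((p : ℝ) ^ a) ^ ε)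
    (h2 : ∀ p a : ℕ, p.Prime → 0 < a → P ≤ p → g p a ≤ ((p : ℝ) ^ a) ^ ε) {N : ℕ} (hN : N ≠ 0) :
    N.factorization.prod g ≤ M ^ P * (N : ℝ) ^ ε := by
  have hNprod : (N : ℝ) ^ ε = ∏ p ∈ N.primeFactors, ((p : ℝ) ^ N.factorization p) ^ ε := by
    rw [Real.finsetProd_rpow _ _ fun p _ => by positivity]
    congr 1
    conv_lhs => rw [← Nat.prod_factorization_pow_eq_self hN]
    rw [Finsupp.prod]
    push_cast
    rfl
  have hMprod : ∏ p ∈ N.primeFactors, (if p < P then M else 1) ≤ M ^ P := by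
    rw [Finset.prod_ite, Finset.prod_const, Finset.prod_const_one, mul_one]
    refine pow_le_pow_right₀ hM ?_
    calc _ ≤ (Finset.range P).card := Finset.card_le_card fun p hp =>
          Finset.mem_range.2 (Finset.mem_filter.1 hp).2
      _ = P := Finset.card_range P
  calc N.factorization.prod g
      ≤ ∏ p ∈ N.primeFactors, ((if p < P then M else 1) * ((p : ℝ) ^ N.factorization p) ^ ε) := by
        rw [Finsupp.prod, Nat.support_factorization]
        refine Finset.prod_le_prod (fun p _ => h0 _ _) fun p hp => ?_
        have hp' := Nat.prime_of_mem_primeFactors hp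
        have hpos : 0 < N.factorization p :=
          hp'.factorization_pos_of_dvd hN (Nat.dvd_of_mem_primeFactors hp)
        split_ifs with h
        · exact h1 _ _ hp' hpos
        · rw [one_mul]
          exact h2 _ _ hp' hpos (not_lt.1 h)
    _ ≤ M ^ P * (N : ℝ) ^ ε := by
        rw [Finset.prod_mul_distrib, ← hNprod]
        exact mul_le_mul_of_nonneg_right hMprod (by positivity)

theorem exists_le_prime_rpow {ε : ℝ} (hε : 0 < ε) (c : ℝ) :
    ∃ P : ℕ, ∀ p : ℕ, P ≤ p → c ≤ (p : ℝ) ^ ε := by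
  have h := (tendsto_rpow_atTop hε).comp tendsto_natCast_atTop_atTop
  obtain ⟨P, hP⟩ := Filter.eventually_atTop.1 (h.eventually_ge_atTop c)
  exact ⟨P, hP⟩

/-- The divisor bound. -/
theorem exists_card_divisors_le_rpow {ε : ℝ} (hε : 0 < ε) :
    ∃ A : ℝ, ∀ N : ℕ, N ≠ 0 → (N.divisors.card : ℝ) ≤ A * (N : ℝ) ^ ε := by
  obtain ⟨P, hP⟩ := exists_le_prime_rpow hε 2
  set x : ℝ := (2 : ℝ) ^ ε - 1
  have hx : 0 < x := by
    have : 1 < (2 : ℝ) ^ ε := Real.one_lt_rpow (by norm_num) hε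
    simp only [x]; linarith
  set M : ℝ := max 1 x⁻¹
  have hM1 : 1 ≤ M := le_max_left _ _
  have hMx : 1 ≤ M * x := by
    calc 1 = x⁻¹ * x := (inv_mul_cancel₀ hx.ne').symm
      _ ≤ M * x := mul_le_mul_of_nonneg_right (le_max_right _ _) hx.le
  refine ⟨M ^ P, fun N hN => ?_⟩
  have hcard : (N.divisors.card : ℝ) = N.factorization.prod fun _ a => ((a : ℝ) + 1) := by
    rw [Nat.card_divisors hN, Finsupp.prod, Nat.support_factorization]
    push_cast
    rfl
  rw [hcard]
  have hpow : ∀ (p a : ℕ), ((p : ℝ) ^ a) ^ ε = ((p : ℝ) ^ ε) ^ a := fun p a => by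
    rw [← Real.rpow_natCast, ← Real.rpow_mul (by positivity), mul_comm,
      Real.rpow_mul (by positivity), Real.rpow_natCast]
  refine prod_factorization_le_rpow hM1 (fun p a => by positivity) ?_ ?_ hN
  · intro p a hp _
    rw [hpow]
    have h2p : (2 : ℝ) ^ ε ≤ (p : ℝ) ^ ε :=
      Real.rpow_le_rpow (by norm_num) (by exact_mod_cast hp.two_le) hε.le
    have hb : 1 + (a : ℝ) * x ≤ (1 + x) ^ a := one_add_mul_le_pow (by linarith) a
    have hb2 : (1 + x) ^ a ≤ ((p : ℝ) ^ ε) ^ a :=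
      pow_le_pow_left₀ (by linarith) (by simp only [x]; linarith) a
    calc (a : ℝ) + 1 ≤ M * (1 + a * x) := by
          have : (0 : ℝ) ≤ a := by positivity
          nlinarith
      _ ≤ _ := mul_le_mul_of_nonneg_left (hb.trans hb2) (by linarith)
  · intro p a hp _ hPp
    rw [hpow]
    calc (a : ℝ) + 1 ≤ 2 ^ a := by exact_mod_cast Nat.lt_two_pow_self
      _ ≤ _ := pow_le_pow_left₀ (by norm_num) (hP p hPp) a

/-- The number of `k`-th roots of unity in `ℤ/N`. -/
noncomputable def unityCount (k N : ℕ) : ℕ := Nat.card {u : (ZMod N)ˣ // u ^ k = 1}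

theorem card_pow_eq_one_le_of_isCyclic {G : Type*} [CommGroup G] [Finite G] [IsCyclic G] {k : ℕ}
    (hk : 0 < k) : Nat.card {u : G // u ^ k = 1} ≤ k := by
  classical
  have := Fintype.ofFinite G
  rw [Nat.card_eq_fintype_card, Fintype.card_subtype]
  exact IsCyclic.card_pow_eq_one_le hk

/-- Two solutions in one coset of H differ by a solution in the cyclic group H, so each coset
contains at most k. -/
theorem card_pow_eq_one_le_mul_index {G : Type*} [CommGroup G] [Finite G] (H : Subgroup G)
    [IsCyclic H] {k : ℕ} (hk : 0 < k) : Nat.card {u : G // u ^ k = 1} ≤ k * H.index := by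
  classical
  have := Fintype.ofFinite G
  have := Fintype.ofFinite (G ⧸ H)
  rw [Nat.card_eq_fintype_card, Fintype.card_subtype, Subgroup.index, Nat.card_eq_fintype_card]
  refine (Finset.card_le_mul_card_image (f := fun u : G => (u : G ⧸ H)) _ k ?_).trans
    (Nat.mul_le_mul_left _ (Finset.card_le_univ _))
  intro b hb
  obtain ⟨u₀, hu₀, rfl⟩ := Finset.mem_image.1 hb
  have hu₀' := (Finset.mem_filter.1 hu₀).2
  refine le_trans ?_ (card_pow_eq_one_le_of_isCyclic (G := H) hk)
  rw [← Fintype.card_coe, ← Nat.card_eq_fintype_card]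
  refine Nat.card_le_card_of_injective (fun u => (⟨⟨u₀⁻¹ * u.1, ?_⟩, ?_⟩ : {v : H // v ^ k = 1})) ?_
  · exact QuotientGroup.eq.1 (Finset.mem_filter.1 u.2).2.symm
  · have hu := (Finset.mem_filter.1 (Finset.mem_filter.1 u.2).1).2
    exact Subtype.ext (by simp [mul_pow, hu₀', hu])
  · intro u v h
    have h1 := congrArg (fun x : {v : H // v ^ k = 1} => (x.1 : G)) h
    exact Subtype.ext (mul_left_cancel h1)

/-- The units modulo p^a are cyclic except when p = 2 and a ≥ 3; there 5 generates a cyclic subgroup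
of index 2, whence the factor 2. -/
theorem unityCount_prime_pow {k : ℕ} (hk : 0 < k) {p a : ℕ} (hp : p.Prime) :
    unityCount k (p ^ a) ≤ 2 * k := by
  have : NeZero (p ^ a) := ⟨pow_ne_zero _ hp.ne_zero⟩
  by_cases hcyc : IsCyclic (ZMod (p ^ a))ˣ
  · exact (card_pow_eq_one_le_of_isCyclic hk).trans (by omega)
  · obtain rfl : p = 2 := by
      by_contra h2
      exact hcyc (ZMod.isCyclic_units_of_prime_pow p hp h2 a)
    have ha : 2 < a := by
      by_contra h
      exact hcyc ((ZMod.isCyclic_units_two_pow_iff a).2 (by omega))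
    obtain ⟨b, rfl⟩ : ∃ b, a = b + 3 := ⟨a - 3, by omega⟩
    have h5 : IsUnit (5 : ZMod (2 ^ (b + 3))) := by
      have : ((5 : ℕ) : ZMod (2 ^ (b + 3))) = 5 := by norm_cast
      rw [← this, ZMod.isUnit_iff_coprime]
      exact Nat.Coprime.pow_right _ (by norm_num)
    obtain ⟨u, hu⟩ := h5
    have hord : orderOf u = 2 ^ (b + 1) := by
      rw [← orderOf_units, hu, ZMod.orderOf_five]
    have hcard : Nat.card (ZMod (2 ^ (b + 3)))ˣ = 2 ^ (b + 2) := by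
      rw [Nat.card_eq_fintype_card, ZMod.card_units_eq_totient,
        Nat.totient_prime_pow_succ Nat.prime_two]
      simp
    have hidx : (Subgroup.zpowers u).index = 2 := by
      have h1 := (Subgroup.zpowers u).card_mul_index
      rw [Nat.card_zpowers, hord, hcard, pow_succ 2 (b + 1)] at h1
      exact Nat.eq_of_mul_eq_mul_left (by positivity) h1
    have := card_pow_eq_one_le_mul_index (Subgroup.zpowers u) hk
    rw [hidx] at this
    rw [unityCount]
    omega

theorem unityCount_mul (k : ℕ) {a b : ℕ} (hab : a.Coprime b) :
    unityCount k (a * b) = unityCount k a * unityCount k b := by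
  let e : (ZMod (a * b))ˣ ≃* (ZMod a)ˣ × (ZMod b)ˣ :=
    (Units.mapEquiv (ZMod.chineseRemainder hab).toMulEquiv).trans MulEquiv.prodUnits
  rw [unityCount, unityCount, unityCount, ← Nat.card_prod]
  refine Nat.card_congr ((e.toEquiv.subtypeEquiv (q := fun x => x.1 ^ k = 1 ∧ x.2 ^ k = 1) ?_).trans
    (Equiv.subtypeProdEquivProd (p := fun u : (ZMod a)ˣ => u ^ k = 1)
      (q := fun u : (ZMod b)ˣ => u ^ k = 1)))
  intro u
  rw [← e.map_eq_one_iff, map_pow, Prod.ext_iff]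
  rfl

theorem unityCount_le_prod {k : ℕ} (hk : 0 < k) {N : ℕ} (hN : N ≠ 0) :
    (unityCount k N : ℝ) ≤ N.factorization.prod fun _ _ => (2 * k : ℝ) := by
  induction N using Nat.recOnPosPrimePosCoprime with
  | prime_pow p a hp ha =>
    rw [hp.factorization_pow, Finsupp.prod, Finsupp.support_single _ ha.ne', Finset.prod_singleton]
    exact_mod_cast unityCount_prime_pow hk hp
  | zero => exact absurd rfl hN
  | one =>
    have : unityCount k 1 ≤ 1 := by
      rw [unityCount]
      exact Finite.card_le_one_iff_subsingleton.2 inferInstance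
    simpa using this
  | coprime a b ha hb hab iha ihb =>
    rw [unityCount_mul k hab, Nat.factorization_mul_of_coprime hab,
      Finsupp.prod_add_index_of_disjoint (by simpa using hab.disjoint_primeFactors)]
    push_cast
    exact mul_le_mul (iha (by omega)) (ihb (by omega)) (by positivity)
      (Finset.prod_nonneg fun _ _ => by positivity)

/-- The number of `k`-th roots of unity modulo `N` is `N^{o(1)}`. -/
theorem exists_unityCount_le_rpow {k : ℕ} (hk : 0 < k) {ε : ℝ} (hε : 0 < ε) :
    ∃ A : ℝ, ∀ N : ℕ, N ≠ 0 → (unityCount k N : ℝ) ≤ A * (N : ℝ) ^ ε := by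
  obtain ⟨P, hP⟩ := exists_le_prime_rpow hε (2 * k)
  have hk1 : (1 : ℝ) ≤ k := by exact_mod_cast hk
  refine ⟨(2 * k) ^ P, fun N hN => (unityCount_le_prod hk hN).trans ?_⟩
  have hge : ∀ p a : ℕ, p.Prime → 0 < a → (p : ℝ) ^ ε ≤ ((p : ℝ) ^ a) ^ ε := by
    intro p a hp ha
    have hp1 : (1 : ℝ) ≤ p := by exact_mod_cast hp.one_le
    exact Real.rpow_le_rpow (by positivity) (le_self_pow₀ hp1 ha.ne') hε.le
  refine prod_factorization_le_rpow (by linarith) (fun _ _ => by positivity) ?_ ?_ hN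
  · intro p a hp ha
    have hp1 : (1 : ℝ) ≤ p := by exact_mod_cast hp.one_le
    have : (1 : ℝ) ≤ ((p : ℝ) ^ a) ^ ε := (Real.one_le_rpow hp1 hε.le).trans (hge p a hp ha)
    nlinarith
  · intro p a hp ha hPp
    exact (hP p hPp).trans (hge p a hp ha)

/-- The primes up to `x` not dividing `N`. -/
def primesNotDvd (x N : ℕ) : Finset ℕ := (Finset.Icc 1 x).filter fun ℓ => ℓ.Prime ∧ ¬ ℓ ∣ N

theorem primeCounting_le_card_primesNotDvd {N : ℕ} (hN : N ≠ 0) (x : ℕ) :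
    Nat.primeCounting x ≤ (primesNotDvd x N).card + Nat.log 2 N := by
  have hω : N.primeFactors.card ≤ Nat.log 2 N := by
    refine Nat.le_log_of_pow_le (by norm_num) ?_
    calc 2 ^ N.primeFactors.card ≤ ∏ p ∈ N.primeFactors, p :=
          Finset.pow_card_le_prod _ _ _ fun p hp => (Nat.prime_of_mem_primeFactors hp).two_le
      _ ≤ N := Nat.le_of_dvd (by omega) (Nat.prod_primeFactors_dvd N)
  have hsub : (Finset.Icc 1 x).filter Nat.Prime ⊆ primesNotDvd x N ∪ N.primeFactors := by
    intro ℓ hℓ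
    obtain ⟨h1, h2⟩ := Finset.mem_filter.1 hℓ
    by_cases h : ℓ ∣ N
    · exact Finset.mem_union_right _ (Nat.mem_primeFactors.2 ⟨h2, h, hN⟩)
    · exact Finset.mem_union_left _ (Finset.mem_filter.2 ⟨h1, h2, h⟩)
  have hcount : Nat.primeCounting x = ((Finset.Icc 1 x).filter Nat.Prime).card := by
    rw [Nat.primeCounting, Nat.primeCounting', Nat.count_eq_card_filter_range]
    congr 1
    ext ℓ
    simp only [Finset.mem_filter, Finset.mem_range, Finset.mem_Icc]
    constructor
    · rintro ⟨h1, h2⟩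
      exact ⟨⟨h2.one_le, by omega⟩, h2⟩
    · rintro ⟨⟨_, h1⟩, h2⟩
      exact ⟨by omega, h2⟩
  rw [hcount]
  exact (Finset.card_le_card hsub).trans ((Finset.card_union_le _ _).trans (by omega))

/-- There are many primes below a power of `q` not dividing a given number of size at most `q²`. -/
theorem exists_rpow_le_card_primesNotDvd {l ε : ℝ} (hl : 0 < l) (hε : 0 < ε) (hεl : ε < l) :
    ∃ Q : ℕ, ∀ q : ℕ, Q ≤ q → ∀ N : ℕ, N ≠ 0 → N ≤ q ^ 2 →
      (q : ℝ) ^ (l - ε) ≤ (primesNotDvd ⌊(q : ℝ) ^ l⌋₊ N).card := by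
  have hlog : ∀ {c a : ℝ}, 0 < c → 0 < a → ∀ᶠ q : ℕ in Filter.atTop,
      Real.log q ≤ c * (q : ℝ) ^ a := by
    intro c a hc ha
    have h := (isLittleO_log_rpow_atTop ha).bound hc
    filter_upwards [tendsto_natCast_atTop_atTop.eventually h, Filter.eventually_ge_atTop 1]
      with q hq hq1
    rw [Real.norm_of_nonneg (Real.log_nonneg (by exact_mod_cast hq1)),
      Real.norm_of_nonneg (by positivity)] at hq
    exact hq
  have hlarge : ∀ᶠ q : ℕ in Filter.atTop, (200 : ℝ) ≤ (q : ℝ) ^ l :=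
    ((tendsto_rpow_atTop hl).comp tendsto_natCast_atTop_atTop).eventually_ge_atTop 200
  -- This constant turns Chebyshev's bound π(x) log x ≥ x/4 into π(x) ≥ 2 q^(l-ε). One of the two
  -- copies pays, through `h2`, for the at most 3 log q primes dividing N.
  have h1 := hlog (c := 1 / (16 * l)) (by positivity) hε
  have h2 := hlog (c := 1 / 3) (by norm_num) (sub_pos.2 hεl)
  have hall := h1.and (h2.and (hlarge.and (Filter.eventually_ge_atTop 2)))
  obtain ⟨Q, hQ⟩ := Filter.eventually_atTop.1 hall
  refine ⟨Q, fun q hq N hN hNq => ?_⟩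
  obtain ⟨hq1, hq2, hq3, hq4⟩ := hQ q hq
  set x := ⌊(q : ℝ) ^ l⌋₊
  have hq0 : (0 : ℝ) < q := by exact_mod_cast (by omega : 0 < q)
  have hxle : (x : ℝ) ≤ (q : ℝ) ^ l := Nat.floor_le (by positivity)
  have hxge : (q : ℝ) ^ l < x + 1 := Nat.lt_floor_add_one _
  have hx100 : (100 : ℝ) ≤ x := by linarith
  have hx0 : (0 : ℝ) < x := by linarith
  have hpsi := (Chebyshev.psi_ge x).trans (Chebyshev.psi_le_primeCounting_mul_log x)
  have hlogx : Real.log (x + 1) ≤ x * (1 / 4) := by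
    have h3 : Real.log (√(x + 1)) ≤ √(x + 1) - 1 :=
      Real.log_le_sub_one_of_pos (Real.sqrt_pos.2 (by linarith))
    rw [Real.log_sqrt (by linarith)] at h3
    have h4 : √((x : ℝ) + 1) ≤ x * (1 / 8) + 1 := by
      rw [Real.sqrt_le_left (by linarith)]
      nlinarith
    linarith
  have hlog2 := Real.log_two_gt_d9
  have hπ : (x : ℝ) * (1 / 4) ≤ Nat.primeCounting x * Real.log x := by nlinarith
  have hlogxq : Real.log x ≤ l * Real.log q := by
    rw [← Real.log_rpow hq0]
    exact Real.log_le_log hx0 hxle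
  have hlogq : 0 < Real.log q := Real.log_pos (by exact_mod_cast (by omega : 1 < q))
  have hπ2 : 2 * (q : ℝ) ^ (l - ε) ≤ Nat.primeCounting x := by
    have h3 : l * Real.log q ≤ (q : ℝ) ^ ε / 16 := by
      have := mul_le_mul_of_nonneg_left hq1 hl.le
      calc l * Real.log q ≤ l * (1 / (16 * l) * (q : ℝ) ^ ε) := this
        _ = _ := by field_simp
    have h4 : (q : ℝ) ^ l * (1 / 8) ≤ Nat.primeCounting x * ((q : ℝ) ^ ε / 16) := by
      calc (q : ℝ) ^ l * (1 / 8) ≤ x * (1 / 4) := by linarith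
        _ ≤ Nat.primeCounting x * Real.log x := hπ
        _ ≤ _ := mul_le_mul_of_nonneg_left (hlogxq.trans h3) (by positivity)
    have h5 : (q : ℝ) ^ l = (q : ℝ) ^ (l - ε) * (q : ℝ) ^ ε := by
      rw [← Real.rpow_add hq0]; ring_nf
    have h6 : 0 < (q : ℝ) ^ ε := by positivity
    rw [h5] at h4
    refine le_of_mul_le_mul_right ?_ h6
    linarith
  have hlogN : (Nat.log 2 N : ℝ) ≤ 3 * Real.log q := by
    have h3 : (2 : ℝ) ^ Nat.log 2 N ≤ (q : ℝ) ^ 2 := by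
      exact_mod_cast (Nat.pow_log_le_self 2 hN).trans hNq
    have h4 := Real.log_le_log (by positivity) h3
    rw [Real.log_pow, Real.log_pow] at h4
    push_cast at h4
    have : (0 : ℝ) ≤ Nat.log 2 N := by positivity
    nlinarith
  have hcard : (Nat.primeCounting x : ℝ) ≤ (primesNotDvd x N).card + Nat.log 2 N := by
    exact_mod_cast primeCounting_le_card_primesNotDvd hN x
  linarith

/-! ### The bilinear estimate over the units modulo T -/

section Bilinear

variable {F : Type*} [Field F] [Fintype F]

/-- The second moment of a short exponential sum. -/
theorem sum_norm_sq_le {T : ℕ} [NeZero T] (ψ : AddChar F ℂ) (h : ZMod T → ℕ → F) (Y : Finset ℕ)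
    {B : ℝ} (hB : ∀ y₁ ∈ Y, ∀ y₂ ∈ Y, y₁ ≠ y₂ → ‖∑ z, ψ (h z y₁ - h z y₂)‖ ≤ B) (hB0 : 0 ≤ B) :
    ∑ z, ‖∑ y ∈ Y, ψ (h z y)‖ ^ 2 ≤ Y.card * T + Y.card ^ 2 * B := by
  have h1 : ((∑ z, ‖∑ y ∈ Y, ψ (h z y)‖ ^ 2 : ℝ) : ℂ) =
      ∑ y₁ ∈ Y, ∑ y₂ ∈ Y, ∑ z, ψ (h z y₁ - h z y₂) := by
    push_cast
    have h2 : ∀ z, (‖∑ y ∈ Y, ψ (h z y)‖ : ℂ) ^ 2 =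
        ∑ y₁ ∈ Y, ∑ y₂ ∈ Y, ψ (h z y₁ - h z y₂) := by
      intro z
      rw [← Complex.mul_conj', map_sum, Finset.sum_mul_sum]
      refine Finset.sum_congr rfl fun y₁ _ => Finset.sum_congr rfl fun y₂ _ => ?_
      rw [← AddChar.map_neg_eq_conj, ← AddChar.map_add_eq_mul, sub_eq_add_neg]
    rw [Finset.sum_congr rfl fun z _ => h2 z, Finset.sum_comm]
    exact Finset.sum_congr rfl fun y₁ _ => Finset.sum_comm
  have h3 : ‖((∑ z, ‖∑ y ∈ Y, ψ (h z y)‖ ^ 2 : ℝ) : ℂ)‖ = ∑ z, ‖∑ y ∈ Y, ψ (h z y)‖ ^ 2 := by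
    rw [Complex.norm_real, Real.norm_of_nonneg (Finset.sum_nonneg fun _ _ => by positivity)]
  rw [← h3, h1]
  calc ‖∑ y₁ ∈ Y, ∑ y₂ ∈ Y, ∑ z, ψ (h z y₁ - h z y₂)‖
      ≤ ∑ y₁ ∈ Y, ∑ y₂ ∈ Y, ((if y₁ = y₂ then (T : ℝ) else 0) + B) := by
        refine norm_sum_le_of_le _ fun y₁ hy₁ => norm_sum_le_of_le _ fun y₂ hy₂ => ?_
        split_ifs with heq
        · subst heq
          simp only [sub_self, AddChar.map_zero_eq_one, Finset.sum_const, Finset.card_univ,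
            ZMod.card, nsmul_eq_mul, mul_one, Complex.norm_natCast]
          linarith
        · rw [zero_add]
          exact hB y₁ hy₁ y₂ hy₂ heq
    _ = Y.card * T + Y.card ^ 2 * B := by
        simp only [Finset.sum_add_distrib, Finset.sum_ite_eq, Finset.sum_const, nsmul_eq_mul]
        rw [Finset.sum_ite_of_true (fun _ h => h), Finset.sum_const, nsmul_eq_mul]
        ring

/-- Kernel and image of u ↦ u^k have orders with product the group order, so the index of the image
is the order of the kernel. -/
theorem index_range_powMonoidHom (k T : ℕ) [NeZero T] :
    (powMonoidHom k : (ZMod T)ˣ →* (ZMod T)ˣ).range.index = unityCount k T := by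
  have h1 := (powMonoidHom k : (ZMod T)ˣ →* (ZMod T)ˣ).range.card_mul_index
  have h2 := (powMonoidHom k : (ZMod T)ˣ →* (ZMod T)ˣ).ker.card_mul_index
  rw [Subgroup.index_ker, mul_comm, ← h1] at h2
  have h3 := Nat.eq_of_mul_eq_mul_left Nat.card_pos h2
  exact h3.symm

/-- A nonempty fibre of u ↦ u^k c is a coset of the group of k-th roots of unity. -/
theorem sum_comp_pow_mul_le {k T : ℕ} [NeZero T] (c : (ZMod T)ˣ) {g : (ZMod T)ˣ → ℝ}
    (hg : ∀ v, 0 ≤ g v) : ∑ u, g (u ^ k * c) ≤ unityCount k T * ∑ v, g v := by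
  classical
  rw [← Finset.sum_fiberwise (s := Finset.univ) (g := fun u : (ZMod T)ˣ => u ^ k * c),
    Finset.mul_sum]
  refine Finset.sum_le_sum fun v _ => ?_
  rw [Finset.sum_congr rfl (g := fun _ => g v) (fun u hu => by rw [(Finset.mem_filter.1 hu).2]),
    Finset.sum_const, nsmul_eq_mul]
  refine mul_le_mul_of_nonneg_right ?_ (hg v)
  norm_cast
  rw [unityCount, ← Fintype.card_coe, ← Nat.card_eq_fintype_card]
  rcases isEmpty_or_nonempty {u ∈ (Finset.univ : Finset (ZMod T)ˣ) | u ^ k * c = v} with hem | ⟨⟨u₀⟩⟩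
  · rw [Nat.card_of_isEmpty]
    exact Nat.zero_le _
  · have h0 := (Finset.mem_filter.1 u₀.2).2
    refine Nat.card_le_card_of_injective (fun u => ⟨u.1 * u₀.1⁻¹, ?_⟩) fun u u' h => ?_
    · have h1 := (Finset.mem_filter.1 u.2).2
      rw [mul_pow, inv_pow, mul_inv_eq_one]
      exact mul_right_cancel (h1.trans h0.symm)
    · exact Subtype.ext (mul_right_cancel (congrArg Subtype.val h))

/-- The bilinear estimate: a sum over the units modulo `T` is controlled by the correlations
of `ψ(η^(z y))` for different `y` in a set of integers coprime to `T`. -/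
theorem card_mul_norm_sum_units_sq_le {k T : ℕ} [NeZero T] {η : F} (hη : η ^ T = 1)
    (ψ : AddChar F ℂ) {Y : Finset ℕ} (hY : ∀ y ∈ Y, y.Coprime T) {B : ℝ} (hB0 : 0 ≤ B)
    (hB : ∀ y₁ ∈ Y, ∀ y₂ ∈ Y, y₁ ≠ y₂ →
      ‖∑ z : ZMod T, ψ (η ^ (z.val * y₁) - η ^ (z.val * y₂))‖ ≤ B) :
    Y.card * ‖∑ u : (ZMod T)ˣ, ψ (η ^ ((u : ZMod T).val ^ k))‖ ^ 2 ≤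
      unityCount k T ^ 3 * T * (T + Y.card * B) := by
  classical
  rcases Y.eq_empty_or_nonempty with rfl | hYne
  · simp only [Finset.card_empty, Nat.cast_zero, zero_mul]
    positivity
  set κ := unityCount k T
  set S := ∑ u : (ZMod T)ˣ, ψ (η ^ ((u : ZMod T).val ^ k))
  set H := (powMonoidHom k : (ZMod T)ˣ →* (ZMod T)ˣ).range
  have hκ : Fintype.card ((ZMod T)ˣ ⧸ H) = κ := by
    rw [← Nat.card_eq_fintype_card]
    exact index_range_powMonoidHom k T
  have hκ0 : (0 : ℝ) < κ := by
    rw [← hκ]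
    exact_mod_cast Fintype.card_pos
  have hpowval : ∀ a : ℕ, η ^ ((a : ZMod T).val) = η ^ a := fun a => by
    rw [ZMod.val_natCast, ← pow_eq_pow_mod a hη]
  let e : (ZMod T)ˣ → F := fun v => η ^ (v : ZMod T).val
  have hS : S = ∑ u : (ZMod T)ˣ, ψ (e (u ^ k)) := by
    refine Finset.sum_congr rfl fun u _ => ?_
    simp only [e]
    rw [← hpowval, Units.val_pow_eq_pow_val]
    push_cast
    rw [ZMod.natCast_zmod_val]
  -- The value 1 off the units is a default; only y in Y matter.
  let U : ℕ → (ZMod T)ˣ := fun y => if h : y.Coprime T then ZMod.unitOfCoprime y h else 1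
  have hU : ∀ y ∈ Y, ((U y : (ZMod T)ˣ) : ZMod T) = y := fun y hy => by
    simp only [U, dif_pos (hY y hy), ZMod.coe_unitOfCoprime]
  -- Pigeonhole over the κ cosets of the k-th powers: one coset contains at least |Y|/κ of the y.
  obtain ⟨b, -, hb⟩ := Finset.exists_le_card_fiber_of_nsmul_le_card_of_maps_to
    (s := Y) (t := Finset.univ) (f := fun y => (U y : (ZMod T)ˣ ⧸ H)) (b := (Y.card : ℝ) / κ)
    (fun _ _ => Finset.mem_univ _) Finset.univ_nonempty (by
      rw [Finset.card_univ, hκ, nsmul_eq_mul, mul_div_cancel₀ _ hκ0.ne'])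
  set Y' := Y.filter fun y => (U y : (ZMod T)ˣ ⧸ H) = b
  have hYpos : (0 : ℝ) < Y.card := by exact_mod_cast hYne.card_pos
  have hY'pos : (0 : ℝ) < Y'.card := (div_pos hYpos hκ0).trans_le hb
  have hY'Y : Y' ⊆ Y := Finset.filter_subset _ _
  obtain ⟨y₀, hy₀⟩ : Y'.Nonempty := Finset.card_pos.1 (by exact_mod_cast hY'pos)
  -- Within the coset, y = y₀ c^k modulo T, and replacing u by uc brings in y without changing S.
  have hshift : ∀ y ∈ Y', S = ∑ u : (ZMod T)ˣ, ψ (e (u ^ k * (U y₀)⁻¹ * U y)) := by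
    intro y hy
    have h1 : ((U y₀ : (ZMod T)ˣ ⧸ H)) = U y :=
      (Finset.mem_filter.1 hy₀).2.trans (Finset.mem_filter.1 hy).2.symm
    obtain ⟨c, hc⟩ := QuotientGroup.eq.1 h1
    have hc : c ^ k = (U y₀)⁻¹ * U y := hc
    rw [hS, ← Equiv.sum_comp (Equiv.mulRight c)]
    refine Finset.sum_congr rfl fun u _ => ?_
    rw [Equiv.coe_mulRight, mul_pow, hc, mul_assoc]
  let g : (ZMod T)ˣ → ℝ := fun v => ‖∑ y ∈ Y', ψ (e (v * U y))‖
  let g' : ZMod T → ℝ := fun z => ‖∑ y ∈ Y', ψ (η ^ (z.val * y))‖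
  have hgg' : ∀ v : (ZMod T)ˣ, g v = g' v := by
    intro v
    simp only [g, g', e]
    congr 1
    refine Finset.sum_congr rfl fun y hy => ?_
    rw [← hpowval ((v : ZMod T).val * y), Nat.cast_mul, ZMod.natCast_zmod_val, Units.val_mul,
      hU y (hY'Y hy)]
  have h1 : Y'.card * ‖S‖ ≤ κ * ∑ z, g' z := by
    have h2 : (Y'.card : ℂ) * S = ∑ u : (ZMod T)ˣ, ∑ y ∈ Y', ψ (e (u ^ k * (U y₀)⁻¹ * U y)) := by
      rw [Finset.sum_comm, ← Finset.sum_congr rfl hshift, Finset.sum_const, nsmul_eq_mul]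
    calc Y'.card * ‖S‖ = ‖(Y'.card : ℂ) * S‖ := by rw [norm_mul, Complex.norm_natCast]
      _ ≤ ∑ u : (ZMod T)ˣ, g (u ^ k * (U y₀)⁻¹) := by
          rw [h2]
          exact norm_sum_le _ _
      _ ≤ κ * ∑ v, g v := sum_comp_pow_mul_le _ fun v => norm_nonneg _
      _ ≤ κ * ∑ z, g' z := by
          refine mul_le_mul_of_nonneg_left ?_ hκ0.le
          rw [Finset.sum_congr rfl fun v _ => hgg' v,
            ← Finset.sum_image (f := g') (g := fun v : (ZMod T)ˣ => (v : ZMod T))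
              fun u _ v _ h => Units.ext h]
          exact Finset.sum_le_univ_sum_of_nonneg fun z => norm_nonneg _
  have h2 : (∑ z, g' z) ^ 2 ≤ T * ∑ z, g' z ^ 2 := by
    have := sq_sum_le_card_mul_sum_sq (s := Finset.univ) (f := g')
    rwa [Finset.card_univ, ZMod.card] at this
  have h3 : ∑ z, g' z ^ 2 ≤ Y'.card * T + Y'.card ^ 2 * B :=
    sum_norm_sq_le ψ (fun z y => η ^ (z.val * y)) Y'
      (fun y₁ h₁ y₂ h₂ => hB y₁ (hY'Y h₁) y₂ (hY'Y h₂)) hB0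
  have h4 : (Y'.card * ‖S‖) ^ 2 ≤ κ ^ 2 * (T * (Y'.card * T + Y'.card ^ 2 * B)) := by
    calc (Y'.card * ‖S‖) ^ 2 ≤ (κ * ∑ z, g' z) ^ 2 := pow_le_pow_left₀ (by positivity) h1 2
      _ = κ ^ 2 * (∑ z, g' z) ^ 2 := by ring
      _ ≤ κ ^ 2 * (T * ∑ z, g' z ^ 2) := mul_le_mul_of_nonneg_left h2 (by positivity)
      _ ≤ _ := by
          refine mul_le_mul_of_nonneg_left (mul_le_mul_of_nonneg_left h3 ?_) (by positivity)
          positivity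
  have h5 : Y'.card * ‖S‖ ^ 2 ≤ κ ^ 2 * T * (T + Y'.card * B) := by
    refine le_of_mul_le_mul_left ?_ hY'pos
    calc Y'.card * (Y'.card * ‖S‖ ^ 2) = (Y'.card * ‖S‖) ^ 2 := by ring
      _ ≤ _ := h4
      _ = _ := by ring
  have h6 : (Y.card : ℝ) ≤ κ * Y'.card := by
    rw [div_le_iff₀ hκ0] at hb
    linarith
  have h7 : (Y'.card : ℝ) ≤ Y.card := by exact_mod_cast Finset.card_le_card hY'Y
  -- Of the three factors κ, two come from squaring the fibre multiplicity of u ↦ u^k and one from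
  -- returning from Y' to Y.
  calc Y.card * ‖S‖ ^ 2 ≤ κ * Y'.card * ‖S‖ ^ 2 := mul_le_mul_of_nonneg_right h6 (by positivity)
    _ = κ * (Y'.card * ‖S‖ ^ 2) := by ring
    _ ≤ κ * (κ ^ 2 * T * (T + Y'.card * B)) := mul_le_mul_of_nonneg_left h5 hκ0.le
    _ = κ ^ 3 * T * (T + Y'.card * B) := by ring
    _ ≤ κ ^ 3 * T * (T + Y.card * B) := by
        refine mul_le_mul_of_nonneg_left ?_ (by positivity)
        have := mul_le_mul_of_nonneg_right h7 hB0
        linarith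

end Bilinear

/-! ### Splitting by the gcd with the group order, and correlations of powers -/

theorem norm_addChar_sum_le_card {G ι : Type*} [AddCommGroup G] [Finite G] (ψ : AddChar G ℂ)
    (s : Finset ι) (f : ι → G) : ‖∑ i ∈ s, ψ (f i)‖ ≤ s.card := by
  refine (norm_sum_le _ _).trans ?_
  simp [AddChar.norm_apply]

theorem sum_range_mul_of_periodic {M : Type*} [AddCommMonoid M] {h : ℕ → M} {T : ℕ}
    (hh : ∀ i, h (i + T) = h i) (d : ℕ) :
    ∑ i ∈ Finset.range (d * T), h i = d • ∑ i ∈ Finset.range T, h i := by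
  have hh' : ∀ e i, h (e * T + i) = h i := by
    intro e
    induction e with
    | zero => simp
    | succ e ih =>
      intro i
      rw [show (e + 1) * T + i = (e * T + i) + T by ring, hh, ih]
  induction d with
  | zero => simp
  | succ d ih =>
    rw [add_mul, one_mul, Finset.sum_range_add, ih, succ_nsmul]
    simp only [hh']

theorem ZMod.sum_val_eq_sum_range {M : Type*} [AddCommMonoid M] (h : ℕ → M) (T : ℕ) [NeZero T] :
    ∑ z : ZMod T, h z.val = ∑ i ∈ Finset.range T, h i := by
  obtain ⟨n, rfl⟩ := Nat.exists_eq_succ_of_ne_zero (NeZero.ne T)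
  exact Fin.sum_univ_eq_sum_range h (n + 1)

theorem ZMod.sum_units_val_eq_sum_coprime {M : Type*} [AddCommMonoid M] (h : ℕ → M) (T : ℕ)
    [NeZero T] : ∑ u : (ZMod T)ˣ, h (u : ZMod T).val =
      ∑ j ∈ (Finset.range T).filter T.Coprime, h j := by
  refine Finset.sum_nbij (fun u => (u : ZMod T).val) (fun u _ => ?_) (fun u _ v _ huv => ?_)
    (fun j hj => ?_) fun _ _ => rfl
  · exact Finset.mem_filter.2 ⟨Finset.mem_range.2 (ZMod.val_lt _),
      (ZMod.val_coe_unit_coprime u).symm⟩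
  · exact Units.ext (ZMod.val_injective T huv)
  · obtain ⟨hj1, hj2⟩ := Finset.mem_filter.1 (Finset.mem_coe.1 hj)
    refine ⟨ZMod.unitOfCoprime j hj2.symm, Finset.mem_coe.2 (Finset.mem_univ _), ?_⟩
    simp only [ZMod.coe_unitOfCoprime]
    exact ZMod.val_cast_of_lt (Finset.mem_range.1 hj1)

/-- Splitting a sum over residues modulo `t` according to the greatest common divisor with `t`. -/
theorem sum_range_eq_sum_divisors {M : Type*} [AddCommMonoid M] (h : ℕ → M) {t : ℕ}
    (ht : t ≠ 0) : ∑ m ∈ Finset.range t, h m =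
      ∑ d ∈ t.divisors, ∑ j ∈ (Finset.range (t / d)).filter (t / d).Coprime, h (d * j) := by
  rw [← Finset.sum_fiberwise_of_maps_to (s := Finset.range t) (t := t.divisors) (g := t.gcd)
    fun m _ => Nat.mem_divisors.2 ⟨Nat.gcd_dvd_left _ _, ht⟩]
  refine Finset.sum_congr rfl fun d hd => ?_
  obtain ⟨T, rfl⟩ := Nat.dvd_of_mem_divisors hd
  have hd0 : 0 < d := Nat.pos_of_mem_divisors hd
  rw [Nat.mul_div_cancel_left _ hd0]
  symm
  refine Finset.sum_nbij (fun j => d * j) (fun j hj => ?_) (fun i _ j _ hij => ?_)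
    (fun m hm => ?_) fun _ _ => rfl
  · obtain ⟨hj1, hj2⟩ := Finset.mem_filter.1 hj
    rw [Finset.mem_filter, Finset.mem_range, Nat.gcd_mul_left]
    exact ⟨Nat.mul_lt_mul_of_pos_left (Finset.mem_range.1 hj1) hd0, by rw [hj2, mul_one]⟩
  · exact Nat.eq_of_mul_eq_mul_left hd0 hij
  · obtain ⟨hm1, hm2⟩ := Finset.mem_filter.1 (Finset.mem_coe.1 hm)
    obtain ⟨j, rfl⟩ : d ∣ m := hm2 ▸ Nat.gcd_dvd_right _ _
    refine ⟨j, Finset.mem_coe.2 (Finset.mem_filter.2 ⟨Finset.mem_range.2 ?_, ?_⟩), rfl⟩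
    · exact Nat.lt_of_mul_lt_mul_left (Finset.mem_range.1 hm1)
    · rw [Nat.gcd_mul_left] at hm2
      exact Nat.eq_of_mul_eq_mul_left hd0 (hm2.trans (mul_one d).symm)

section
variable {F : Type*} [Field F] [Fintype F]

-- Weil's bound for X^a - X^b, whose degree is one of the two exponents and hence nonzero in F.
open Polynomial in
theorem norm_sum_addChar_pow_sub_pow_le {ψ : AddChar F ℂ} (hψ : ψ ≠ 1) {a b : ℕ} (hab : a ≠ b)
    (ha : (a : F) ≠ 0) (hb : (b : F) ≠ 0) :
    ‖∑ x : F, ψ (x ^ a - x ^ b)‖ ≤ (max a b - 1 : ℕ) * √(Fintype.card F) := by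
  have hdeg : (X ^ a - X ^ b : F[X]).natDegree = max a b := by
    rcases hab.lt_or_gt with h | h
    · rw [natDegree_sub_eq_right_of_natDegree_lt (by simpa using h), natDegree_X_pow,
        max_eq_right h.le]
    · rw [natDegree_sub_eq_left_of_natDegree_lt (by simpa using h), natDegree_X_pow,
        max_eq_left h.le]
  have h := norm_sum_addChar_eval_le hψ (f := X ^ a - X ^ b) (by
    rw [hdeg]
    rcases max_choice a b with h | h <;> rw [h] <;> assumption)
  simpa [hdeg] using h

theorem IsPrimitiveRoot.sum_range_pow_eq_sum_erase_zero {M : Type*} [AddCommMonoid M]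
    [DecidableEq F] {θ : F} (hθ : IsPrimitiveRoot θ (Fintype.card F - 1)) (g : F → M) :
    ∑ i ∈ Finset.range (Fintype.card F - 1), g (θ ^ i) = ∑ x ∈ Finset.univ.erase 0, g x := by
  have hcard : 1 < Fintype.card F := Fintype.one_lt_card
  have : NeZero (Fintype.card F - 1) := ⟨by omega⟩
  have hθ0 : θ ≠ 0 := hθ.ne_zero (NeZero.ne _)
  refine Finset.sum_nbij (fun i => θ ^ i) (fun i _ => ?_) (fun i hi j hj hij => ?_)
    (fun x hx => ?_) fun _ _ => rfl
  · exact Finset.mem_erase.2 ⟨pow_ne_zero _ hθ0, Finset.mem_univ _⟩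
  · exact hθ.pow_inj (Finset.mem_range.1 hi) (Finset.mem_range.1 hj) hij
  · obtain ⟨i, hi, rfl⟩ := hθ.eq_pow_of_pow_eq_one
      (FiniteField.pow_card_sub_one_eq_one x (Finset.mem_erase.1 (Finset.mem_coe.1 hx)).1)
    exact ⟨i, Finset.mem_coe.2 (Finset.mem_range.2 hi), rfl⟩

/-- Powers of θ omit only x = 0, whose contribution 1 raises the Weil factor from max a b - 1 to max
a b. -/
theorem norm_sum_range_pow_sub_pow_le {ψ : AddChar F ℂ} (hψ : ψ ≠ 1) {θ : F}
    (hθ : IsPrimitiveRoot θ (Fintype.card F - 1)) {a b : ℕ} (hab : a ≠ b)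
    (ha : (a : F) ≠ 0) (hb : (b : F) ≠ 0) :
    ‖∑ i ∈ Finset.range (Fintype.card F - 1), ψ (θ ^ (i * a) - θ ^ (i * b))‖ ≤
      (max a b : ℕ) * √(Fintype.card F) := by
  classical
  have ha0 : a ≠ 0 := by rintro rfl; simp at ha
  have hb0 : b ≠ 0 := by rintro rfl; simp at hb
  have h1 := hθ.sum_range_pow_eq_sum_erase_zero fun x => ψ (x ^ a - x ^ b)
  simp only [← pow_mul] at h1
  have h2 := Finset.sum_erase_add (s := Finset.univ) (f := fun x : F => ψ (x ^ a - x ^ b))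
    (Finset.mem_univ 0)
  simp only [zero_pow ha0, zero_pow hb0, sub_zero, AddChar.map_zero_eq_one] at h2
  rw [h1, eq_sub_of_add_eq h2]
  have h3 := norm_sum_addChar_pow_sub_pow_le hψ hab ha hb
  have h4 : (1 : ℝ) ≤ √(Fintype.card F) := by
    rw [Real.one_le_sqrt]
    exact_mod_cast Fintype.card_pos
  have h5 : ((max a b : ℕ) : ℝ) = (max a b - 1 : ℕ) + 1 := by
    have : 1 ≤ max a b := (Nat.one_le_iff_ne_zero.2 ha0).trans (le_max_left _ _)
    exact_mod_cast (Nat.sub_add_cancel this).symm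
  refine (norm_sub_le _ _).trans ?_
  rw [h5, norm_one]
  linarith

/-- Correlations of `ψ(η^(z y))` for `η` of the form `θ^(d^k)`. -/
theorem norm_sum_zmod_pow_sub_pow_le {ψ : AddChar F ℂ} (hψ : ψ ≠ 1) {θ : F}
    (hθ : IsPrimitiveRoot θ (Fintype.card F - 1)) {d T k : ℕ} [NeZero T] (hk : 1 ≤ k)
    (hdT : d * T = Fintype.card F - 1) {y₁ y₂ : ℕ} (hy : y₁ ≠ y₂) (h₁ : (y₁ : F) ≠ 0)
    (h₂ : (y₂ : F) ≠ 0) {L : ℝ} (hL₁ : y₁ ≤ L) (hL₂ : y₂ ≤ L) :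
    ‖∑ z : ZMod T, ψ ((θ ^ d ^ k) ^ (z.val * y₁) - (θ ^ d ^ k) ^ (z.val * y₂))‖ ≤
      (d : ℝ) ^ (k - 1) * L * √(Fintype.card F) := by
  obtain ⟨k, rfl⟩ := Nat.exists_eq_add_of_le' hk
  have hcard : 1 < Fintype.card F := Fintype.one_lt_card
  have hd0 : d ≠ 0 := by rintro rfl; omega
  -- d divides q - 1, which is -1 in F.
  have hdF : (d : F) ≠ 0 := by
    intro h
    have h1 : ((d * T : ℕ) : F) = -1 := by
      rw [hdT, Nat.cast_sub hcard.le, FiniteField.cast_card_eq_zero]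
      simp
    rw [Nat.cast_mul, h, zero_mul] at h1
    exact one_ne_zero (neg_eq_zero.1 h1.symm)
  have hθT : θ ^ (d * T) = 1 := by rw [hdT]; exact hθ.pow_eq_one
  have hη : (θ ^ d ^ (k + 1)) ^ T = 1 := by
    rw [← pow_mul, pow_succ, mul_assoc, mul_comm, pow_mul, hθT, one_pow]
  -- The summand has period T, so d times the sum is a sum over the whole multiplicative group.
  -- Weil's bound there carries a factor d^k, and division by d leaves d^(k-1), where k is the
  -- exponent of the statement.
  have hper := sum_range_mul_of_periodic (T := T)
    (h := fun i => ψ ((θ ^ d ^ (k + 1)) ^ (i * y₁) - (θ ^ d ^ (k + 1)) ^ (i * y₂))) (fun i => by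
      have : ∀ y, (θ ^ d ^ (k + 1)) ^ ((i + T) * y) = (θ ^ d ^ (k + 1)) ^ (i * y) := fun y => by
        rw [add_mul, pow_add, pow_mul _ T, hη, one_pow, mul_one]
      simp only [this]) d
  rw [ZMod.sum_val_eq_sum_range
    (fun i => ψ ((θ ^ d ^ (k + 1)) ^ (i * y₁) - (θ ^ d ^ (k + 1)) ^ (i * y₂)))]
  set S := ∑ i ∈ Finset.range T, ψ ((θ ^ d ^ (k + 1)) ^ (i * y₁) - (θ ^ d ^ (k + 1)) ^ (i * y₂))
  have hW := norm_sum_range_pow_sub_pow_le hψ hθ (a := d ^ (k + 1) * y₁) (b := d ^ (k + 1) * y₂)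
    (fun h => hy (Nat.eq_of_mul_eq_mul_left (pow_pos (Nat.pos_of_ne_zero hd0) _) h))
    (by push_cast; exact mul_ne_zero (pow_ne_zero _ hdF) h₁)
    (by push_cast; exact mul_ne_zero (pow_ne_zero _ hdF) h₂)
  have hre : ∀ i y, θ ^ (i * (d ^ (k + 1) * y)) = (θ ^ d ^ (k + 1)) ^ (i * y) := fun i y => by
    rw [← pow_mul]
    congr 1
    ring
  simp only [hre] at hW
  rw [← hdT, hper, nsmul_eq_mul, norm_mul, Complex.norm_natCast] at hW
  have hmax : ((max (d ^ (k + 1) * y₁) (d ^ (k + 1) * y₂) : ℕ) : ℝ) ≤ d ^ (k + 1) * L := by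
    push_cast
    exact max_le (mul_le_mul_of_nonneg_left hL₁ (by positivity))
      (mul_le_mul_of_nonneg_left hL₂ (by positivity))
  have hdpos : (0 : ℝ) < d := by exact_mod_cast Nat.pos_of_ne_zero hd0
  refine le_of_mul_le_mul_left (hW.trans ?_) hdpos
  calc _ ≤ (d : ℝ) ^ (k + 1) * L * √(Fintype.card F) :=
        mul_le_mul_of_nonneg_right hmax (Real.sqrt_nonneg _)
    _ = _ := by
        rw [Nat.add_sub_cancel]
        ring

end

/-! ### The exponential sum over k-th powers in the exponent -/

section
variable {F : Type*} [Field F] [Fintype F]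

/-- The estimate for the part of the power sum coming from exponents having greatest common
divisor `d` with the group order, when `d` is small. -/
theorem card_mul_norm_sum_coprime_sq_le {p : ℕ} [CharP F p] {ψ : AddChar F ℂ}
    (hψ : ψ ≠ 1) {θ : F} (hθ : IsPrimitiveRoot θ (Fintype.card F - 1)) {d T k : ℕ} [NeZero T]
    (hk : 1 ≤ k) (hdT : d * T = Fintype.card F - 1) {L : ℝ} (hL : 0 ≤ L) :
    (primesNotDvd ⌊L⌋₊ ((Fintype.card F - 1) * p)).card *
        ‖∑ j ∈ (Finset.range T).filter T.Coprime, ψ (θ ^ (d * j) ^ k)‖ ^ 2 ≤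
      unityCount k T ^ 3 * T * (T + (primesNotDvd ⌊L⌋₊ ((Fintype.card F - 1) * p)).card *
        ((d : ℝ) ^ (k - 1) * L * √(Fintype.card F))) := by
  rw [← ZMod.sum_units_val_eq_sum_coprime (fun j => ψ (θ ^ (d * j) ^ k))]
  simp only [mul_pow, pow_mul]
  -- Avoiding the divisors of q - 1 makes y a unit modulo T; avoiding p keeps y nonzero in F, as
  -- Weil's bound requires.
  have hmem : ∀ y ∈ primesNotDvd ⌊L⌋₊ ((Fintype.card F - 1) * p),
      y.Coprime T ∧ (y : F) ≠ 0 ∧ (y : ℝ) ≤ L := by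
    intro y hy
    obtain ⟨hy1, hy2, hy3⟩ := Finset.mem_filter.1 hy
    refine ⟨(hy2.coprime_iff_not_dvd).2 fun h => hy3 ?_, fun h => ?_, ?_⟩
    · exact (h.trans (Dvd.intro_left d hdT)).mul_right _
    · have h1 := (CharP.cast_eq_zero_iff F p y).1 h
      rcases (Nat.dvd_prime hy2).1 h1 with rfl | rfl
      · exact CharP.ringChar_ne_one (R := F) (ringChar.eq F 1)
      · exact hy3 (dvd_mul_left _ _)
    · exact (Nat.le_floor_iff hL).1 (Finset.mem_Icc.1 hy1).2
  refine card_mul_norm_sum_units_sq_le ?_ ψ (fun y hy => (hmem y hy).1) (by positivity)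
    fun y₁ h₁ y₂ h₂ hy => norm_sum_zmod_pow_sub_pow_le hψ hθ hk hdT hy (hmem y₁ h₁).2.1
      (hmem y₂ h₂).2.1 (hmem y₁ h₁).2.2 (hmem y₂ h₂).2.2
  obtain ⟨k, rfl⟩ := Nat.exists_eq_add_of_le' hk
  rw [← pow_mul, pow_succ, mul_assoc, hdT, mul_comm, pow_mul, hθ.pow_eq_one, one_pow]

end

/-- The numerical part of the estimate for small `d`. -/
theorem sq_le_of_card_mul_sq_le {q d T y κ S A σ ε : ℝ} {k : ℕ} (hk : 2 ≤ k)
    (hσ : (k + 2) * σ = 1 / 2) (hε : 0 ≤ ε) (hq : 1 ≤ q) (hd : 1 ≤ d) (hdσ : d ≤ q ^ σ)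
    (hT : 0 ≤ T) (hdT : d * T ≤ q) (hy : q ^ (2 * σ - ε) ≤ y) (hκ0 : 0 ≤ κ) (hκ : κ ≤ A * q ^ ε)
    (h : y * S ^ 2 ≤ κ ^ 3 * T * (T + y * (d ^ (k - 1) * q ^ (2 * σ) * √q))) :
    S ^ 2 ≤ 2 * A ^ 3 * (q ^ (1 - σ + 2 * ε)) ^ 2 := by
  have hq0 : 0 < q := by linarith
  have hy0 : 0 < y := (Real.rpow_pos_of_pos hq0 _).trans_le hy
  have hTq : T ≤ q := by nlinarith
  -- After division by y the diagonal part is T²/y ≤ q^(2-2σ+ε). The off-diagonal part is at most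
  -- q^(3/2+kσ), which equals q^(2-2σ) exactly when (k+2)σ = 1/2; this balance fixes σ.
  have h1 : T * T ≤ y * q ^ (2 - 2 * σ + ε) := by
    calc T * T ≤ q * q := mul_le_mul hTq hTq hT hq0.le
      _ = q ^ (2 * σ - ε) * q ^ (2 - 2 * σ + ε) := by
          rw [← Real.rpow_add hq0, ← pow_two, ← Real.rpow_natCast]
          congr 1
          push_cast
          ring
      _ ≤ _ := mul_le_mul_of_nonneg_right hy (by positivity)
  have h2 : T * (d ^ (k - 1) * q ^ (2 * σ) * √q) ≤ q ^ (2 - 2 * σ + ε) := by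
    obtain ⟨k, rfl⟩ := Nat.exists_eq_add_of_le' hk
    have h3 : d ^ k ≤ q ^ (k * σ) := by
      rw [mul_comm, Real.rpow_mul hq0.le, Real.rpow_natCast]
      exact pow_le_pow_left₀ (by linarith) hdσ k
    calc T * (d ^ (k + 2 - 1) * q ^ (2 * σ) * √q) = (d * T) * d ^ k * (q ^ (2 * σ) * √q) := by
          rw [show k + 2 - 1 = k + 1 by omega]
          ring
      _ ≤ q * q ^ (k * σ) * (q ^ (2 * σ) * √q) := by gcongr
      _ = q ^ (2 - 2 * σ) := by
          rw [Real.sqrt_eq_rpow, ← Real.rpow_add hq0, ← Real.rpow_one_add' hq0.le,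
            ← Real.rpow_add hq0]
          · congr 1
            push_cast at hσ
            linarith
          · have : 0 ≤ k * σ := by
              have : 0 ≤ σ := by
                by_contra hneg
                push_cast at hσ
                nlinarith [(Nat.cast_nonneg k : (0 : ℝ) ≤ k)]
              positivity
            positivity
      _ ≤ _ := Real.rpow_le_rpow_of_exponent_le hq (by linarith)
  have h4 : y * S ^ 2 ≤ y * (κ ^ 3 * (2 * q ^ (2 - 2 * σ + ε))) := by
    calc y * S ^ 2 ≤ κ ^ 3 * (T * T + y * (T * (d ^ (k - 1) * q ^ (2 * σ) * √q))) := by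
          refine h.trans (le_of_eq ?_)
          ring
      _ ≤ κ ^ 3 * (y * q ^ (2 - 2 * σ + ε) + y * q ^ (2 - 2 * σ + ε)) := by
          gcongr
      _ = _ := by ring
  refine (le_of_mul_le_mul_left h4 hy0).trans ?_
  calc κ ^ 3 * (2 * q ^ (2 - 2 * σ + ε)) ≤ (A * q ^ ε) ^ 3 * (2 * q ^ (2 - 2 * σ + ε)) := by
        gcongr
    _ = 2 * A ^ 3 * ((q ^ ε) ^ 3 * q ^ (2 - 2 * σ + ε)) := by ring
    _ = _ := by
        rw [← Real.rpow_natCast (q ^ ε), ← Real.rpow_natCast (q ^ (1 - σ + 2 * ε)),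
          ← Real.rpow_mul hq0.le, ← Real.rpow_mul hq0.le, ← Real.rpow_add hq0]
        congr 2
        push_cast
        ring

universe u

/-- For d ≥ q^σ the trivial bound T ≤ q^(1-σ) suffices; for smaller d the bilinear estimate is used
with primes up to q^(2σ). Fields with fewer than Q elements are absorbed in the constant. -/
theorem exists_norm_sum_coprime_le {k : ℕ} (hk : 2 ≤ k) {ε : ℝ} (hε : 0 < ε) :
    ∃ A : ℝ, 0 ≤ A ∧ ∀ (F : Type u) [Field F] [Fintype F] (ψ : AddChar F ℂ), ψ ≠ 1 → ∀ θ : F,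
      IsPrimitiveRoot θ (Fintype.card F - 1) → ∀ d T : ℕ, d * T = Fintype.card F - 1 →
        ‖∑ j ∈ (Finset.range T).filter T.Coprime, ψ (θ ^ (d * j) ^ k)‖ ≤
          A * (Fintype.card F : ℝ) ^ (1 - 1 / (2 * k + 4) + 2 * ε : ℝ) := by
  set σ : ℝ := 1 / (2 * k + 4) with hσdef
  have hσ0 : 0 < σ := by positivity
  have hσ1 : σ ≤ 1 := by
    rw [hσdef, div_le_one (by positivity)]
    linarith [(Nat.cast_nonneg k : (0 : ℝ) ≤ k)]
  have hσ : (k + 2) * σ = 1 / 2 := by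
    rw [hσdef]
    field_simp
    ring
  -- Shrinking ε keeps it below 2σ, as the supply of primes up to q^(2σ) requires.
  set ε' := min ε σ
  have hε'0 : 0 < ε' := lt_min hε hσ0
  have hε' : ε' ≤ ε := min_le_left _ _
  have hε'σ : ε' ≤ σ := min_le_right _ _
  obtain ⟨A, hA⟩ := exists_unityCount_le_rpow (k := k) (by omega) hε'0
  obtain ⟨Q, hQ⟩ := exists_rpow_le_card_primesNotDvd (l := 2 * σ) (ε := ε') (by positivity) hε'0
    (by linarith)
  have hA0 : 0 ≤ A := by
    have := hA 1 one_ne_zero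
    rw [Nat.cast_one, Real.one_rpow, mul_one] at this
    exact (Nat.cast_nonneg _).trans this
  refine ⟨max (max 1 Q) (√(2 * A ^ 3)), by positivity, ?_⟩
  intro F _ _ ψ hψ θ hθ d T hdT
  set S := ∑ j ∈ (Finset.range T).filter T.Coprime, ψ (θ ^ (d * j) ^ k)
  have hcard : 1 < Fintype.card F := Fintype.one_lt_card
  have hd0 : d ≠ 0 := by rintro rfl; omega
  have hT0 : T ≠ 0 := by rintro rfl; omega
  have : NeZero T := ⟨hT0⟩
  have htriv : ‖S‖ ≤ T := by
    refine (norm_addChar_sum_le_card _ _ _).trans ?_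
    exact_mod_cast (Finset.card_filter_le _ _).trans (Finset.card_range T).le
  set q : ℝ := (Fintype.card F : ℝ) with hqdef
  have hq1 : 1 ≤ q := by
    rw [hqdef]
    exact_mod_cast hcard.le
  have hq0 : 0 < q := by linarith
  have hdTq : (d : ℝ) * T ≤ q := by
    rw [hqdef]
    exact_mod_cast hdT.le.trans (Nat.sub_le _ _)
  have hd1 : (1 : ℝ) ≤ d := by exact_mod_cast Nat.one_le_iff_ne_zero.2 hd0
  have hmono : q ^ (1 - σ) ≤ q ^ (1 - σ + 2 * ε) :=
    Real.rpow_le_rpow_of_exponent_le hq1 (by linarith)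
  have hone : 1 ≤ q ^ (1 - σ + 2 * ε) := Real.one_le_rpow hq1 (by linarith)
  rcases le_or_gt (q ^ σ) d with hd | hd
  · calc ‖S‖ ≤ T := htriv
      _ ≤ q ^ (1 - σ) := by
          rw [Real.rpow_sub hq0, Real.rpow_one, le_div_iff₀ (by positivity)]
          calc T * q ^ σ ≤ T * d := by gcongr
            _ ≤ q := by linarith
      _ ≤ 1 * q ^ (1 - σ + 2 * ε) := by linarith
      _ ≤ _ := by
          gcongr
          exact (le_max_left _ _).trans (le_max_left _ _)
  rcases lt_or_ge (Fintype.card F) Q with hqQ | hqQ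
  · calc ‖S‖ ≤ T := htriv
      _ ≤ q := by nlinarith
      _ ≤ Q := by
          rw [hqdef]
          exact_mod_cast hqQ.le
      _ ≤ Q * q ^ (1 - σ + 2 * ε) := le_mul_of_one_le_right (by positivity) hone
      _ ≤ _ := by
          gcongr
          exact (le_max_right _ _).trans (le_max_left _ _)
  · obtain ⟨p, hp⟩ := CharP.exists F
    have hpp : p.Prime := CharP.char_is_prime F p
    have hpq : p ≤ Fintype.card F := Nat.le_of_dvd (by omega)
      ((CharP.cast_eq_zero_iff F p _).1 (FiniteField.cast_card_eq_zero F))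
    have hy := hQ _ hqQ ((Fintype.card F - 1) * p) (mul_ne_zero (by omega) hpp.ne_zero) (by
      rw [pow_two]
      exact Nat.mul_le_mul (Nat.sub_le _ _) hpq)
    have hκ : (unityCount k T : ℝ) ≤ A * q ^ ε' := by
      refine (hA T hT0).trans (mul_le_mul_of_nonneg_left ?_ hA0)
      exact Real.rpow_le_rpow (Nat.cast_nonneg _) (by nlinarith) hε'0.le
    have hmain := sq_le_of_card_mul_sq_le hk hσ hε'0.le hq1 hd1 hd.le (Nat.cast_nonneg T) hdTq hy
      (Nat.cast_nonneg _) hκ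
      (card_mul_norm_sum_coprime_sq_le hψ hθ (by omega) hdT (by positivity))
    have hmain' : ‖S‖ ≤ √(2 * A ^ 3) * q ^ (1 - σ + 2 * ε') := by
      refine le_of_sq_le_sq ?_ (by positivity)
      rwa [mul_pow, Real.sq_sqrt (by positivity)]
    refine hmain'.trans ?_
    gcongr
    exact le_max_right _ _

/-- The exponential sum estimate over `k`-th powers in the exponent of a primitive root. -/
theorem exists_norm_sum_pow_pow_le {k : ℕ} (hk : 2 ≤ k) {ε : ℝ} (hε : 0 < ε) :
    ∃ A : ℝ, 0 ≤ A ∧ ∀ (F : Type u) [Field F] [Fintype F] (ψ : AddChar F ℂ), ψ ≠ 1 → ∀ θ : F,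
      IsPrimitiveRoot θ (Fintype.card F - 1) →
        ‖∑ m ∈ Finset.Icc 1 (Fintype.card F - 1), ψ (θ ^ m ^ k)‖ ≤
          A * (Fintype.card F : ℝ) ^ (1 - 1 / (2 * k + 4) + ε : ℝ) := by
  obtain ⟨A, hA0, hA⟩ := exists_norm_sum_coprime_le.{u} hk (ε := ε / 4) (by positivity)
  obtain ⟨D, hD⟩ := exists_card_divisors_le_rpow (ε := ε / 2) (by positivity)
  have hD0 : 0 ≤ D := by
    have := hD 1 one_ne_zero
    rw [Nat.cast_one, Real.one_rpow, mul_one] at this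
    exact (Nat.cast_nonneg _).trans this
  refine ⟨D * A, by positivity, fun F _ _ ψ hψ θ hθ => ?_⟩
  have hcard : 1 < Fintype.card F := Fintype.one_lt_card
  have ht : Fintype.card F - 1 ≠ 0 := by omega
  set t := Fintype.card F - 1 with htdef
  have hq0 : (0 : ℝ) < Fintype.card F := by exact_mod_cast Fintype.card_pos
  -- The exponents t^k and 0^k give the same power of θ because k > 0, so m = t may be replaced by m
  -- = 0.
  have hrange : ∑ m ∈ Finset.Icc 1 t, ψ (θ ^ m ^ k) = ∑ m ∈ Finset.range t, ψ (θ ^ m ^ k) := by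
    have h1 : ψ (θ ^ t ^ k) = ψ (θ ^ 0 ^ k) := by
      rw [zero_pow (by omega), pow_zero]
      obtain ⟨k, rfl⟩ := Nat.exists_eq_add_of_le' hk
      rw [pow_succ, mul_comm, pow_mul, hθ.pow_eq_one, one_pow]
    have h2 := Finset.sum_range_succ (fun m => ψ (θ ^ m ^ k)) t
    have h3 := Finset.sum_range_succ' (fun m => ψ (θ ^ m ^ k)) t
    rw [h2, h1] at h3
    rw [add_right_cancel h3, ← Finset.Ico_add_one_right_eq_Icc, Finset.sum_Ico_eq_sum_range]
    refine Finset.sum_congr rfl fun m _ => ?_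
    rw [add_comm]
  rw [hrange, sum_range_eq_sum_divisors _ ht]
  refine (norm_sum_le _ _).trans ((Finset.sum_le_card_nsmul _ _ _ fun d hd =>
    hA F ψ hψ θ hθ d (t / d) (Nat.mul_div_cancel' (Nat.dvd_of_mem_divisors hd))).trans ?_)
  rw [nsmul_eq_mul]
  calc (t.divisors.card : ℝ) * (A * (Fintype.card F : ℝ) ^ (1 - 1 / (2 * k + 4) + 2 * (ε / 4) : ℝ))
      ≤ (D * (Fintype.card F : ℝ) ^ (ε / 2)) *
          (A * (Fintype.card F : ℝ) ^ (1 - 1 / (2 * k + 4) + 2 * (ε / 4) : ℝ)) := by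
        refine mul_le_mul_of_nonneg_right ((hD t ht).trans ?_) (by positivity)
        refine mul_le_mul_of_nonneg_left ?_ hD0
        exact Real.rpow_le_rpow (Nat.cast_nonneg _) (by exact_mod_cast Nat.sub_le _ _)
          (by positivity)
    _ = D * A * ((Fintype.card F : ℝ) ^ (ε / 2) *
          (Fintype.card F : ℝ) ^ (1 - 1 / (2 * k + 4) + 2 * (ε / 4) : ℝ)) := by ring
    _ = _ := by
        rw [← Real.rpow_add hq0]
        congr 2
        ring

/-! ### Fourier analysis on (ℤ/p)^n and the discrepancy of boxes -/

section
open ZMod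

variable {p n : ℕ} [NeZero p] {ι : Type*}

/-- The difference between a weighted count of points of `(ℤ/p)^n` and its expected value. -/
noncomputable def discrepancy (M : Finset ι) (a : ι → Fin n → ZMod p)
    (φ : Fin n → ZMod p → ℂ) : ℂ :=
  ∑ m ∈ M, ∏ r, φ r (a m r) - M.card * ∏ r, ((p : ℂ)⁻¹ * ∑ x, φ r x)

/-- The sum of the absolute values of the Fourier coefficients of a function on `ℤ/p`. -/
noncomputable def fourierNorm (φ : ZMod p → ℂ) : ℝ := ∑ h, ‖(p : ℂ)⁻¹ * dft φ h‖

theorem fourierNorm_sub_le (φ φ' : ZMod p → ℂ) :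
    fourierNorm (φ - φ') ≤ fourierNorm φ + fourierNorm φ' := by
  unfold fourierNorm
  rw [← Finset.sum_add_distrib]
  refine Finset.sum_le_sum fun h _ => ?_
  rw [map_sub, Pi.sub_apply, mul_sub]
  exact norm_sub_le _ _

theorem AddChar.map_sum_eq_prod {A M κ : Type*} [AddCommMonoid A] [CommMonoid M]
    (ψ : AddChar A M) (s : Finset κ) (f : κ → A) : ψ (∑ i ∈ s, f i) = ∏ i ∈ s, ψ (f i) := by
  classical
  induction s using Finset.induction_on with
  | empty => simp
  | insert i s hi ih => rw [Finset.sum_insert hi, Finset.prod_insert hi, map_add_eq_mul, ih]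

/-- Fourier inversion in each coordinate: the zero frequency gives the expected value, every other
frequency a sum bounded by E, and the absolute coefficients sum to the product of the
one-dimensional norms. -/
theorem norm_discrepancy_le {M : Finset ι} {a : ι → Fin n → ZMod p} {φ : Fin n → ZMod p → ℂ}
    {E Λ : ℝ} (hE0 : 0 ≤ E)
    (hE : ∀ h : Fin n → ZMod p, h ≠ 0 → ‖∑ m ∈ M, stdAddChar (∑ r, h r * a m r)‖ ≤ E)
    (hφ : ∀ r, fourierNorm (φ r) ≤ Λ) : ‖discrepancy M a φ‖ ≤ E * Λ ^ n := by
  classical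
  let c : Fin n → ZMod p → ℂ := fun r h => (p : ℂ)⁻¹ * dft (φ r) h
  have hinv : ∀ r x, φ r x = ∑ h, c r h * stdAddChar (h * x) := by
    intro r x
    have h1 := congrFun (dft.symm_apply_apply (φ r)) x
    rw [invDFT_apply, smul_eq_mul, Finset.mul_sum] at h1
    rw [← h1]
    refine Finset.sum_congr rfl fun h _ => ?_
    simp only [c, smul_eq_mul]
    ring
  have hc0 : ∀ r, (p : ℂ)⁻¹ * ∑ x, φ r x = c r 0 := fun r => by
    simp only [c, dft_apply_zero]
  let S : (Fin n → ZMod p) → ℂ := fun h => ∑ m ∈ M, stdAddChar (∑ r, h r * a m r)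
  have hexp : ∑ m ∈ M, ∏ r, φ r (a m r) = ∑ h : Fin n → ZMod p, (∏ r, c r (h r)) * S h := by
    simp only [S, hinv, Fintype.prod_sum, Finset.prod_mul_distrib, Finset.mul_sum,
      AddChar.map_sum_eq_prod]
    exact Finset.sum_comm
  have hS0 : S 0 = M.card := by simp [S]
  have hdisc : discrepancy M a φ = ∑ h ∈ Finset.univ.erase (0 : Fin n → ZMod p),
      (∏ r, c r (h r)) * S h := by
    have h1 := Finset.sum_erase_add (s := Finset.univ)
      (f := fun h : Fin n → ZMod p => (∏ r, c r (h r)) * S h) (Finset.mem_univ 0)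
    rw [discrepancy, hexp, ← h1, hS0]
    simp only [hc0, Pi.zero_apply]
    ring
  rw [hdisc]
  calc _ ≤ ∑ h ∈ Finset.univ.erase (0 : Fin n → ZMod p), (∏ r, ‖c r (h r)‖) * E := by
        refine (norm_sum_le _ _).trans (Finset.sum_le_sum fun h hh => ?_)
        rw [norm_mul, norm_prod]
        exact mul_le_mul_of_nonneg_left (hE h (Finset.ne_of_mem_erase hh))
          (Finset.prod_nonneg fun _ _ => norm_nonneg _)
    _ ≤ ∑ h : Fin n → ZMod p, (∏ r, ‖c r (h r)‖) * E := by
        refine Finset.sum_le_sum_of_subset_of_nonneg (Finset.erase_subset _ _) fun h _ _ => ?_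
        exact mul_nonneg (Finset.prod_nonneg fun _ _ => norm_nonneg _) hE0
    _ = E * ∏ r, fourierNorm (φ r) := by
        rw [← Finset.sum_mul, ← Fintype.prod_sum fun r h => ‖c r h‖, mul_comm]
        rfl
    _ ≤ E * ∏ _r : Fin n, Λ := by
        refine mul_le_mul_of_nonneg_left (Finset.prod_le_prod (fun r _ => ?_) fun r _ => hφ r) hE0
        exact Finset.sum_nonneg fun _ _ => norm_nonneg _
    _ = _ := by rw [Finset.prod_const, Finset.card_univ, Fintype.card_fin]

/-- |ζ^h - 1| = 2|sin(πh/p)|, and the sine is at least 2y/p for the distance y from h to the nearer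
of 0 and p. Adding both reciprocals avoids a minimum and leads to two harmonic sums. -/
theorem inv_norm_stdAddChar_sub_one_le {h : ZMod p} (hh : h ≠ 0) :
    2 / ‖(stdAddChar h : ℂ) - 1‖ ≤ (p : ℝ) / 2 * ((h.val : ℝ)⁻¹ + ((p : ℝ) - h.val)⁻¹) := by
  set j := h.val
  have hj0 : (0 : ℝ) < j := by
    have : j ≠ 0 := fun h0 => hh ((ZMod.val_eq_zero h).1 h0)
    exact_mod_cast Nat.pos_of_ne_zero this
  have hjp : (j : ℝ) < p := by exact_mod_cast ZMod.val_lt h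
  have hp0 : (0 : ℝ) < p := hj0.trans hjp
  have hnorm : ‖(stdAddChar h : ℂ) - 1‖ = 2 * |Real.sin (Real.pi * (j / p))| := by
    have h1 : (stdAddChar h : ℂ) = Complex.exp (Complex.I * ((2 * (Real.pi * (j / p)) : ℝ) : ℂ)) := by
      have h2 := stdAddChar_coe (N := p) (j : ℤ)
      rw [Int.cast_natCast, ZMod.natCast_zmod_val] at h2
      rw [h2]
      congr 1
      push_cast
      ring
    rw [h1, Complex.norm_exp_I_mul_ofReal_sub_one, norm_mul, Real.norm_eq_abs, Real.norm_eq_abs,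
      abs_two]
    congr 3
    ring
  have hkey : ∀ y : ℝ, 0 < y → y ≤ p / 2 → 2 * (y / p) ≤ Real.sin (Real.pi * (y / p)) := by
    intro y hy0 hy
    have h1 : y / p ≤ 1 / 2 := by
      rw [div_le_iff₀ hp0]
      linarith
    have h2 := Real.mul_le_sin (x := Real.pi * (y / p)) (by positivity)
      (by nlinarith [Real.pi_pos])
    refine le_trans (le_of_eq ?_) h2
    field_simp
  have hsin : ∃ y : ℝ, 0 < y ∧ (y = j ∨ y = p - j) ∧
      2 * (y / p) ≤ |Real.sin (Real.pi * (j / p))| := by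
    rcases le_total (j : ℝ) (p / 2) with hle | hle
    · exact ⟨j, hj0, Or.inl rfl, (hkey j hj0 hle).trans (le_abs_self _)⟩
    · refine ⟨p - j, by linarith, Or.inr rfl, (hkey (p - j) (by linarith) (by linarith)).trans ?_⟩
      have : Real.pi * ((p - j) / p) = Real.pi - Real.pi * (j / p) := by field_simp
      rw [this, Real.sin_pi_sub]
      exact le_abs_self _
  obtain ⟨y, hy0, hy, hys⟩ := hsin
  have hypos : 0 < 2 * (y / p) := by positivity
  have hfin : y⁻¹ ≤ (j : ℝ)⁻¹ + ((p : ℝ) - j)⁻¹ := by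
    have h1 : 0 < (j : ℝ)⁻¹ := inv_pos.2 hj0
    have h2 : 0 < ((p : ℝ) - j)⁻¹ := inv_pos.2 (by linarith)
    rcases hy with rfl | rfl <;> linarith
  calc 2 / ‖(stdAddChar h : ℂ) - 1‖ = 1 / |Real.sin (Real.pi * (j / p))| := by
        rw [hnorm]
        field_simp
    _ ≤ 1 / (2 * (y / p)) := one_div_le_one_div_of_le hypos hys
    _ = p / 2 * y⁻¹ := by field_simp
    _ ≤ _ := mul_le_mul_of_nonneg_left hfin (by positivity)

theorem fourierNorm_lt_le {v : ℕ} (hv : v ≤ p) :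
    fourierNorm (fun x : ZMod p => if x.val < v then 1 else 0) ≤ 2 + Real.log p := by
  have hp0 : (0 : ℝ) < p := by exact_mod_cast Nat.pos_of_ne_zero (NeZero.ne p)
  have hdft : ∀ h : ZMod p, dft (fun x : ZMod p => if x.val < v then (1 : ℂ) else 0) h =
      ∑ i ∈ Finset.range v, (stdAddChar (-h) : ℂ) ^ i := by
    intro h
    have h1 := ZMod.sum_val_eq_sum_range
      (fun i => (stdAddChar (-h) : ℂ) ^ i * if i < v then 1 else 0) p
    rw [dft_apply]
    refine Eq.trans (Finset.sum_congr rfl fun x _ => ?_) (h1.trans ?_)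
    · rw [smul_eq_mul, ← AddChar.map_nsmul_eq_pow, nsmul_eq_mul, ZMod.natCast_zmod_val, mul_neg]
    · simp only [mul_ite, mul_one, mul_zero]
      rw [← Finset.sum_filter]
      congr 1
      ext i
      simp only [Finset.mem_filter, Finset.mem_range]
      omega
  -- At h = 0 the inverse of 0 is 0 by convention, so the indicator supplies the bound 1; elsewhere
  -- the transform is a geometric sum.
  have hbound : ∀ h : ZMod p,
      ‖(p : ℂ)⁻¹ * dft (fun x : ZMod p => if x.val < v then (1 : ℂ) else 0) h‖ ≤
        (if h.val = 0 then (1 : ℝ) else 0) + 1 / 2 * ((h.val : ℝ)⁻¹ + ((p : ℝ) - h.val)⁻¹) := by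
    intro h
    rw [hdft, norm_mul, norm_inv, Complex.norm_natCast]
    have hjp : (0 : ℝ) < (p : ℝ) - h.val := by
      have : (h.val : ℝ) < p := by exact_mod_cast ZMod.val_lt h
      linarith
    rcases eq_or_ne h 0 with rfl | hh
    · simp only [neg_zero, AddChar.map_zero_eq_one, one_pow, Finset.sum_const, Finset.card_range,
        nsmul_eq_mul, mul_one, Complex.norm_natCast, ZMod.val_zero, if_true]
      have h1 : (p : ℝ)⁻¹ * v ≤ 1 := by
        rw [inv_mul_le_one₀ hp0]
        exact_mod_cast hv
      have h2 : (0 : ℝ) ≤ 1 / 2 * (((0 : ℕ) : ℝ)⁻¹ + ((p : ℝ) - (0 : ℕ))⁻¹) := by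
        simp
      linarith
    · have hval : h.val ≠ 0 := fun h0 => hh ((ZMod.val_eq_zero h).1 h0)
      rw [if_neg hval, zero_add]
      have hne : (stdAddChar (-h) : ℂ) ≠ 1 := by
        rw [← AddChar.map_zero_eq_one (stdAddChar (N := p))]
        exact fun h1 => hh (neg_eq_zero.1 (injective_stdAddChar h1))
      have hinv : ‖(stdAddChar (-h) : ℂ) - 1‖ = ‖(stdAddChar h : ℂ) - 1‖ := by
        have h1 : (stdAddChar (-h) : ℂ) * stdAddChar h = 1 := by
          rw [← AddChar.map_add_eq_mul, neg_add_cancel, AddChar.map_zero_eq_one]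
        have h2 : (stdAddChar (-h) : ℂ) - 1 = -(stdAddChar (-h) * (stdAddChar h - 1)) := by
          rw [mul_sub, h1]
          ring
        rw [h2, norm_neg, norm_mul, AddChar.norm_apply, one_mul]
      have hgeom : ‖∑ i ∈ Finset.range v, (stdAddChar (-h) : ℂ) ^ i‖ ≤
          2 / ‖(stdAddChar h : ℂ) - 1‖ := by
        rw [geom_sum_eq hne, norm_div, hinv]
        refine div_le_div_of_nonneg_right ((norm_sub_le _ _).trans ?_) (norm_nonneg _)
        rw [norm_pow, AddChar.norm_apply, one_pow, norm_one]
        norm_num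
      calc (p : ℝ)⁻¹ * ‖∑ i ∈ Finset.range v, (stdAddChar (-h) : ℂ) ^ i‖
          ≤ (p : ℝ)⁻¹ * ((p : ℝ) / 2 * ((h.val : ℝ)⁻¹ + ((p : ℝ) - h.val)⁻¹)) :=
            mul_le_mul_of_nonneg_left (hgeom.trans (inv_norm_stdAddChar_sub_one_le hh))
              (by positivity)
        _ = _ := by field_simp
  have hharm : ∑ i ∈ Finset.range p, ((i + 1 : ℕ) : ℝ)⁻¹ ≤ 1 + Real.log p := by
    have := harmonic_le_one_add_log p
    rw [harmonic] at this
    push_cast at this ⊢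
    exact this
  refine (Finset.sum_le_sum fun h _ => hbound h).trans ?_
  rw [ZMod.sum_val_eq_sum_range
    (fun j => (if j = 0 then (1 : ℝ) else 0) + 1 / 2 * ((j : ℝ)⁻¹ + ((p : ℝ) - j)⁻¹)) p,
    Finset.sum_add_distrib, ← Finset.mul_sum, Finset.sum_add_distrib]
  have h1 : ∑ j ∈ Finset.range p, (if j = 0 then (1 : ℝ) else 0) ≤ 1 := by
    rw [Finset.sum_ite_eq']
    split_ifs <;> norm_num
  have h2 : ∑ j ∈ Finset.range p, (j : ℝ)⁻¹ ≤ 1 + Real.log p := by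
    obtain ⟨m, hm⟩ := Nat.exists_eq_succ_of_ne_zero (NeZero.ne p)
    refine le_trans ?_ hharm
    rw [hm, Finset.sum_range_succ' (fun j => (j : ℝ)⁻¹), Finset.sum_range_succ, Nat.cast_zero,
      _root_.inv_zero]
    gcongr
    positivity
  have h3 : ∑ j ∈ Finset.range p, ((p : ℝ) - j)⁻¹ ≤ 1 + Real.log p := by
    refine le_trans (le_of_eq ?_) hharm
    rw [← Finset.sum_range_reflect]
    refine Finset.sum_congr rfl fun j hj => ?_
    have := Finset.mem_range.1 hj
    rw [Nat.sub_sub, Nat.cast_sub (by omega)]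
    push_cast
    ring
  linarith

theorem fourierNorm_Ico_le {u v : ℕ} (huv : u ≤ v) (hv : v ≤ p) :
    fourierNorm (fun x : ZMod p => if u ≤ x.val ∧ x.val < v then 1 else 0) ≤
      4 + 2 * Real.log p := by
  have h : (fun x : ZMod p => if u ≤ x.val ∧ x.val < v then (1 : ℂ) else 0) =
      (fun x => if x.val < v then 1 else 0) - fun x => if x.val < u then 1 else 0 := by
    ext x
    rw [Pi.sub_apply]
    split_ifs <;> first | omega | simp
  rw [h]
  refine (fourierNorm_sub_le _ _).trans ?_
  have h1 := fourierNorm_lt_le hv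
  have h2 := fourierNorm_lt_le (huv.trans hv)
  linarith

end

/-! ### Grid cells, boundaries and volumes -/

section
open MeasureTheory

variable {n : ℕ}

/-- The closed cube of the grid of mesh `1/H` with lower corner `J/H`. -/
def gridCell (H : ℕ) (J : Fin n → ℕ) : Set (Fin n → ℝ) :=
  Set.Icc (fun r => (J r : ℝ) / H) fun r => ((J r : ℝ) + 1) / H

variable (n) in
/-- The indices of the cells of the grid of mesh `1/H` in the unit cube. -/
def gridIndices (H : ℕ) : Finset (Fin n → ℕ) := Fintype.piFinset fun _ => Finset.range H

open Classical in
/-- The indices of the cells meeting the boundary of a set. -/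
noncomputable def boundaryCells (Ω : Set (Fin n → ℝ)) (H : ℕ) : Finset (Fin n → ℕ) :=
  (gridIndices n H).filter fun J => (gridCell H J ∩ frontier Ω).Nonempty

theorem mem_gridIndices {H : ℕ} {J : Fin n → ℕ} : J ∈ gridIndices n H ↔ ∀ r, J r < H := by
  simp [gridIndices]

theorem mem_boundaryCells {Ω : Set (Fin n → ℝ)} {H : ℕ} {J : Fin n → ℕ} :
    J ∈ boundaryCells Ω H ↔ J ∈ gridIndices n H ∧ (gridCell H J ∩ frontier Ω).Nonempty := by
  simp [boundaryCells]

theorem card_gridIndices (H : ℕ) : (gridIndices n H).card = H ^ n := by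
  simp [gridIndices]

theorem mem_gridCell {H : ℕ} (hH : 0 < H) {J : Fin n → ℕ} {x : Fin n → ℝ} :
    x ∈ gridCell H J ↔ ∀ r, (J r : ℝ) ≤ H * x r ∧ H * x r ≤ J r + 1 := by
  have hH' : (0 : ℝ) < H := by exact_mod_cast hH
  simp only [gridCell, Set.mem_Icc, Pi.le_def, ← forall_and]
  refine forall_congr' fun r => ?_
  rw [div_le_iff₀ hH', le_div_iff₀ hH', mul_comm]

theorem exists_mem_gridCell {H : ℕ} (hH : 0 < H) {x : Fin n → ℝ} (hx : x ∈ Set.Icc 0 1) :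
    ∃ J ∈ gridIndices n H, x ∈ gridCell H J := by
  have hH' : (0 : ℝ) < H := by exact_mod_cast hH
  -- The minimum puts points with a coordinate equal to 1 into the last cell.
  refine ⟨fun r => min ⌊H * x r⌋₊ (H - 1), mem_gridIndices.2 fun r => ?_,
    (mem_gridCell hH).2 fun r => ?_⟩
  · exact (min_le_right _ _).trans_lt (by omega)
  · have h0 : 0 ≤ H * x r := mul_nonneg hH'.le (hx.1 r)
    have h1 : H * x r ≤ H := mul_le_of_le_one_right hH'.le (hx.2 r)
    refine ⟨le_trans (by exact_mod_cast min_le_left _ _) (Nat.floor_le h0), ?_⟩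
    rcases min_choice ⌊H * x r⌋₊ (H - 1) with h | h <;> rw [h]
    · exact (Nat.lt_floor_add_one _).le
    · rw [Nat.cast_sub hH]
      push_cast
      linarith

/-- A cell is connected, so if it misses the frontier it lies in the interior or in the exterior. -/
theorem gridCell_subset_of_not_mem_boundaryCells {Ω : Set (Fin n → ℝ)} {H : ℕ} {J : Fin n → ℕ}
    (hJ : J ∈ gridIndices n H) (hb : J ∉ boundaryCells Ω H) (hne : (gridCell H J ∩ Ω).Nonempty) :
    gridCell H J ⊆ Ω := by
  have hdisj : gridCell H J ∩ frontier Ω = ∅ := by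
    by_contra h
    exact hb (mem_boundaryCells.2 ⟨hJ, Set.nonempty_iff_ne_empty.2 h⟩)
  have hcover : gridCell H J ⊆ interior Ω ∪ (closure Ω)ᶜ := by
    intro x hx
    by_contra h
    rw [Set.mem_union, not_or, Set.mem_compl_iff, not_not] at h
    exact Set.notMem_empty x (hdisj ▸ ⟨hx, h.2, h.1⟩)
  have hconn : IsPreconnected (gridCell H J) := (convex_Icc _ _).isPreconnected
  rcases hconn.subset_or_subset isOpen_interior isClosed_closure.isOpen_compl
    (Set.disjoint_compl_right_iff_subset.2 (interior_subset.trans subset_closure)) hcover with h | h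
  · exact h.trans interior_subset
  · obtain ⟨x, hx, hxΩ⟩ := hne
    exact absurd (subset_closure hxΩ) (h hx)

/-- Consecutive cells of a column share a point. -/
theorem gridCell_cons_inter_nonempty {H : ℕ} (hH : 0 < H) (i : ℕ) (J : Fin n → ℕ) :
    (gridCell H (Fin.cons i J : Fin (n + 1) → ℕ) ∩
      gridCell H (Fin.cons (i + 1) J : Fin (n + 1) → ℕ)).Nonempty := by
  have hH' : (H : ℝ) ≠ 0 := by exact_mod_cast hH.ne'
  refine ⟨Fin.cons (((i : ℝ) + 1) / H) fun r => (J r : ℝ) / H, ?_, ?_⟩ <;>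
  · rw [mem_gridCell hH]
    intro r
    refine Fin.cases ?_ (fun r => ?_) r <;>
    · simp only [Fin.cons_zero, Fin.cons_succ, mul_div_cancel₀ _ hH']
      push_cast
      constructor <;> linarith

theorem ContDiffOn.exists_lipschitzOnWith_Icc {m : ℕ} {φ : (Fin m → ℝ) → (Fin n → ℝ)}
    (hφ : ContDiffOn ℝ 1 φ (Set.Icc 0 1)) : ∃ K, LipschitzOnWith K φ (Set.Icc 0 1) := by
  refine LocallyLipschitzOn.exists_lipschitzOnWith_of_compact isCompact_Icc fun x hx => ?_
  exact (hφ x hx).exists_lipschitzOnWith (convex_Icc _ _)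

/-- The image of a cell of side 1/H has diameter at most K/H, so the cells it meets have indices
within K + 1 of one another in every coordinate. -/
theorem card_filter_image_meets_le {m H K : ℕ} (hH : 0 < H) {φ : (Fin m → ℝ) → (Fin n → ℝ)}
    (hφ : LipschitzOnWith K φ (Set.Icc 0 1)) (c : Fin m → ℕ) (s : Finset (Fin n → ℕ))
    (hs : ∀ J ∈ s, ∃ y ∈ Set.Icc (0 : Fin m → ℝ) 1 ∩ gridCell H c, φ y ∈ gridCell H J) :
    s.card ≤ (2 * K + 3) ^ n := by
  rcases s.eq_empty_or_nonempty with rfl | ⟨J₀, hJ₀⟩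
  · simp
  have hH' : (0 : ℝ) < H := by exact_mod_cast hH
  obtain ⟨y₀, ⟨hy₀, hy₀c⟩, hφ₀⟩ := hs J₀ hJ₀
  have hsub : s ⊆ Fintype.piFinset fun r => Finset.Icc (J₀ r - (K + 1)) (J₀ r + (K + 1)) := by
    intro J hJ
    obtain ⟨y, ⟨hy, hyc⟩, hφy⟩ := hs J hJ
    rw [mem_gridCell hH] at hyc hy₀c hφy hφ₀
    have hdist : dist y y₀ ≤ 1 / H := by
      refine (dist_pi_le_iff (by positivity)).2 fun r => ?_
      rw [Real.dist_eq, le_div_iff₀ hH', mul_comm, ← abs_of_pos hH', ← abs_mul, abs_le]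
      constructor <;> linarith [hyc r, hy₀c r]
    have hdist' : dist (φ y) (φ y₀) ≤ K * (1 / H) :=
      (hφ.dist_le_mul y hy y₀ hy₀).trans (mul_le_mul_of_nonneg_left hdist (by positivity))
    refine Fintype.mem_piFinset.2 fun r => ?_
    have h1 := (dist_le_pi_dist (φ y) (φ y₀) r).trans hdist'
    rw [Real.dist_eq, mul_one_div, le_div_iff₀ hH', mul_comm, ← abs_of_pos hH', ← abs_mul,
      abs_le] at h1
    have h2 : (J r : ℝ) ≤ J₀ r + (K + 1) := by linarith [hφy r, hφ₀ r]
    have h3 : (J₀ r : ℝ) ≤ J r + (K + 1) := by linarith [hφy r, hφ₀ r]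
    have h2' : J r ≤ J₀ r + (K + 1) := by exact_mod_cast h2
    have h3' : J₀ r ≤ J r + (K + 1) := by exact_mod_cast h3
    rw [Finset.mem_Icc]
    omega
  refine (Finset.card_le_card hsub).trans ?_
  rw [Fintype.card_piFinset]
  refine (Finset.prod_le_prod' fun r _ => ?_).trans
    (le_of_eq (by rw [Finset.prod_const, Finset.card_univ, Fintype.card_fin]))
  rw [Nat.card_Icc]
  omega

/-- A piecewise smooth boundary meets few cells of the grid. -/
theorem HasPiecewiseSmoothBoundary.exists_card_boundaryCells_le {Ω : Set (Fin n → ℝ)}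
    (hΩ : HasPiecewiseSmoothBoundary Ω) :
    ∃ C : ℕ, ∀ H : ℕ, 0 < H → (boundaryCells Ω H).card ≤ C * H ^ (n - 1) := by
  classical
  obtain ⟨r, φ, hφ, hcover⟩ := hΩ
  choose K hK using fun i => (hφ i).exists_lipschitzOnWith_Icc
  obtain ⟨K', hK'⟩ : ∃ K' : ℕ, ∀ i, LipschitzOnWith K' (φ i) (Set.Icc 0 1) := by
    refine ⟨∑ i, ⌈K i⌉₊, fun i => (hK i).weaken ?_⟩
    refine (Nat.le_ceil _).trans ?_
    exact_mod_cast Finset.single_le_sum (f := fun i => ⌈K i⌉₊) (fun _ _ => Nat.zero_le _)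
      (Finset.mem_univ i)
  refine ⟨r * (2 * K' + 3) ^ n, fun H hH => ?_⟩
  let P : Fin r × (Fin (n - 1) → ℕ) → Finset (Fin n → ℕ) := fun ic =>
    (boundaryCells Ω H).filter fun J =>
      ∃ y ∈ Set.Icc (0 : Fin (n - 1) → ℝ) 1 ∩ gridCell H ic.2, φ ic.1 y ∈ gridCell H J
  have hsub : boundaryCells Ω H ⊆
      ((Finset.univ : Finset (Fin r)) ×ˢ gridIndices (n - 1) H).biUnion P := by
    intro J hJ
    obtain ⟨x, hxJ, hx⟩ := (mem_boundaryCells.1 hJ).2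
    obtain ⟨i, y, hy, rfl⟩ := Set.mem_iUnion.1 (hcover hx)
    obtain ⟨c, hc, hyc⟩ := exists_mem_gridCell hH hy
    exact Finset.mem_biUnion.2 ⟨(i, c), Finset.mem_product.2 ⟨Finset.mem_univ _, hc⟩,
      Finset.mem_filter.2 ⟨hJ, y, ⟨hy, hyc⟩, hxJ⟩⟩
  refine (Finset.card_le_card hsub).trans ((Finset.card_biUnion_le_card_mul _ _ _ fun ic _ =>
    card_filter_image_meets_le hH (hK' ic.1) ic.2 _ fun J hJ =>
      (Finset.mem_filter.1 hJ).2).trans (le_of_eq ?_))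
  rw [Finset.card_product, card_gridIndices, Finset.card_univ, Fintype.card_fin]
  ring

theorem volume_gridCell {H : ℕ} (J : Fin n → ℕ) :
    volume (gridCell H J) = ENNReal.ofReal ((1 / H : ℝ) ^ n) := by
  rw [gridCell, Real.volume_Icc_pi]
  have : ∀ r, ((J r : ℝ) + 1) / H - J r / H = 1 / H := fun r => by ring
  simp only [this]
  rw [Finset.prod_const, Finset.card_univ, Fintype.card_fin, ENNReal.ofReal_pow (by positivity)]

/-- The volume of a set is at most the total volume of the cells it meets. -/
theorem toReal_volume_le_card {H : ℕ} (hH : 0 < H) {Ω : Set (Fin n → ℝ)}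
    (hΩ : Ω ⊆ Set.Icc 0 1) {s : Finset (Fin n → ℕ)}
    (hs : ∀ J ∈ gridIndices n H, (gridCell H J ∩ Ω).Nonempty → J ∈ s) :
    (volume Ω).toReal ≤ s.card * (1 / H : ℝ) ^ n := by
  have h1 : Ω ⊆ ⋃ J ∈ s, gridCell H J := fun x hx => by
    obtain ⟨J, hJ, hxJ⟩ := exists_mem_gridCell hH (hΩ hx)
    exact Set.mem_biUnion (hs J hJ ⟨x, hxJ, hx⟩) hxJ
  have h2 := (measure_mono h1).trans (measure_biUnion_finset_le (μ := volume) s _)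
  simp only [volume_gridCell, Finset.sum_const] at h2
  rw [nsmul_eq_mul, ← ENNReal.ofReal_natCast, ← ENNReal.ofReal_mul (Nat.cast_nonneg _)] at h2
  exact ENNReal.toReal_le_of_le_ofReal (by positivity) h2

/-- The volume of a set is at least the total volume of the cells it contains. -/
theorem card_le_toReal_volume {H : ℕ} (hH : 0 < H) {Ω : Set (Fin n → ℝ)}
    (hΩ : Ω ⊆ Set.Icc 0 1) {s : Finset (Fin n → ℕ)} (hs : ∀ J ∈ s, gridCell H J ⊆ Ω) :
    s.card * (1 / H : ℝ) ^ n ≤ (volume Ω).toReal := by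
  have hH' : (0 : ℝ) < H := by exact_mod_cast hH
  let c : (Fin n → ℕ) → Set (Fin n → ℝ) := fun J =>
    Set.pi Set.univ fun r => Set.Ico ((J r : ℝ) / H) (((J r : ℝ) + 1) / H)
  have hc : ∀ J, c J ⊆ gridCell H J := fun J x hx =>
    ⟨fun r => (hx r (Set.mem_univ r)).1, fun r => (hx r (Set.mem_univ r)).2.le⟩
  have hvol : ∀ J, volume (c J) = ENNReal.ofReal ((1 / H : ℝ) ^ n) := fun J => by
    rw [← volume_gridCell J, gridCell, Real.volume_Icc_pi, ← Real.volume_pi_Ico]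
  have hdisj : (s : Set (Fin n → ℕ)).PairwiseDisjoint c := by
    intro J _ J' _ hne
    refine Set.disjoint_left.2 fun x hx hx' => hne (funext fun r => ?_)
    have h1 := hx r (Set.mem_univ r)
    have h2 := hx' r (Set.mem_univ r)
    rw [Set.mem_Ico, div_le_iff₀ hH', lt_div_iff₀ hH'] at h1 h2
    have h3 : (J r : ℝ) < J' r + 1 := by linarith
    have h4 : (J' r : ℝ) < J r + 1 := by linarith
    have h3' : J r < J' r + 1 := by exact_mod_cast h3
    have h4' : J' r < J r + 1 := by exact_mod_cast h4
    omega
  have h1 : ⋃ J ∈ s, c J ⊆ Ω := Set.iUnion₂_subset fun J hJ => (hc J).trans (hs J hJ)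
  have h2 := measure_mono (μ := volume) h1
  rw [measure_biUnion_finset hdisj fun J _ => MeasurableSet.univ_pi fun _ => measurableSet_Ico] at h2
  simp only [hvol, Finset.sum_const] at h2
  rw [nsmul_eq_mul, ← ENNReal.ofReal_natCast, ← ENNReal.ofReal_mul (Nat.cast_nonneg _)] at h2
  refine (ENNReal.ofReal_le_iff_le_toReal ?_).1 h2
  exact ((measure_mono hΩ).trans_lt isCompact_Icc.measure_lt_top).ne

end

/-! ### Summation by parts along columns of cells -/

section

/-- The indicator of g jumps only next to an index satisfying b, at most twice per such index, and
by Abel summation each jump costs one partial sum. A long run of cells thus costs no more than a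
single box. -/
theorem norm_sum_ite_le_of_partialSums {f : ℕ → ℂ} {E : ℝ} {H : ℕ}
    (hf : ∀ s ≤ H, ‖∑ i ∈ Finset.range s, f i‖ ≤ E) {g b : ℕ → Prop} [DecidablePred g]
    [DecidablePred b] (hgb : ∀ i, i + 1 < H → ¬ (g i ↔ g (i + 1)) → b i ∨ b (i + 1)) :
    ‖∑ i ∈ Finset.range H, if g i then f i else 0‖ ≤
      E * (1 + 2 * ((Finset.range H).filter b).card) := by
  have hE : 0 ≤ E := (norm_nonneg _).trans (hf 0 (Nat.zero_le _))
  let c : ℕ → ℂ := fun i => if g i then 1 else 0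
  let β : ℕ → ℝ := fun i => if b i then 1 else 0
  have hβ : ∀ i, 0 ≤ β i := fun i => by
    simp only [β]
    split_ifs <;> norm_num
  have hβsum : ∑ i ∈ Finset.range H, β i = ((Finset.range H).filter b).card := by
    simp [β]
  have h1 := Finset.sum_range_by_parts c f H
  have h2 : ∀ i, (if g i then f i else 0) = c i • f i := fun i => by simp [c]
  simp only [h2]
  rw [h1]
  have hc : ∀ i, ‖c i‖ ≤ 1 := fun i => by
    simp only [c]
    split_ifs <;> simp
  have h3 : ‖c (H - 1) • ∑ i ∈ Finset.range H, f i‖ ≤ E := by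
    rw [norm_smul]
    exact (mul_le_of_le_one_left (norm_nonneg _) (hc _)).trans (hf H le_rfl)
  have h4 : ∀ i ∈ Finset.range (H - 1),
      ‖(c (i + 1) - c i) • ∑ j ∈ Finset.range (i + 1), f j‖ ≤ (β i + β (i + 1)) * E := by
    intro i hi
    have hi := Finset.mem_range.1 hi
    rw [norm_smul]
    refine mul_le_mul ?_ (hf _ (by omega)) (norm_nonneg _) (add_nonneg (hβ _) (hβ _))
    by_cases hg : g i ↔ g (i + 1)
    · have : c (i + 1) - c i = 0 := by simp [c, hg]
      rw [this, norm_zero]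
      exact add_nonneg (hβ _) (hβ _)
    · have h5 : ‖c (i + 1) - c i‖ ≤ 1 := by
        simp only [c]
        split_ifs <;> simp
      refine h5.trans ?_
      rcases hgb i (by omega) hg with h | h
      · have : β i = 1 := if_pos h
        linarith [hβ (i + 1)]
      · have : β (i + 1) = 1 := if_pos h
        linarith [hβ i]
  have h5 : ∑ i ∈ Finset.range (H - 1), β i ≤ ∑ i ∈ Finset.range H, β i :=
    Finset.sum_le_sum_of_subset_of_nonneg (Finset.range_mono (Nat.sub_le _ _)) fun i _ _ => hβ i
  have h6 : ∑ i ∈ Finset.range (H - 1), β (i + 1) ≤ ∑ i ∈ Finset.range H, β i := by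
    rcases H with - | H
    · simp
    · rw [Nat.add_sub_cancel, Finset.sum_range_succ' β]
      linarith [hβ 0]
  have h7 := norm_sum_le_of_le _ h4
  rw [← Finset.sum_mul, Finset.sum_add_distrib] at h7
  refine (norm_sub_le _ _).trans ?_
  nlinarith

theorem cell_ceilDiv_le {p H : ℕ} (hH : 0 < H) {s : ℕ} (hs : s ≤ H) : (s * p) ⌈/⌉ H ≤ p := by
  rw [ceilDiv_le_iff_le_mul hH]
  exact Nat.mul_le_mul_right _ hs

theorem cell_ceilDiv_mono {p H : ℕ} (hH : 0 < H) (i : ℕ) :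
    (i * p) ⌈/⌉ H ≤ ((i + 1) * p) ⌈/⌉ H := by
  rw [ceilDiv_le_iff_le_mul hH]
  refine le_trans (Nat.mul_le_mul_right _ (Nat.le_succ i)) ?_
  exact le_smul_ceilDiv hH

variable {p n : ℕ} [NeZero p] {ι : Type*}

theorem sum_gridIndices_succ {M : Type*} [AddCommMonoid M] (H : ℕ) (f : (Fin (n + 1) → ℕ) → M) :
    ∑ J ∈ gridIndices (n + 1) H, f J =
      ∑ J ∈ gridIndices n H, ∑ i ∈ Finset.range H, f (Fin.cons i J) := by
  rw [Finset.sum_comm, ← Finset.sum_product']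
  symm
  refine Finset.sum_nbij (fun iJ => Fin.cons iJ.1 iJ.2) (fun iJ h => ?_) (fun iJ _ iJ' _ h => ?_)
    (fun J hJ => ?_) fun _ _ => rfl
  · rw [Finset.mem_product] at h
    refine mem_gridIndices.2 fun r => Fin.cases ?_ (fun r => ?_) r
    · exact Finset.mem_range.1 h.1
    · exact mem_gridIndices.1 h.2 r
  · have h' := Fin.cons_injective2 h
    exact Prod.ext h'.1 h'.2
  · have hJ := mem_gridIndices.1 (Finset.mem_coe.1 hJ)
    refine ⟨(J 0, Fin.tail J), Finset.mem_coe.2 (Finset.mem_product.2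
      ⟨Finset.mem_range.2 (hJ 0), mem_gridIndices.2 fun r => hJ r.succ⟩), Fin.cons_self_tail J⟩

theorem discrepancy_cons_sum {κ : Type*} (M : Finset ι) (a : ι → Fin (n + 1) → ZMod p)
    (s : Finset κ) (ψ : κ → ZMod p → ℂ) (φ : Fin n → ZMod p → ℂ) :
    discrepancy M a (Fin.cons (∑ i ∈ s, ψ i) φ : Fin (n + 1) → ZMod p → ℂ) =
      ∑ i ∈ s, discrepancy M a (Fin.cons (ψ i) φ : Fin (n + 1) → ZMod p → ℂ) := by
  simp only [discrepancy, Fin.prod_univ_succ, Fin.cons_zero, Fin.cons_succ, Finset.sum_apply,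
    Finset.sum_sub_distrib]
  congr 1
  · rw [Finset.sum_comm]
    exact Finset.sum_congr rfl fun m _ => Finset.sum_mul _ _ _
  · rw [Finset.sum_comm, Finset.mul_sum, Finset.sum_mul, Finset.mul_sum]

variable (p) in
/-- The indicator function of the residues lying in the `i`-th interval of the grid. -/
noncomputable def cellIndicator (H i : ℕ) (x : ZMod p) : ℂ := if H * x.val / p = i then 1 else 0

theorem cell_lt_iff {H : ℕ} (hH : 0 < H) (x s : ℕ) : H * x / p < s ↔ x < (s * p) ⌈/⌉ H := by
  rw [Nat.div_lt_iff_lt_mul (Nat.pos_of_ne_zero (NeZero.ne p)), ← not_iff_not, not_lt, not_lt,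
    ceilDiv_le_iff_le_mul hH]

theorem cell_eq_iff {H : ℕ} (hH : 0 < H) (x i : ℕ) :
    H * x / p = i ↔ (i * p) ⌈/⌉ H ≤ x ∧ x < ((i + 1) * p) ⌈/⌉ H := by
  rw [← cell_lt_iff hH, ← not_lt, ← cell_lt_iff hH]
  omega

theorem fourierNorm_cellIndicator_le {H i : ℕ} (hi : i < H) :
    fourierNorm (cellIndicator p H i) ≤ 4 + 2 * Real.log p := by
  have hH : 0 < H := by omega
  have h : cellIndicator p H i =
      fun x => if (i * p) ⌈/⌉ H ≤ x.val ∧ x.val < ((i + 1) * p) ⌈/⌉ H then 1 else 0 := by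
    ext x
    simp only [cellIndicator, cell_eq_iff hH]
  rw [h]
  exact fourierNorm_Ico_le (cell_ceilDiv_mono hH i) (cell_ceilDiv_le hH hi)

/-- Consecutive cells form one interval, so the bound does not grow with their number. -/
theorem fourierNorm_sum_cellIndicator_le {H s : ℕ} (hH : 0 < H) (hs : s ≤ H) :
    fourierNorm (∑ i ∈ Finset.range s, cellIndicator p H i) ≤ 4 + 2 * Real.log p := by
  have h : ∑ i ∈ Finset.range s, cellIndicator p H i =
      fun x => if 0 ≤ x.val ∧ x.val < (s * p) ⌈/⌉ H then 1 else 0 := by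
    ext x
    simp only [Finset.sum_apply, cellIndicator, Finset.sum_ite_eq, Finset.mem_range,
      cell_lt_iff hH, Nat.zero_le, true_and]
  rw [h]
  exact fourierNorm_Ico_le (Nat.zero_le _) (cell_ceilDiv_le hH hs)

/-- The discrepancy of a union of cells, in terms of the number of cells at its boundary. -/
theorem norm_sum_discrepancy_cells_le {M : Finset ι} {a : ι → Fin (n + 1) → ZMod p} {E : ℝ}
    (hE0 : 0 ≤ E) (hE : ∀ h : Fin (n + 1) → ZMod p, h ≠ 0 →
      ‖∑ m ∈ M, ZMod.stdAddChar (∑ r, h r * a m r)‖ ≤ E) {H : ℕ} (hH : 0 < H)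
    {G b : (Fin (n + 1) → ℕ) → Prop} [DecidablePred G] [DecidablePred b]
    (hGb : ∀ J ∈ gridIndices n H, ∀ i, i + 1 < H →
      ¬ (G (Fin.cons i J) ↔ G (Fin.cons (i + 1) J)) →
        b (Fin.cons i J) ∨ b (Fin.cons (i + 1) J)) :
    ‖∑ J ∈ gridIndices (n + 1) H,
        if G J then discrepancy M a (fun r => cellIndicator p H (J r)) else 0‖ ≤
      E * (4 + 2 * Real.log p) ^ (n + 1) *
        (H ^ n + 2 * ((gridIndices (n + 1) H).filter b).card) := by
  set E' := E * (4 + 2 * Real.log p) ^ (n + 1)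
  have hcons : ∀ (i : ℕ) (J : Fin n → ℕ),
      (fun r => cellIndicator p H ((Fin.cons i J : Fin (n + 1) → ℕ) r)) =
        (Fin.cons (cellIndicator p H i) fun r => cellIndicator p H (J r) :
          Fin (n + 1) → ZMod p → ℂ) := by
    intro i J
    funext r
    refine Fin.cases ?_ (fun r => ?_) r
    · simp only [Fin.cons_zero]
    · simp only [Fin.cons_succ]
  have hcol : ∀ J ∈ gridIndices n H, ‖∑ i ∈ Finset.range H, if G (Fin.cons i J) then
      discrepancy M a (fun r => cellIndicator p H ((Fin.cons i J : Fin (n + 1) → ℕ) r)) else 0‖ ≤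
        E' * (1 + 2 * ((Finset.range H).filter fun i => b (Fin.cons i J)).card) := by
    intro J hJ
    refine norm_sum_ite_le_of_partialSums (fun s hs => ?_) (hGb J hJ)
    simp only [hcons]
    rw [← discrepancy_cons_sum]
    refine norm_discrepancy_le hE0 hE fun r => Fin.cases ?_ (fun r => ?_) r
    · rw [Fin.cons_zero]
      exact fourierNorm_sum_cellIndicator_le hH hs
    · rw [Fin.cons_succ]
      exact fourierNorm_cellIndicator_le (mem_gridIndices.1 hJ r)
  have hcard : ((gridIndices (n + 1) H).filter b).card =
      ∑ J ∈ gridIndices n H, ((Finset.range H).filter fun i => b (Fin.cons i J)).card := by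
    rw [Finset.card_filter, sum_gridIndices_succ]
    exact Finset.sum_congr rfl fun J _ => (Finset.card_filter _ _).symm
  rw [sum_gridIndices_succ]
  refine (norm_sum_le_of_le _ hcol).trans (le_of_eq ?_)
  rw [← Finset.mul_sum, Finset.sum_add_distrib, ← Finset.mul_sum, Finset.sum_const,
    card_gridIndices, hcard]
  push_cast
  rw [nsmul_eq_mul, mul_one]
  push_cast
  ring

theorem norm_prod_sub_pow_le {x : Fin n → ℂ} {y : ℂ} {δ B : ℝ} (hB : ∀ r, ‖x r‖ ≤ B)
    (hy : ‖y‖ ≤ B) (hδ : ∀ r, ‖x r - y‖ ≤ δ) (hB0 : 0 ≤ B) :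
    ‖∏ r, x r - y ^ n‖ ≤ n * δ * B ^ (n - 1) := by
  induction n with
  | zero => simp
  | succ n ih =>
    rw [Fin.prod_univ_succ, pow_succ', Nat.add_sub_cancel]
    have h1 : x 0 * ∏ r : Fin n, x r.succ - y * y ^ n =
        (x 0 - y) * y ^ n + x 0 * (∏ r : Fin n, x r.succ - y ^ n) := by ring
    have hδ0 : 0 ≤ δ := (norm_nonneg _).trans (hδ 0)
    have h2 := ih (fun r => hB r.succ) fun r => hδ r.succ
    calc _ ≤ ‖x 0 - y‖ * ‖y‖ ^ n + ‖x 0‖ * ‖∏ r : Fin n, x r.succ - y ^ n‖ := by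
          rw [h1]
          refine (norm_add_le _ _).trans ?_
          rw [norm_mul, norm_mul, norm_pow]
      _ ≤ δ * B ^ n + B * (n * δ * B ^ (n - 1)) := by
          gcongr
          · exact hδ 0
          · exact hB 0
      _ = _ := by
          rcases n with - | n
          · simp
          · rw [Nat.add_sub_cancel, pow_succ]
            push_cast
            ring

/-- A half-open interval of length p/H contains p/H integers up to an error of at most 1. -/
theorem norm_inv_mul_sum_cellIndicator_sub_le {H i : ℕ} (hi : i < H) :
    ‖(p : ℂ)⁻¹ * ∑ x, cellIndicator p H i x - (H : ℂ)⁻¹‖ ≤ (p : ℝ)⁻¹ := by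
  have hH : 0 < H := by omega
  have hp0 : (0 : ℝ) < p := by exact_mod_cast Nat.pos_of_ne_zero (NeZero.ne p)
  have hH0 : (0 : ℝ) < H := by exact_mod_cast hH
  set u := (i * p) ⌈/⌉ H
  set v := ((i + 1) * p) ⌈/⌉ H
  have huv : u ≤ v := cell_ceilDiv_mono hH i
  have hvp : v ≤ p := cell_ceilDiv_le hH hi
  have hsum : ∑ x, cellIndicator p H i x = ((v - u : ℕ) : ℂ) := by
    have h1 := ZMod.sum_val_eq_sum_range (fun j => if u ≤ j ∧ j < v then (1 : ℂ) else 0) p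
    simp only [cellIndicator, cell_eq_iff hH]
    rw [h1, Finset.sum_boole, ← Nat.card_Ico]
    congr 2
    ext j
    simp only [Finset.mem_filter, Finset.mem_range, Finset.mem_Ico]
    omega
  have hceil : ∀ s : ℕ, (s * p : ℝ) ≤ H * ((s * p) ⌈/⌉ H : ℕ) ∧
      H * ((s * p) ⌈/⌉ H : ℕ) < (s * p : ℝ) + H := by
    intro s
    have h1 : s * p ≤ H * ((s * p) ⌈/⌉ H) := le_smul_ceilDiv hH
    have h2 : H * ((s * p) ⌈/⌉ H) < s * p + H := by
      rw [Nat.ceilDiv_eq_add_pred_div]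
      have := Nat.mul_div_le (s * p + H - 1) H
      omega
    exact ⟨by exact_mod_cast h1, by exact_mod_cast h2⟩
  have hu := hceil i
  have hv := hceil (i + 1)
  have h1 : (p : ℂ)⁻¹ * ((v - u : ℕ) : ℂ) - (H : ℂ)⁻¹ =
      (((p : ℝ)⁻¹ * (H : ℝ)⁻¹ * (H * v - H * u - p) : ℝ) : ℂ) := by
    have hp' : (p : ℂ) ≠ 0 := by exact_mod_cast NeZero.ne p
    have hH' : (H : ℂ) ≠ 0 := by exact_mod_cast hH.ne'
    push_cast [Nat.cast_sub huv]
    field_simp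
  rw [hsum, h1, Complex.norm_real, Real.norm_eq_abs, abs_mul, abs_of_pos (by positivity), mul_assoc]
  refine mul_le_of_le_one_right (by positivity) ?_
  rw [inv_mul_le_one₀ hH0, abs_le]
  push_cast at hu hv
  constructor <;> linarith [hu.1, hu.2, hv.1, hv.2]

/-- Counting the points whose cell has a given property. -/
theorem abs_card_filter_cells_sub_le {M : Finset ι} {a : ι → Fin (n + 1) → ZMod p} {E : ℝ}
    (hE0 : 0 ≤ E) (hE : ∀ h : Fin (n + 1) → ZMod p, h ≠ 0 →
      ‖∑ m ∈ M, ZMod.stdAddChar (∑ r, h r * a m r)‖ ≤ E) {H : ℕ} (hH : 0 < H) (hHp : H ≤ p)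
    (hM : M.card ≤ p ^ (n + 1)) {G b : (Fin (n + 1) → ℕ) → Prop} [DecidablePred G]
    [DecidablePred b] (hGb : ∀ J ∈ gridIndices n H, ∀ i, i + 1 < H →
      ¬ (G (Fin.cons i J) ↔ G (Fin.cons (i + 1) J)) →
        b (Fin.cons i J) ∨ b (Fin.cons (i + 1) J)) :
    |((M.filter fun m => G fun r => H * (a m r).val / p).card : ℝ) -
        M.card * (((gridIndices (n + 1) H).filter G).card * (1 / H : ℝ) ^ (n + 1))| ≤
      E * (4 + 2 * Real.log p) ^ (n + 1) *
        (H ^ n + 2 * ((gridIndices (n + 1) H).filter b).card) +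
      (n + 1) * 2 ^ n * (p ^ n * H) := by
  have hp : 0 < p := Nat.pos_of_ne_zero (NeZero.ne p)
  have hp0 : (0 : ℝ) < p := by exact_mod_cast hp
  have hH0 : (0 : ℝ) < H := by exact_mod_cast hH
  have hmain := norm_sum_discrepancy_cells_le hE0 hE hH hGb
  set Z := (gridIndices (n + 1) H).filter G with hZ
  set q : (Fin (n + 1) → ℕ) → ℂ := fun J => ∏ r, ((p : ℂ)⁻¹ * ∑ x, cellIndicator p H (J r) x)
  -- Each side has density within 1/p of 1/H, hence at most 2/H since H ≤ p. Over at most H^(n+1)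
  -- cells and p^(n+1) points this amounts to (n+1) 2^n p^n H.
  have hq : ∀ J ∈ Z, ‖q J - (H : ℂ)⁻¹ ^ (n + 1)‖ ≤
      (n + 1 : ℕ) * (p : ℝ)⁻¹ * (2 * (H : ℝ)⁻¹) ^ (n + 1 - 1) := by
    intro J hJ
    have hJ := mem_gridIndices.1 (Finset.mem_filter.1 hJ).1
    have hpH : (p : ℝ)⁻¹ ≤ (H : ℝ)⁻¹ := inv_anti₀ hH0 (by exact_mod_cast hHp)
    have hnormH : ‖(H : ℂ)⁻¹‖ = (H : ℝ)⁻¹ := by rw [norm_inv, Complex.norm_natCast]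
    refine norm_prod_sub_pow_le (fun r => ?_) ?_ (fun r =>
      norm_inv_mul_sum_cellIndicator_sub_le (hJ r)) (by positivity)
    · have h1 := norm_sub_norm_le ((p : ℂ)⁻¹ * ∑ x, cellIndicator p H (J r) x) (H : ℂ)⁻¹
      have h2 := norm_inv_mul_sum_cellIndicator_sub_le (p := p) (hJ r)
      linarith
    · rw [hnormH]
      linarith [inv_pos.2 hH0]
  have hcount : ∑ J ∈ Z, ∑ m ∈ M, ∏ r, cellIndicator p H (J r) (a m r) =
      ((M.filter fun m => G fun r => H * (a m r).val / p).card : ℂ) := by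
    rw [Finset.sum_comm, Finset.card_filter]
    push_cast
    refine Finset.sum_congr rfl fun m _ => ?_
    have h1 : ∀ J : Fin (n + 1) → ℕ, ∏ r, cellIndicator p H (J r) (a m r) =
        if (fun r => H * (a m r).val / p) = J then 1 else 0 := by
      intro J
      simp only [cellIndicator, Finset.prod_ite_zero, Finset.prod_const_one, funext_iff,
        Finset.mem_univ, true_imp_iff]
    simp only [h1]
    rw [Finset.sum_ite_eq]
    refine if_congr ?_ rfl rfl
    rw [hZ, Finset.mem_filter, and_iff_right_iff_imp]
    refine fun _ => mem_gridIndices.2 fun r => ?_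
    rw [Nat.div_lt_iff_lt_mul hp]
    exact Nat.mul_lt_mul_of_pos_left (ZMod.val_lt _) hH
  rw [← Finset.sum_filter] at hmain
  simp only [discrepancy] at hmain
  rw [Finset.sum_sub_distrib, hcount, ← Finset.mul_sum] at hmain
  have hsum : ‖(M.card : ℂ) * ∑ J ∈ Z, q J - M.card * (Z.card * (H : ℂ)⁻¹ ^ (n + 1))‖ ≤
      (n + 1) * 2 ^ n * (p ^ n * H) := by
    rw [← mul_sub, ← nsmul_eq_mul Z.card, ← Finset.sum_const, ← Finset.sum_sub_distrib, norm_mul,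
      Complex.norm_natCast]
    have h1 := norm_sum_le_of_le _ hq
    rw [Finset.sum_const, nsmul_eq_mul, Nat.add_sub_cancel] at h1
    have h2 : (Z.card : ℝ) ≤ (H : ℝ) ^ (n + 1) := by
      exact_mod_cast (Finset.card_filter_le _ _).trans (card_gridIndices H).le
    have h3 : (M.card : ℝ) ≤ (p : ℝ) ^ (n + 1) := by exact_mod_cast hM
    calc _ ≤ (p : ℝ) ^ (n + 1) *
          ((H : ℝ) ^ (n + 1) * ((n + 1 : ℕ) * (p : ℝ)⁻¹ * (2 * (H : ℝ)⁻¹) ^ n)) := by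
          refine mul_le_mul h3 (h1.trans ?_) (norm_nonneg _) (by positivity)
          exact mul_le_mul_of_nonneg_right h2 (by positivity)
      _ = _ := by
          push_cast
          simp only [mul_pow, inv_pow]
          field_simp
          ring
  have hfin := (norm_sub_le_norm_sub_add_norm_sub _ _ _).trans (add_le_add hmain hsum)
  refine le_trans (le_of_eq ?_) hfin
  rw [← Real.norm_eq_abs, ← Complex.norm_real]
  push_cast
  rw [one_div]

end

/-! ### Counting points in a set with piecewise smooth boundary -/

section
open MeasureTheory

theorem mem_gridCell_of_zmod {p n H : ℕ} [NeZero p] (hH : 0 < H) (x : Fin n → ZMod p) :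
    (fun r => ((x r).val : ℝ) / p) ∈ gridCell H fun r => H * (x r).val / p := by
  have hp : 0 < p := Nat.pos_of_ne_zero (NeZero.ne p)
  have hp0 : (0 : ℝ) < p := by exact_mod_cast hp
  refine (mem_gridCell hH).2 fun r => ?_
  rw [← mul_div_assoc, le_div_iff₀ hp0, div_le_iff₀ hp0]
  refine ⟨by exact_mod_cast Nat.div_mul_le_self _ _, ?_⟩
  have h := (Nat.lt_mul_of_div_lt (Nat.lt_succ_self (H * (x r).val / p)) hp).le
  rw [Nat.succ_eq_add_one] at h
  exact_mod_cast h

/-- The number of points in a set with piecewise smooth boundary, in terms of bounds for the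
exponential sums formed with the points. -/
theorem abs_card_filter_mem_sub_volume_le {p n H C : ℕ} [NeZero p] {ι : Type*} {M : Finset ι}
    {a : ι → Fin (n + 1) → ZMod p} {E : ℝ} (hE0 : 0 ≤ E)
    (hE : ∀ h : Fin (n + 1) → ZMod p, h ≠ 0 →
      ‖∑ m ∈ M, ZMod.stdAddChar (∑ r, h r * a m r)‖ ≤ E) (hH : 0 < H) (hHp : H ≤ p)
    (hM : M.card ≤ p ^ (n + 1)) {Ω : Set (Fin (n + 1) → ℝ)} (hΩ : Ω ⊆ Set.Icc 0 1)
    (hC : (boundaryCells Ω H).card ≤ C * H ^ n) {s : Finset ι}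
    (hs : ∀ m, m ∈ s ↔ m ∈ M ∧ (fun r => ((a m r).val : ℝ) / p) ∈ Ω) :
    |(s.card : ℝ) - (p : ℝ) ^ (n + 1) * (volume Ω).toReal| ≤
      E * (4 + 2 * Real.log p) ^ (n + 1) * ((1 + 2 * C) * H ^ n) +
        (n + 1) * 2 ^ n * (p ^ n * H) + C * (p ^ (n + 1) / H) + (p ^ (n + 1) - M.card) := by
  classical
  have hp : 0 < p := Nat.pos_of_ne_zero (NeZero.ne p)
  have hp0 : (0 : ℝ) < p := by exact_mod_cast hp
  have hp1 : (1 : ℝ) ≤ p := by exact_mod_cast hp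
  have hH0 : (0 : ℝ) < H := by exact_mod_cast hH
  set w : ℝ := (1 / H : ℝ) ^ (n + 1) with hw
  have hw0 : 0 < w := by positivity
  -- Inner and outer approximation of Ω by cells. For both, neighbouring cells can differ only if
  -- one of them meets the boundary, because they share a point.
  let G₁ : (Fin (n + 1) → ℕ) → Prop := fun J => gridCell H J ⊆ Ω
  let G₂ : (Fin (n + 1) → ℕ) → Prop := fun J => (gridCell H J ∩ Ω).Nonempty
  have hadj : ∀ J ∈ gridIndices n H, ∀ i, i + 1 < H →
      ((Fin.cons i J : Fin (n + 1) → ℕ) ∈ gridIndices (n + 1) H ∧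
        (Fin.cons (i + 1) J : Fin (n + 1) → ℕ) ∈ gridIndices (n + 1) H) := by
    intro J hJ i hi
    constructor <;>
    · refine mem_gridIndices.2 fun r => Fin.cases ?_ (fun r => ?_) r
      · rw [Fin.cons_zero]
        omega
      · exact mem_gridIndices.1 hJ r
  have hne : ∀ {x : Fin (n + 1) → ℝ} {A B : Set (Fin (n + 1) → ℝ)}, x ∈ A → x ∈ B →
    (A ∩ B).Nonempty := fun h h' => ⟨_, h, h'⟩
  have hb₁ : ∀ J ∈ gridIndices n H, ∀ i, i + 1 < H →
      ¬ (G₁ (Fin.cons i J) ↔ G₁ (Fin.cons (i + 1) J)) →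
        Fin.cons i J ∈ boundaryCells Ω H ∨ Fin.cons (i + 1) J ∈ boundaryCells Ω H := by
    intro J hJ i hi hG
    by_contra hb
    rw [not_or] at hb
    obtain ⟨x, hx, hx'⟩ := gridCell_cons_inter_nonempty hH i J
    exact hG ⟨fun h => gridCell_subset_of_not_mem_boundaryCells (hadj J hJ i hi).2 hb.2
      (hne hx' (h hx)), fun h => gridCell_subset_of_not_mem_boundaryCells (hadj J hJ i hi).1 hb.1
      (hne hx (h hx'))⟩
  have hb₂ : ∀ J ∈ gridIndices n H, ∀ i, i + 1 < H →
      ¬ (G₂ (Fin.cons i J) ↔ G₂ (Fin.cons (i + 1) J)) →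
        Fin.cons i J ∈ boundaryCells Ω H ∨ Fin.cons (i + 1) J ∈ boundaryCells Ω H := by
    intro J hJ i hi hG
    by_contra hb
    rw [not_or] at hb
    obtain ⟨x, hx, hx'⟩ := gridCell_cons_inter_nonempty hH i J
    exact hG ⟨fun h => hne hx' (gridCell_subset_of_not_mem_boundaryCells (hadj J hJ i hi).1 hb.1
      h hx), fun h => hne hx (gridCell_subset_of_not_mem_boundaryCells (hadj J hJ i hi).2 hb.2
      h hx')⟩
  have hcount₁ := abs_card_filter_cells_sub_le hE0 hE hH hHp hM hb₁
  have hcount₂ := abs_card_filter_cells_sub_le hE0 hE hH hHp hM hb₂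
  set Z₁ := (gridIndices (n + 1) H).filter G₁
  set Z₂ := (gridIndices (n + 1) H).filter G₂
  rw [← hw] at hcount₁ hcount₂
  have hbdry : (((gridIndices (n + 1) H).filter (· ∈ boundaryCells Ω H)).card : ℝ) ≤ C * H ^ n := by
    exact_mod_cast (Finset.card_le_card fun J hJ => (Finset.mem_filter.1 hJ).2).trans hC
  have hR : E * (4 + 2 * Real.log p) ^ (n + 1) * ((H : ℝ) ^ n +
      2 * ((gridIndices (n + 1) H).filter (· ∈ boundaryCells Ω H)).card) +
        (n + 1) * 2 ^ n * (p ^ n * H) ≤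
      E * (4 + 2 * Real.log p) ^ (n + 1) * ((1 + 2 * C) * H ^ n) +
        (n + 1) * 2 ^ n * (p ^ n * H) := by
    have hlog : 0 ≤ Real.log p := Real.log_nonneg hp1
    gcongr
    linarith
  have h₁ := (abs_le.1 (hcount₁.trans hR)).1
  have h₂ := (abs_le.1 (hcount₂.trans hR)).2
  set R := E * (4 + 2 * Real.log p) ^ (n + 1) * ((1 + 2 * C) * H ^ n) +
    (n + 1) * 2 ^ n * (p ^ n * H)
  have hs₁ : ((M.filter fun m => G₁ fun r => H * (a m r).val / p).card : ℝ) ≤ s.card := by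
    refine Nat.cast_le.2 (Finset.card_le_card fun m hm => ?_)
    obtain ⟨hm1, hm2⟩ := Finset.mem_filter.1 hm
    exact (hs m).2 ⟨hm1, hm2 (mem_gridCell_of_zmod hH (a m))⟩
  have hs₂ : (s.card : ℝ) ≤ (M.filter fun m => G₂ fun r => H * (a m r).val / p).card := by
    refine Nat.cast_le.2 (Finset.card_le_card fun m hm => ?_)
    obtain ⟨hm1, hm2⟩ := (hs m).1 hm
    exact Finset.mem_filter.2 ⟨hm1, hne (mem_gridCell_of_zmod hH (a m)) hm2⟩
  have hZ : (Z₂.card : ℝ) ≤ Z₁.card + C * H ^ n := by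
    have h : Z₂ ⊆ Z₁ ∪ boundaryCells Ω H := by
      intro J hJ
      obtain ⟨hJ1, hJ2⟩ := Finset.mem_filter.1 hJ
      by_cases hb : J ∈ boundaryCells Ω H
      · exact Finset.mem_union_right _ hb
      · exact Finset.mem_union_left _ (Finset.mem_filter.2
          ⟨hJ1, gridCell_subset_of_not_mem_boundaryCells hJ1 hb hJ2⟩)
    have := (Finset.card_le_card h).trans ((Finset.card_union_le _ _).trans
      (Nat.add_le_add_left hC _))
    exact_mod_cast this
  -- Only monotonicity and subadditivity of the measure are applied to Ω, so its measurability plays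
  -- no role.
  have hvol₁ := card_le_toReal_volume hH hΩ (s := Z₁) fun J hJ => (Finset.mem_filter.1 hJ).2
  have hvol₂ := toReal_volume_le_card hH hΩ (s := Z₂) fun J hJ h => Finset.mem_filter.2 ⟨hJ, h⟩
  have hvol₃ := toReal_volume_le_card hH hΩ (s := gridIndices (n + 1) H) fun J hJ _ => hJ
  rw [← hw] at hvol₁ hvol₂ hvol₃
  have hHw : (H : ℝ) ^ (n + 1) * w = 1 := by
    rw [hw, ← mul_pow, mul_one_div_cancel hH0.ne', one_pow]
  have hHw' : (p : ℝ) ^ (n + 1) * (C * H ^ n * w) = C * (p ^ (n + 1) / H) := by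
    rw [eq_div_of_mul_eq (pow_ne_zero _ hH0.ne') ((mul_comm _ _).trans hHw)]
    field_simp
    ring
  rw [card_gridIndices, Nat.cast_pow, hHw] at hvol₃
  have hMR : (M.card : ℝ) ≤ (p : ℝ) ^ (n + 1) := by exact_mod_cast hM
  have hM0 : (0 : ℝ) ≤ M.card := Nat.cast_nonneg _
  set V := (volume Ω).toReal
  set Q : ℝ := (p : ℝ) ^ (n + 1)
  have hV0 : 0 ≤ V := ENNReal.toReal_nonneg
  have hZw : Z₂.card * w ≤ Z₁.card * w + C * H ^ n * w := by
    rw [← add_mul]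
    exact mul_le_mul_of_nonneg_right hZ hw0.le
  have hQ0 : 0 ≤ Q := by positivity
  have hX0 : 0 ≤ C * H ^ n * w := by positivity
  have hA : M.card * (Z₂.card * w) ≤ Q * V + Q * (C * H ^ n * w) := by
    rw [← mul_add]
    exact mul_le_mul hMR (by linarith) (by positivity) hQ0
  -- The deficit Q - |M| is multiplied by the volume, which is at most 1 by `hvol₃`.
  have hB : Q * V ≤ M.card * (Z₁.card * w) + Q * (C * H ^ n * w) + (Q - M.card) := by
    have h3 : M.card * V ≤ M.card * (Z₁.card * w) + M.card * (C * H ^ n * w) := by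
      rw [← mul_add]
      exact mul_le_mul_of_nonneg_left (by linarith) hM0
    have h4 : (M.card : ℝ) * (C * H ^ n * w) ≤ Q * (C * H ^ n * w) :=
      mul_le_mul_of_nonneg_right hMR hX0
    have h5 : (Q - M.card) * V ≤ (Q - M.card) * 1 :=
      mul_le_mul_of_nonneg_left hvol₃ (by linarith)
    linarith
  rw [abs_le]
  constructor <;> linarith

end

/-! ### Choice of parameters and the theorem -/

theorem rho_nonneg {k : ℕ} (hk : 2 ≤ k) : 0 ≤ rho k := by
  unfold rho
  split_ifs
  · norm_num
  · have h : (1 : ℝ) ≤ ⌈(k : ℝ) / 2⌉ := by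
      have : (0 : ℤ) < ⌈(k : ℝ) / 2⌉ := Int.ceil_pos.2 (by positivity)
      exact_mod_cast this
    have hk0 : (0 : ℝ) ≤ k := Nat.cast_nonneg k
    exact div_nonneg (by linarith) (by positivity)

/-- The right side is the saving in the exponential sum. There is equality at k = 2; for k ≥ 3 the
inequality follows from ⌈k/2⌉ < k/2 + 1. -/
theorem rho_le {k : ℕ} (hk : 2 ≤ k) : rho k ≤ 1 / (2 * k + 4) := by
  unfold rho
  split_ifs with h2
  · rw [h2]
    norm_num
  · have h1 : (1 : ℝ) ≤ ⌈(k : ℝ) / 2⌉ := by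
      have : (0 : ℤ) < ⌈(k : ℝ) / 2⌉ := Int.ceil_pos.2 (by positivity)
      exact_mod_cast this
    have h3 := Int.ceil_lt_add_one ((k : ℝ) / 2)
    have hk0 : (0 : ℝ) ≤ k := Nat.cast_nonneg k
    rw [div_le_div_iff₀ (by positivity) (by positivity)]
    nlinarith

/-- A bound with arbitrarily small powers is a bound with a power tending to zero. -/
theorem exists_tendsto_zero_forall_le_rpow {A : ℕ → ℝ} (hA : ∀ j, 1 ≤ A j) :
    ∃ δ : ℕ → ℝ, Filter.Tendsto δ Filter.atTop (nhds 0) ∧ ∀ p : ℕ, 2 ≤ p → ∀ X : ℝ,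
      (∀ j : ℕ, X ≤ A j * (p : ℝ) ^ (1 / ((j : ℝ) + 1))) → X ≤ (p : ℝ) ^ δ p := by
  -- p^(f p j) is the j-th bound, so δ(p) is the infimum of these exponents over j. For fixed j the
  -- logarithmic term tends to 0, which leaves 1/(j+1).
  let f : ℕ → ℕ → ℝ := fun p j => 1 / ((j : ℝ) + 1) + Real.log (A j) / Real.log p
  have hf : ∀ p j, 0 ≤ f p j := fun p j =>
    add_nonneg (by positivity) (div_nonneg (Real.log_nonneg (hA j)) (Real.log_natCast_nonneg p))
  have hbdd : ∀ p, BddBelow (Set.range (f p)) := fun p => ⟨0, by rintro _ ⟨j, rfl⟩; exact hf p j⟩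
  refine ⟨fun p => ⨅ j, f p j, ?_, fun p hp X hX => ?_⟩
  · refine Metric.tendsto_atTop'.2 fun ε hε => ?_
    obtain ⟨j, hj⟩ := exists_nat_one_div_lt (half_pos hε)
    have hlim : Filter.Tendsto (fun p : ℕ => Real.log (A j) / Real.log p) Filter.atTop (nhds 0) :=
      (Real.tendsto_log_atTop.comp tendsto_natCast_atTop_atTop).const_div_atTop _
    obtain ⟨N, hN⟩ := Filter.eventually_atTop.1 (hlim.eventually_lt_const (half_pos hε))
    refine ⟨N, fun p hp => ?_⟩
    rw [Real.dist_eq, sub_zero, abs_of_nonneg (Real.iInf_nonneg (hf p))]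
    refine (ciInf_le (hbdd p) j).trans_lt ?_
    have := hN p hp.le
    simp only [f]
    linarith
  · have hp1 : (1 : ℝ) < p := by exact_mod_cast hp
    have hp0 : (0 : ℝ) < p := by linarith
    rcases le_or_gt X 0 with hX0 | hX0
    · exact hX0.trans (by positivity)
    have hlog : 0 < Real.log p := Real.log_pos hp1
    rw [Real.le_rpow_iff_log_le hX0 hp0, ← div_le_iff₀ hlog]
    refine le_ciInf fun j => ?_
    have hA0 : 0 < A j := zero_lt_one.trans_le (hA j)
    have h := Real.log_le_log hX0 (hX j)
    rw [Real.log_mul hA0.ne' (by positivity), Real.log_rpow hp0] at h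
    rw [div_le_iff₀ hlog, add_mul, div_mul_cancel₀ _ hlog.ne']
    linarith

theorem orbitCount_eq_card {p n : ℕ} [Fact p.Prime] {F : Type*} [Field F] [Algebra (ZMod p) F]
    (hF : Nat.card F = p ^ n) {θ : F} (hθ : IsPrimitiveRoot θ (p ^ n - 1)) (k : ℕ)
    (Ω : Set (Fin n → ℝ)) : ∃ s : Finset ℕ, orbitCount hF hθ k Ω = s.card ∧
      ∀ m, m ∈ s ↔ m ∈ Finset.Icc 1 (p ^ n - 1) ∧
        (fun r => ((coordVec hF hθ (m ^ k) r).val : ℝ) / p) ∈ Ω := by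
  classical
  refine ⟨(Finset.Icc 1 (p ^ n - 1)).filter fun m => orbitPoint hF hθ (m ^ k) ∈ Ω, ?_,
    fun m => Finset.mem_filter⟩
  rw [orbitCount, ← Set.ncard_coe_finset]
  congr 1
  ext m
  simp

/-- The character sums formed with the coordinate vectors are sums of characters of the field. -/
theorem exists_addChar_coordVec {p n : ℕ} [Fact p.Prime] {F : Type*} [Field F]
    [Algebra (ZMod p) F] (hF : Nat.card F = p ^ n) {θ : F}
    (hθ : IsPrimitiveRoot θ (p ^ n - 1)) {h : Fin n → ZMod p} (hh : h ≠ 0) :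
    ∃ ψ : AddChar F ℂ, ψ ≠ 1 ∧
      ∀ m, ZMod.stdAddChar (∑ r, h r * coordVec hF hθ m r) = ψ (θ ^ m) := by
  let b := primitiveRootBasis hF hθ
  let f : F →+ ZMod p :=
    { toFun := fun x => ∑ r, h r * b.repr x r
      map_zero' := by simp
      map_add' := fun x y => by
        simp only [map_add, Finsupp.add_apply, mul_add, Finset.sum_add_distrib] }
  refine ⟨ZMod.stdAddChar.compAddMonoidHom f, fun hψ => hh (funext fun r => ?_), fun m => rfl⟩
  have h1 := DFunLike.congr_fun hψ (b r)
  rw [AddChar.compAddMonoidHom_apply, AddChar.one_apply,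
    ← AddChar.map_zero_eq_one (ZMod.stdAddChar (N := p))] at h1
  have h2 := ZMod.injective_stdAddChar h1
  have h3 : f (b r) = h r := by
    simp [f, Finsupp.single_apply]
  rw [h3] at h2
  exact h2

/-- The numerical combination of the error terms, with the grid of mesh about `p^(-ρ)`. -/
theorem error_terms_le {p n H C : ℕ} {ρ σ ε A B : ℝ} (hp : 1 ≤ p) (hσ : σ ≤ 1 / 2)
    (hρσ : ρ ≤ σ) (hε : 0 < ε) (hA : 0 ≤ A) (hH1 : (p : ℝ) ^ ρ ≤ H)
    (hH2 : (H : ℝ) ≤ 2 * (p : ℝ) ^ ρ)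
    (hB : (4 + 2 * Real.log p) ^ (n + 1) ≤ B * (p : ℝ) ^ (ε / 2)) :
    A * ((p : ℝ) ^ (n + 1)) ^ (1 - σ + ε / (2 * (n + 1))) * (4 + 2 * Real.log p) ^ (n + 1) *
        ((1 + 2 * C) * (H : ℝ) ^ n) + (n + 1) * 2 ^ n * ((p : ℝ) ^ n * H) +
        C * ((p : ℝ) ^ (n + 1) / H) + 1 ≤
      ((1 + 2 * C) * 2 ^ n + (n + 1) * 2 ^ (n + 1) + C + 1) *
        (max 1 (A * B) * (p : ℝ) ^ ((n + 1 : ℝ) - ρ + ε)) := by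
  have hp1 : (1 : ℝ) ≤ p := by exact_mod_cast hp
  have hp0 : (0 : ℝ) < p := by linarith
  have hH0 : (0 : ℝ) < H := (Real.rpow_pos_of_pos hp0 _).trans_le hH1
  have hn0 : (0 : ℝ) ≤ n := Nat.cast_nonneg n
  set P := (p : ℝ) ^ ((n + 1 : ℝ) - ρ + ε)
  set T := max 1 (A * B) * P
  have hP1 : 1 ≤ P := Real.one_le_rpow hp1 (by linarith)
  have hPT : P ≤ T := le_mul_of_one_le_left (by linarith) (le_max_left _ _)
  have hmono : ∀ {x y : ℝ}, x ≤ y → (p : ℝ) ^ x ≤ (p : ℝ) ^ y :=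
    fun h => Real.rpow_le_rpow_of_exponent_le hp1 h
  have hHn : (H : ℝ) ^ n ≤ 2 ^ n * (p : ℝ) ^ (n * ρ) := by
    refine (pow_le_pow_left₀ hH0.le hH2 n).trans (le_of_eq ?_)
    rw [mul_pow, ← Real.rpow_natCast ((p : ℝ) ^ ρ), ← Real.rpow_mul hp0.le, mul_comm ρ]
  have h1 : A * ((p : ℝ) ^ (n + 1)) ^ (1 - σ + ε / (2 * (n + 1))) *
      (4 + 2 * Real.log p) ^ (n + 1) * ((1 + 2 * C) * (H : ℝ) ^ n) ≤
        (1 + 2 * C) * 2 ^ n * T := by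
    have hq : ((p : ℝ) ^ (n + 1)) ^ (1 - σ + ε / (2 * (n + 1))) =
        (p : ℝ) ^ ((n + 1) * (1 - σ) + ε / 2) := by
      rw [← Real.rpow_natCast, ← Real.rpow_mul hp0.le]
      congr 1
      push_cast
      field_simp
    have hB0 : 0 ≤ B := by
      by_contra hneg
      have hlog : 0 ≤ Real.log p := Real.log_nonneg hp1
      have h2 : 0 < (4 + 2 * Real.log p) ^ (n + 1) := by positivity
      have h3 : B * (p : ℝ) ^ (ε / 2) < 0 :=
        mul_neg_of_neg_of_pos (not_le.1 hneg) (by positivity)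
      linarith
    calc _ ≤ A * (p : ℝ) ^ ((n + 1) * (1 - σ) + ε / 2) * (B * (p : ℝ) ^ (ε / 2)) *
          ((1 + 2 * C) * (2 ^ n * (p : ℝ) ^ (n * ρ))) := by
          rw [hq]
          gcongr
      _ = (1 + 2 * C) * 2 ^ n * (A * B * ((p : ℝ) ^ ((n + 1) * (1 - σ) + ε / 2) *
          (p : ℝ) ^ (ε / 2) * (p : ℝ) ^ (n * ρ))) := by ring
      _ ≤ (1 + 2 * C) * 2 ^ n * T := by
          rw [← Real.rpow_add hp0, ← Real.rpow_add hp0]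
          -- This is where ρ ≤ σ enters: (n+1)(1-σ) + nρ ≤ n + 1 - ρ.
          have h4 : (p : ℝ) ^ ((n + 1) * (1 - σ) + ε / 2 + ε / 2 + n * ρ) ≤ P :=
            hmono (by nlinarith)
          have h5 := le_max_right 1 (A * B)
          gcongr
          exact mul_le_mul h5 h4 (by positivity) (by positivity)
  -- Here n + ρ ≤ n + 1 - ρ because ρ ≤ σ ≤ 1/2.
  have h2 : (n + 1) * 2 ^ n * ((p : ℝ) ^ n * H) ≤ (n + 1) * 2 ^ (n + 1) * T := by
    calc (n + 1) * 2 ^ n * ((p : ℝ) ^ n * H) ≤ (n + 1) * 2 ^ n * ((p : ℝ) ^ n * (2 * p ^ ρ)) := by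
          gcongr
      _ = (n + 1) * 2 ^ (n + 1) * (p : ℝ) ^ (n + ρ) := by
          rw [Real.rpow_add hp0, Real.rpow_natCast]
          ring
      _ ≤ (n + 1) * 2 ^ (n + 1) * T := by
          gcongr
          exact (hmono (by linarith)).trans hPT
  have h3 : C * ((p : ℝ) ^ (n + 1) / H) ≤ C * T := by
    gcongr
    calc (p : ℝ) ^ (n + 1) / H ≤ (p : ℝ) ^ (n + 1) / (p : ℝ) ^ ρ := by gcongr
      _ = (p : ℝ) ^ ((n + 1 : ℝ) - ρ) := by
          rw [Real.rpow_sub hp0]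
          congr 1
          exact_mod_cast (Real.rpow_natCast (p : ℝ) (n + 1)).symm
      _ ≤ T := (hmono (by linarith)).trans hPT
  have h4 := hP1.trans hPT
  linarith

theorem exists_log_pow_le_rpow (n : ℕ) {ε : ℝ} (hε : 0 < ε) :
    ∃ B : ℝ, ∀ p : ℕ, 1 ≤ p → (4 + 2 * Real.log p) ^ n ≤ B * (p : ℝ) ^ ε := by
  set η := ε / (n + 1)
  have hη : 0 < η := by positivity
  refine ⟨(4 + 2 / η) ^ n, fun p hp => ?_⟩
  have hp1 : (1 : ℝ) ≤ p := by exact_mod_cast hp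
  have hp0 : (0 : ℝ) < p := by linarith
  have hlog : 0 ≤ Real.log p := Real.log_nonneg hp1
  have h1 : 4 + 2 * Real.log p ≤ (4 + 2 / η) * (p : ℝ) ^ η := by
    have h2 := Real.log_le_rpow_div hp0.le hη
    have h3 := Real.one_le_rpow hp1 hη.le
    calc 4 + 2 * Real.log p ≤ 4 * (p : ℝ) ^ η + 2 * ((p : ℝ) ^ η / η) := by linarith
      _ = _ := by ring
  refine (pow_le_pow_left₀ (by positivity) h1 n).trans ?_
  rw [mul_pow, ← Real.rpow_natCast ((p : ℝ) ^ η), ← Real.rpow_mul hp0.le]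
  refine mul_le_mul_of_nonneg_left (Real.rpow_le_rpow_of_exponent_le hp1 ?_) (by positivity)
  rw [div_mul_eq_mul_div, div_le_iff₀ (by positivity)]
  nlinarith

/-- A is chosen before Ω, which enters only through the constant C of its boundary. This uniformity
allows one function δ to serve all Ω. -/
theorem exists_abs_orbitCount_sub_le_rpow (n : ℕ) {k : ℕ} (hk : 2 ≤ k) {ε : ℝ} (hε : 0 < ε) :
    ∃ A : ℝ, 1 ≤ A ∧ ∀ Ω : Set (Fin (n + 1) → ℝ), Ω ⊆ Set.Icc 0 1 → ∀ C : ℕ,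
      (∀ H : ℕ, 0 < H → (boundaryCells Ω H).card ≤ C * H ^ n) →
        ∀ (p : ℕ) [Fact p.Prime] (F : Type u) [Field F] [Algebra (ZMod p) F]
          (hF : Nat.card F = p ^ (n + 1)) (θ : F) (hθ : IsPrimitiveRoot θ (p ^ (n + 1) - 1)),
          |(orbitCount hF hθ k Ω : ℝ) - (p : ℝ) ^ (n + 1) * (MeasureTheory.volume Ω).toReal| ≤
            ((1 + 2 * C) * 2 ^ n + (n + 1) * 2 ^ (n + 1) + C + 1) *
              (A * (p : ℝ) ^ ((n + 1 : ℝ) - rho k + ε)) := by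
  obtain ⟨A, hA0, hA⟩ := exists_norm_sum_pow_pow_le.{u} hk (ε := ε / (2 * (n + 1)))
    (by positivity)
  obtain ⟨B, hB⟩ := exists_log_pow_le_rpow (n + 1) (half_pos hε)
  refine ⟨max 1 (A * B), le_max_left _ _, fun Ω hΩ C hC p _ F _ _ hF θ hθ => ?_⟩
  have hp : p.Prime := Fact.out
  have : Finite F := Nat.finite_of_card_ne_zero (by rw [hF]; exact pow_ne_zero _ hp.ne_zero)
  have : Fintype F := Fintype.ofFinite F
  have hcard : Fintype.card F = p ^ (n + 1) := Nat.card_eq_fintype_card.symm.trans hF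
  have hp1 : (1 : ℝ) ≤ p := by exact_mod_cast hp.one_le
  have hp0 : (0 : ℝ) < p := by linarith
  have hk0 : (2 : ℝ) ≤ k := by exact_mod_cast hk
  have hσ : 1 / (2 * (k : ℝ) + 4) ≤ 1 / 2 :=
    one_div_le_one_div_of_le (by norm_num) (by linarith)
  have hρ0 := rho_nonneg hk
  have hρσ := rho_le hk
  have hone : 1 ≤ (p : ℝ) ^ rho k := Real.one_le_rpow hp1 hρ0
  -- Mesh about p^(-ρ): the boundary cells then contribute p^(n+1-ρ), and finer cells would not be
  -- needed.
  set H := ⌈(p : ℝ) ^ rho k⌉₊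
  have hH : 0 < H := Nat.ceil_pos.2 (by linarith)
  have hHp : H ≤ p := by
    refine Nat.ceil_le.2 ((Real.rpow_le_rpow_of_exponent_le hp1 ?_).trans (Real.rpow_one _).le)
    linarith
  have hH1 : (p : ℝ) ^ rho k ≤ H := Nat.le_ceil _
  have hH2 : (H : ℝ) ≤ 2 * (p : ℝ) ^ rho k := by
    have := Nat.ceil_lt_add_one (zero_le_one.trans hone)
    linarith
  obtain ⟨s, hs, hsm⟩ := orbitCount_eq_card hF hθ k Ω
  have hM : (Finset.Icc 1 (p ^ (n + 1) - 1)).card = p ^ (n + 1) - 1 := by simp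
  have hE : ∀ h : Fin (n + 1) → ZMod p, h ≠ 0 →
      ‖∑ m ∈ Finset.Icc 1 (p ^ (n + 1) - 1),
        ZMod.stdAddChar (∑ r, h r * coordVec hF hθ (m ^ k) r)‖ ≤
          A * ((p : ℝ) ^ (n + 1)) ^ (1 - 1 / (2 * (k : ℝ) + 4) + ε / (2 * (n + 1))) := by
    intro h hh
    obtain ⟨ψ, hψ, hψm⟩ := exists_addChar_coordVec hF hθ hh
    simp only [hψm]
    have := hA F ψ hψ θ (by rwa [hcard])
    rw [hcard] at this
    exact_mod_cast this
  rw [hs]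
  refine (abs_card_filter_mem_sub_volume_le (by positivity) hE hH hHp
    (hM.le.trans (Nat.sub_le _ _)) hΩ (hC H hH) hsm).trans ?_
  have hlast : (p : ℝ) ^ (n + 1) - (Finset.Icc 1 (p ^ (n + 1) - 1)).card = 1 := by
    rw [hM, Nat.cast_sub (Nat.one_le_pow _ _ hp.pos)]
    push_cast
    ring
  rw [hlast]
  exact error_terms_le hp.one_le hσ hρσ hε hA0 hH1 hH2 (hB p hp.one_le)

theorem theorem2p7 (n k : ℕ) (hn : 1 ≤ n) (hk : 2 ≤ k) :
    ∃ δ : ℕ → ℝ, Filter.Tendsto δ Filter.atTop (nhds 0) ∧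
      ∀ Ω : Set (Fin n → ℝ), Ω ⊆ Set.Icc 0 1 → HasPiecewiseSmoothBoundary Ω →
        ∃ C : ℝ, ∀ (p : ℕ) [Fact p.Prime] (F : Type*) [Field F] [Algebra (ZMod p) F]
          (hF : Nat.card F = p ^ n) (θ : F) (hθ : IsPrimitiveRoot θ (p ^ n - 1)),
          |(orbitCount hF hθ k Ω : ℝ) - (p : ℝ) ^ n * (MeasureTheory.volume Ω).toReal| ≤
            C * (p : ℝ) ^ ((n : ℝ) - rho k + δ p) := by
  obtain ⟨n, rfl⟩ := Nat.exists_eq_add_of_le' hn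
  -- The exponents ε = 1/(j+1) are those combined into δ; the constants A j do not involve Ω.
  choose A hA1 hA using fun j : ℕ =>
    exists_abs_orbitCount_sub_le_rpow n hk (ε := 1 / ((j : ℝ) + 1)) (by positivity)
  obtain ⟨δ, hδ, hδX⟩ := exists_tendsto_zero_forall_le_rpow hA1
  refine ⟨δ, hδ, fun Ω hΩ hbd => ?_⟩
  obtain ⟨C, hC⟩ := hbd.exists_card_boundaryCells_le
  set K : ℝ := (1 + 2 * C) * 2 ^ n + (n + 1) * 2 ^ (n + 1) + C + 1
  have hK : 0 < K := by positivity
  refine ⟨K, fun p _ F _ _ hF θ hθ => ?_⟩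
  have hp : p.Prime := Fact.out
  have hp0 : (0 : ℝ) < p := by exact_mod_cast hp.pos
  set Y := |(orbitCount hF hθ k Ω : ℝ) - (p : ℝ) ^ (n + 1) * (MeasureTheory.volume Ω).toReal|
  have hD : 0 < K * (p : ℝ) ^ ((n + 1 : ℝ) - rho k) := by positivity
  have hX := hδX p hp.two_le (Y / (K * (p : ℝ) ^ ((n + 1 : ℝ) - rho k))) fun j => by
    rw [div_le_iff₀ hD]
    refine (hA j Ω hΩ C hC p F hF θ hθ).trans (le_of_eq ?_)
    rw [Real.rpow_add hp0]
    ring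
  rw [div_le_iff₀ hD] at hX
  refine hX.trans (le_of_eq ?_)
  push_cast
  rw [Real.rpow_add hp0 ((n + 1 : ℝ) - rho k)]
  ring
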